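/- Let $n\ge 1$, let $P\subset\mathbb R^n$ be an open, bounded, convex set with $0\in P$, and let $h:\overline P\to[0,\infty)$ be measurable on $P$, bounded on $P$, and bounded below by a positive constant on every compact subset of $P$ (for example, $h$ continuous on $\overline P$ and positive on $P$). Write $dy^h=h(y)\,dy$ and $H=\int_P dy^h$. Assume: (A1) $dy^h$ is doubling: there is $C>0$ with $\int_{\overline P\cap(y_0+E)}dy^h\le C\int_{\overline P\cap(y_0+\frac12E)}dy^h$ for all $y_0\in\overline P$ and all ellipsoids $E$ centered at $0$. (A2) $h$ has a vanishing order, where $\mathtt v\in[0,\infty)$ is called a vanishing order of $h$ if there are a nonempty open cone $\mathtt C$ with apex $0$ and constants $C,\delta>0$ such that for each $y_0\in\partial P$ there is $A\in O(n)$ with $K_{y_0}:=(y_0+A\mathtt C)\cap B_\delta(y_0)\subset P$ and $h(y)\ge C^{-1}|y-y_0|^{\mathtt v}$ on $K_{y_0}$. Let $F(s)=\int_0^s f$ for $s\ge0$, with $f>0$ on $(0,\infty)$ integrable on bounded intervals, and let $G:(0,\infty)\to\mathbb R$ be differentiable with $G'=g>0$. Consider the following properties, in which all implicit constants are positive. *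 $\mathbf{H1}$: $g$ is a positive constant, and $\log F(t)=O(t)$ as $t\to\infty$. * $\mathbf{H2}_{\nu,\gamma}$ ($\gamma\ge\nu\ge0$): $G$ is concave and increasing, $G(1)=0$, $G(s)\to+\infty$ as $s\to\infty$; $-s^{-(n+\nu)}\lesssim G(s)$ on $(0,1]$, $G(s)\lesssim-s^{-(n+\nu)+1}$ on $(0,\frac12]$, and $\int_0^1G(s)s^{n+\nu-1}ds=-\infty$; $F$ is convex and increasing on $[0,\infty)$, $F(0)=0$, $F(s)\sim s^\gamma$ on $(0,1]$; and for every $\epsilon\in(0,1)$, $\log F(x)=O\big(G^{-1}(\epsilon G(\epsilon x))\big)$ as $x\to\infty$. It is called strong ($\mathbf{H2}^*$) if, in addition, $O$ can be replaced by $o$. * $\mathbf{H3}_{\nu,\gamma,\beta_1,\beta_2}$ ($\gamma>\nu\ge0$, $\beta_2\ge\beta_1\ge0$): $G<0$ is concave and increasing, $G(s)\to0$ as $s\to\infty$; $-s^{-(n+\nu)}\lesssim G(s)\lesssim-s^{-(n+\nu)+1}$ on $(0,1]$ and $\int_0^1G(s)s^{n+\nu-1}ds=-\infty$; $-s^{-(n+\beta_1)}\lesssim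 G(s)\lesssim-s^{-(n+\beta_2)}$ on $[1,\infty)$ and $\int_1^\infty|G(s)|s^{n-1}ds<\infty$; $F$ is convex and increasing on $[0,\infty)$, $F(0)=0$, $F(s)\sim s^\gamma$ on $(0,1]$; and $\log F(s)=O\big(s^{\frac{n+\beta_1}{n+\beta_2}}\big)$ as $s\to\infty$. It is called strong ($\mathbf{H3}^*$) if, in addition, $O$ can be replaced by $o$. Let $\mathcal C^+$ be the set of convex functions $v:\overline P\to(0,\infty)$. For $v\in\mathcal C^+$ let $u(x)=\sup_{y\in P}(\langle x,y\rangle-v(y))$ and, for $\Lambda\ge0$, put $$I(v)=\int_{\{u<0\}}F(-u(x))\,dx,\qquad J(v)=G^{-1}\Big(\frac1H\int_PG(v)\,dy^h\Big),\qquad \mathcal E_\Lambda(v)=-\log I(v)+\Lambda J(v),$$ where $J(v)=+\infty$ if $\int_P G(v)\,dy^h=+\infty$ and $J(v)=0$ if $\int_P G(v)\,dy^h=-\infty$. Let $$\mathcal C_P=\Big\{v\in\mathcal C^+:\ \int_P g(v(y))\,|y|\,dy^h<\infty,\ \int_Pg(v(y))\,y\,dy^h=0\Big\}.$$ Suppose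 that one of the following holds: * $(F,G)$ satisfies $\mathbf{H1}$ and $\int_P y\,dy^h=0$; * $(F,G)$ satisfies $\mathbf{H2}_{\nu,\gamma}$ with $\nu\ge\mathtt v$ for some vanishing order $\mathtt v$ of $h$; * $(F,G)$ satisfies $\mathbf{H3}_{\nu,\gamma,\beta_1,\beta_2}$ with $\nu\ge\mathtt v$ for some vanishing order $\mathtt v$ of $h$. Then there is $\Lambda_0\ge0$, depending only on $n$, $P$, $h$, the parameters ($\nu,\gamma,\beta_1,\beta_2$) and the implicit constants in the property in question, such that for every $\Lambda\ge\Lambda_0$ there is $v\in\mathcal C_P$ with $$\mathcal E_\Lambda(v)=\inf_{\mathcal C_P}\mathcal E_\Lambda\in\mathbb R .$$ If $\mathbf{H2}^*$ or $\mathbf{H3}^*$ holds (in the second or third case, respectively), then such a $v$ exists for every $\Lambda>0$. -/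

import Mathlib

open Set Filter Topology MeasureTheory Asymptotics
open scoped ENNReal

noncomputable section

namespace FreeBdyMA

/-! ### Structural conditions on the pair `(F, G)` -/

/-- `F (s) = ∫₀ˢ f` with `f > 0` locally integrable on `[0,∞)`, and `G` is an antiderivative
of `g > 0` on `(0,∞)`. -/
structure IsAntiderivPair (f g F G : ℝ → ℝ) : Prop where
  f_pos : ∀ s, 0 < s → 0 < f s
  f_int : ∀ s, 0 ≤ s → IntervalIntegrable f volume 0 s
  F_eq : ∀ s, 0 ≤ s → F s = ∫ t in (0 : ℝ)..s, f t
  g_pos : ∀ s, 0 < s → 0 < g s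
  G_deriv : ∀ s, 0 < s → HasDerivAt G (g s) s

/-- The inverse function of `G : (0,∞) → ℝ`. -/
def Ginv (G : ℝ → ℝ) : ℝ → ℝ := Function.invFunOn G (Ioi 0)

/-- Property H1, with `M` the implicit constant in `log F(t) = O(t)`. -/
structure IsH1 (M : ℝ) (F G : ℝ → ℝ) : Prop where
  G_deriv_const : ∃ c : ℝ, 0 < c ∧ ∀ s, 0 < s → HasDerivAt G c s
  log_F : IsBigOWith M atTop (fun t => Real.log (F t)) (fun t => t)

/-- Property H2 with parameters `ν, γ`; the implicit constants are `a, A` (bounds on `G` near `0`),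
`b, B` (bounds on `F` near `0`) and `M ε` (the growth condition at `∞`, for each `ε ∈ (0,1)`).
As `G 1 = 0`, the strictly negative upper bound on `G` is imposed on `(0, 1/2]`. -/
structure IsH2 (n : ℕ) (ν γ a A b B : ℝ) (M : ℝ → ℝ) (F G : ℝ → ℝ) : Prop where
  nu_nonneg : 0 ≤ ν
  nu_le : ν ≤ γ
  a_pos : 0 < a
  b_pos : 0 < b
  G_concave : ConcaveOn ℝ (Ioi 0) G
  G_mono : StrictMonoOn G (Ioi 0)
  G_one : G 1 = 0
  G_top : Tendsto G atTop atTop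
  G_lower : ∀ s ∈ Ioc (0 : ℝ) 1, -(A * s ^ (-((n : ℝ) + ν))) ≤ G s
  G_upper : ∀ s ∈ Ioc (0 : ℝ) (1 / 2), G s ≤ -(a * s ^ (-((n : ℝ) + ν) + 1))
  G_div : ∫⁻ s in Ioc (0 : ℝ) 1, ENNReal.ofReal (-(G s * s ^ ((n : ℝ) + ν - 1))) = ⊤
  F_convex : ConvexOn ℝ (Ici 0) F
  F_mono : StrictMonoOn F (Ici 0)
  F_zero : F 0 = 0
  F_lower : ∀ s ∈ Ioc (0 : ℝ) 1, b * s ^ γ ≤ F s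
  F_upper : ∀ s ∈ Ioc (0 : ℝ) 1, F s ≤ B * s ^ γ
  log_F : ∀ ε ∈ Ioo (0 : ℝ) 1,
    IsBigOWith (M ε) atTop (fun x => Real.log (F x)) (fun x => Ginv G (ε * G (ε * x)))

/-- The additional requirement in Strong Property H2. -/
def StrongH2Growth (F G : ℝ → ℝ) : Prop :=
  ∀ ε ∈ Ioo (0 : ℝ) 1, (fun x => Real.log (F x)) =o[atTop] (fun x => Ginv G (ε * G (ε * x)))

/-- Property H3 with parameters `ν, γ, β = (β₁, β₂)`; the implicit constants are `a, A` (bounds on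
`G` near `0`), `d, D` (bounds on `G` near `∞`), `b, B` (bounds on `F` near `0`) and `M` (the growth
condition at `∞`). -/
structure IsH3 (n : ℕ) (ν γ β₁ β₂ a A d D b B M : ℝ) (F G : ℝ → ℝ) : Prop where
  nu_nonneg : 0 ≤ ν
  nu_lt : ν < γ
  beta_nonneg : 0 ≤ β₁
  beta_le : β₁ ≤ β₂
  a_pos : 0 < a
  d_pos : 0 < d
  b_pos : 0 < b
  G_neg : ∀ s, 0 < s → G s < 0
  G_concave : ConcaveOn ℝ (Ioi 0) G
  G_mono : StrictMonoOn G (Ioi 0)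
  G_lim : Tendsto G atTop (𝓝 0)
  G_lower : ∀ s ∈ Ioc (0 : ℝ) 1, -(A * s ^ (-((n : ℝ) + ν))) ≤ G s
  G_upper : ∀ s ∈ Ioc (0 : ℝ) 1, G s ≤ -(a * s ^ (-((n : ℝ) + ν) + 1))
  G_div : ∫⁻ s in Ioc (0 : ℝ) 1, ENNReal.ofReal (-(G s * s ^ ((n : ℝ) + ν - 1))) = ⊤
  G_lower_top : ∀ s, 1 ≤ s → -(D * s ^ (-((n : ℝ) + β₁))) ≤ G s
  G_upper_top : ∀ s, 1 ≤ s → G s ≤ -(d * s ^ (-((n : ℝ) + β₂)))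
  G_int : IntegrableOn (fun s => G s * s ^ ((n : ℝ) - 1)) (Ioi 1)
  F_convex : ConvexOn ℝ (Ici 0) F
  F_mono : StrictMonoOn F (Ici 0)
  F_zero : F 0 = 0
  F_lower : ∀ s ∈ Ioc (0 : ℝ) 1, b * s ^ γ ≤ F s
  F_upper : ∀ s ∈ Ioc (0 : ℝ) 1, F s ≤ B * s ^ γ
  log_F : IsBigOWith M atTop (fun s => Real.log (F s))
    (fun s => s ^ (((n : ℝ) + β₁) / ((n : ℝ) + β₂)))

/-- The additional requirement in Strong Property H3. -/
def StrongH3Growth (n : ℕ) (β₁ β₂ : ℝ) (F : ℝ → ℝ) : Prop :=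
  (fun s => Real.log (F s)) =o[atTop] (fun s => s ^ (((n : ℝ) + β₁) / ((n : ℝ) + β₂)))

/-! ### Conditions on the density `h` -/

/-- `h(y) dy`, extended by zero outside `closure P`, is doubling with respect to all ellipsoids:
an ellipsoid centred at the origin is the image of the unit ball under an invertible linear map. -/
def IsDoubling {n : ℕ} (P : Set (EuclideanSpace ℝ (Fin n))) (h : EuclideanSpace ℝ (Fin n) → ℝ) :
    Prop :=
  ∃ C : ℝ, 0 < C ∧ ∀ y₀ ∈ closure P,
    ∀ T : EuclideanSpace ℝ (Fin n) ≃L[ℝ] EuclideanSpace ℝ (Fin n),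
      ∫ y in closure P ∩ (fun z => y₀ + T z) '' Metric.closedBall 0 1, h y ≤
        C * ∫ y in closure P ∩ (fun z => y₀ + T z) '' Metric.closedBall 0 (1 / 2), h y

/-- Condition A1: `h ≥ 0` on `closure P`, `h > 0` on `P`, and `h dy` is doubling on `P`.
In place of continuity of `h` on `closure P` only its consequences are kept: `h` is measurable and
bounded on `P`, and bounded below by a positive constant on each compact subset of `P`. -/
structure CondA1 {n : ℕ} (P : Set (EuclideanSpace ℝ (Fin n)))
    (h : EuclideanSpace ℝ (Fin n) → ℝ) : Prop where
  nonneg : ∀ y ∈ closure P, 0 ≤ h y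
  measurable : AEMeasurable h (volume.restrict P)
  bounded : ∃ C : ℝ, ∀ y ∈ P, h y ≤ C
  pos : ∀ K ⊆ P, IsCompact K → ∃ c : ℝ, 0 < c ∧ ∀ y ∈ K, c ≤ h y
  doubling : IsDoubling P h

/-- `vo ∈ [0,∞)` is a vanishing order of `h`. The cone is solid (open and nonempty); since it is
open, its apex does not belong to it. -/
def IsVanishingOrder {n : ℕ} (P : Set (EuclideanSpace ℝ (Fin n)))
    (h : EuclideanSpace ℝ (Fin n) → ℝ) (vo : ℝ) : Prop :=
  0 ≤ vo ∧ ∃ (K : Set (EuclideanSpace ℝ (Fin n))) (C δ : ℝ),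
    IsOpen K ∧ K.Nonempty ∧ (∀ z ∈ K, ∀ t : ℝ, 0 < t → t • z ∈ K) ∧ 0 < C ∧ 0 < δ ∧
    ∀ y₀ ∈ frontier P, ∃ T : EuclideanSpace ℝ (Fin n) ≃ₗᵢ[ℝ] EuclideanSpace ℝ (Fin n),
      ∀ y ∈ (fun z => y₀ + T z) '' K ∩ Metric.ball y₀ δ,
        y ∈ P ∧ C⁻¹ * dist y y₀ ^ vo ≤ h y

/-- `P` has `h`-barycenter at the origin. -/
def BarycenterZero {n : ℕ} (P : Set (EuclideanSpace ℝ (Fin n)))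
    (h : EuclideanSpace ℝ (Fin n) → ℝ) : Prop :=
  ∫ y in P, h y • y = 0

/-! ### The energy and the class of normalized functions -/

/-- The Legendre transform `u(x) = sup_{y ∈ P} (⟨x, y⟩ - v(y))`. -/
def legendre {n : ℕ} (P : Set (EuclideanSpace ℝ (Fin n))) (v : EuclideanSpace ℝ (Fin n) → ℝ)
    (x : EuclideanSpace ℝ (Fin n)) : ℝ :=
  ⨆ y : P, (inner ℝ x (y : EuclideanSpace ℝ (Fin n)) - v y)

/-- `I(v) = ∫_{u < 0} F(-u(x)) dx`, where `u` is the Legendre transform of `v`. -/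
def funI {n : ℕ} (P : Set (EuclideanSpace ℝ (Fin n))) (F : ℝ → ℝ)
    (v : EuclideanSpace ℝ (Fin n) → ℝ) : ℝ≥0∞ :=
  ∫⁻ x in {x | legendre P v x < 0}, ENNReal.ofReal (F (-legendre P v x))

open Classical in
/-- `J(v) = G⁻¹ (H⁻¹ ∫_P G(v) h dy)`, `H = ∫_P h dy`. When `∫_P G(v) h dy` is not a finite number,
it is read as an integral in `[-∞,∞]`, with `G⁻¹(-∞) = 0` and `G⁻¹(+∞) = +∞`. -/
def funJ {n : ℕ} (P : Set (EuclideanSpace ℝ (Fin n))) (h : EuclideanSpace ℝ (Fin n) → ℝ)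
    (G : ℝ → ℝ) (v : EuclideanSpace ℝ (Fin n) → ℝ) : EReal :=
  if IntegrableOn (fun y => G (v y) * h y) P then
    ((Ginv G ((∫ y in P, h y)⁻¹ * ∫ y in P, G (v y) * h y) : ℝ) : EReal)
  else if ∫⁻ y in P, ENNReal.ofReal (-(G (v y) * h y)) = ⊤ then 0
  else ⊤

/-- The energy `E_Λ(v) = - log I(v) + Λ J(v)`. -/
def energy {n : ℕ} (P : Set (EuclideanSpace ℝ (Fin n))) (h : EuclideanSpace ℝ (Fin n) → ℝ)
    (F G : ℝ → ℝ) (Λ : ℝ) (v : EuclideanSpace ℝ (Fin n) → ℝ) : EReal :=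
  -ENNReal.log (funI P F v) + (Λ : EReal) * funJ P h G v

/-- The class `C⁺` of positive convex functions on `closure P`. -/
def classCplus {n : ℕ} (P : Set (EuclideanSpace ℝ (Fin n))) :
    Set (EuclideanSpace ℝ (Fin n) → ℝ) :=
  {v | ConvexOn ℝ (closure P) v ∧ ∀ y ∈ closure P, 0 < v y}

/-- The class `C_P` of normalized functions: `v ∈ C⁺` with `∫_P g(v(y)) y h(y) dy = 0`. -/
def classCP {n : ℕ} (P : Set (EuclideanSpace ℝ (Fin n))) (h : EuclideanSpace ℝ (Fin n) → ℝ)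
    (g : ℝ → ℝ) : Set (EuclideanSpace ℝ (Fin n) → ℝ) :=
  {v | v ∈ classCplus P ∧ IntegrableOn (fun y => (g (v y) * h y) • y) P ∧
    ∫ y in P, (g (v y) * h y) • y = 0}

/-- The energy `E_Λ` attains its infimum over `C_P`, and the infimum is a finite real number. -/
def AttainsInf {n : ℕ} (P : Set (EuclideanSpace ℝ (Fin n))) (h : EuclideanSpace ℝ (Fin n) → ℝ)
    (g F G : ℝ → ℝ) (Λ : ℝ) : Prop :=
  ∃ v ∈ classCP P h g, energy P h F G Λ v ≠ ⊥ ∧ energy P h F G Λ v ≠ ⊤ ∧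
    energy P h F G Λ v = ⨅ w ∈ classCP P h g, energy P h F G Λ w

end FreeBdyMA

end

namespace FreeBdyMA

variable {n : ℕ} {P : Set (EuclideanSpace ℝ (Fin n))} {v w : EuclideanSpace ℝ (Fin n) → ℝ}

/-! ### The Legendre transform -/

/-! The proof is the direct method. Subtracting a linear function `⟨p, ·⟩` from `v` ("tilting")
translates the Legendre transform `u`, so `I` does not change. For normalized `v`, the tangent line
inequality of the concave function `G` together with `∫ g(v) y = 0` gives `∫ G(w) ≤ ∫ G(v)` for
every positive `w` below a tilt of `v` (`integral_G_le`). Hence a normalized function maximizes `J`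
among its positive tilts, and every lower barrier for a tilt bounds `J(v)` from below.

Coercivity. Let `-m` be the minimum of `u`, attained at `p₀`, and choose vectors `e i` with `p₀ + e
i` in the compact set `{u ≤ 0}` and with maximal determinant; `T` is the linear map with rows `e i`
(`exists_isFrame`). Maximality encloses `{u ≤ 0}` in a parallelepiped, so `I(v) ≤ C F(m) |det T|`.
Tilting by the barycentre of the points `p₀`, `p₀ + e i` makes `v` at least `κ max(m, ‖T y‖)`, so
the mean of `G(κ max(m, ‖T y‖))` is at most `G(J(v))` (`IsFrame.integral_le`). Thus `I` and `J` are
compared through the pair `(m, T)` alone. Each structural condition yields `log I ≤ B J + C` with `B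
< Λ`, and bounded edges `e i` once `J` is bounded above and `I` below; this is coercivity
(`isCoercive_of_bounds`).

Compactness. Replacing `v` by the Legendre transform of `u` restricted to `{u ≤ 0}` keeps `I`,
lowers `v`, and gives a Lipschitz constant controlled by the frame (`exists_regularization`), so
Arzelà–Ascoli applies to a minimizing sequence. The limit need not be normalized, but a further tilt
of it is. That tilt has the same `I`, and its `J` is at most the limit of the values `J` of the
sequence, so it is a minimizer (`attainsInf_of_isCoercive`).

Normalization. If `g` is constant, the barycentre condition suffices. Otherwise one maximizes `p ↦ ∫
G(w - ⟨p, y⟩)` over the slopes that keep the tilt positive. The vanishing order of `h` and the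
divergence of `∫ G(s) s^(n+ν-1) ds` at `0` prevent the optimal tilt from reaching zero on `closure
P`, and the first order condition is then the normalization (`hasDivergence`,
`hasNormalization_of_divergence`). -/

lemma bddAbove_legendre (hPb : Bornology.IsBounded P) {c : ℝ} (hv : ∀ y ∈ P, c ≤ v y)
    (x : EuclideanSpace ℝ (Fin n)) :
    BddAbove (range fun y : P => inner ℝ x (y : EuclideanSpace ℝ (Fin n)) - v y) := by
  obtain ⟨R, hR⟩ := hPb.exists_norm_le
  refine ⟨‖x‖ * R - c, ?_⟩
  rintro _ ⟨y, rfl⟩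
  have h1 := real_inner_le_norm x (y : EuclideanSpace ℝ (Fin n))
  have h2 := mul_le_mul_of_nonneg_left (hR y y.2) (norm_nonneg x)
  have h3 := hv y y.2
  simp only
  linarith

lemma le_legendre (hPb : Bornology.IsBounded P) {c : ℝ} (hv : ∀ y ∈ P, c ≤ v y)
    (x : EuclideanSpace ℝ (Fin n)) {y : EuclideanSpace ℝ (Fin n)} (hy : y ∈ P) :
    inner ℝ x y - v y ≤ legendre P v x :=
  le_ciSup (bddAbove_legendre hPb hv x) (⟨y, hy⟩ : P)

lemma legendre_le (hne : P.Nonempty) {x : EuclideanSpace ℝ (Fin n)} {c : ℝ}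
    (h : ∀ y ∈ P, inner ℝ x y - v y ≤ c) : legendre P v x ≤ c := by
  have : Nonempty P := hne.to_subtype
  exact ciSup_le fun y => h y y.2

lemma legendre_le_add (hPb : Bornology.IsBounded P) (hne : P.Nonempty) {c ε : ℝ}
    (hv : ∀ y ∈ P, c ≤ v y) (hvw : ∀ y ∈ P, v y ≤ w y + ε) (x : EuclideanSpace ℝ (Fin n)) :
    legendre P w x ≤ legendre P v x + ε :=
  legendre_le hne fun y hy => by
    have := le_legendre hPb hv x hy
    have := hvw y hy
    linarith

lemma legendre_sub_inner (p x : EuclideanSpace ℝ (Fin n)) :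
    legendre P (fun y => v y - inner ℝ p y) x = legendre P v (x + p) := by
  unfold legendre
  congr 1
  ext y
  rw [inner_add_left]
  ring

lemma legendre_le_legendre_add (hPb : Bornology.IsBounded P) (hne : P.Nonempty) {c ρ : ℝ}
    (hv : ∀ y ∈ P, c ≤ v y) (hρ : ∀ y ∈ P, ‖y‖ ≤ ρ) (x x' : EuclideanSpace ℝ (Fin n)) :
    legendre P v x ≤ legendre P v x' + ρ * ‖x - x'‖ :=
  legendre_le hne fun y hy => by
    have h1 := le_legendre hPb hv x' hy
    have h2 := real_inner_le_norm (x - x') y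
    have h3 := mul_le_mul_of_nonneg_left (hρ y hy) (norm_nonneg (x - x'))
    rw [inner_sub_left] at h2
    linarith

lemma continuous_legendre (hPb : Bornology.IsBounded P) (hne : P.Nonempty) {c : ℝ}
    (hv : ∀ y ∈ P, c ≤ v y) : Continuous (legendre P v) := by
  obtain ⟨R, hR⟩ := hPb.exists_norm_le
  have : LipschitzWith (Real.toNNReal R) (legendre P v) := by
    refine LipschitzWith.of_le_add_mul _ fun x x' => ?_
    have h1 := legendre_le_legendre_add hPb hne hv hR x x'
    rw [dist_eq_norm]
    have := mul_le_mul_of_nonneg_right (Real.le_coe_toNNReal R) (norm_nonneg (x - x'))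
    linarith
  exact this.continuous

/-- A convex function on an open set containing `0` has a subgradient at `0`. -/
lemma exists_subgradient (hPo : IsOpen P) (hP0 : 0 ∈ P) (hv : ConvexOn ℝ P v) :
    ∃ p : EuclideanSpace ℝ (Fin n), ∀ y ∈ P, v 0 + inner ℝ p y ≤ v y := by
  have hcont : ContinuousOn v P := by
    have := hv.continuousOn_interior
    rwa [hPo.interior_eq] at this
  set S : Set (EuclideanSpace ℝ (Fin n) × ℝ) := {q | q.1 ∈ P ∧ v q.1 < q.2} with hS
  have hSconv : Convex ℝ S := hv.convex_strict_epigraph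
  have hSo : IsOpen S := by
    have h1 : ContinuousOn (fun q : EuclideanSpace ℝ (Fin n) × ℝ => q.2 - v q.1)
        (Prod.fst ⁻¹' P) :=
      continuousOn_snd.sub (hcont.comp continuousOn_fst fun q hq => hq)
    have h2 := h1.isOpen_inter_preimage (hPo.preimage continuous_fst)
      (isOpen_Ioi (a := (0 : ℝ)))
    convert h2 using 1
    ext q
    simp [hS]
  have hnot : ((0 : EuclideanSpace ℝ (Fin n)), v 0) ∉ S := fun hq => lt_irrefl _ hq.2
  -- The point `(0, v 0)` is separated from the open strict epigraph. The functional splits as `⟨q,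
  -- y⟩ + t k`, and `k < 0` says that the hyperplane is not vertical.
  obtain ⟨f, hf⟩ := geometric_hahn_banach_open_point hSconv hSo hnot
  set l : EuclideanSpace ℝ (Fin n) →L[ℝ] ℝ := f.comp (ContinuousLinearMap.inl ℝ _ ℝ) with hl
  obtain ⟨q, hq⟩ := (InnerProductSpace.toDual ℝ (EuclideanSpace ℝ (Fin n))).surjective l
  have hq' : ∀ y, f (y, 0) = inner ℝ q y := by
    intro y
    have : l y = inner ℝ q y := by rw [← hq]; simp
    rw [← this]; simp [hl]
  obtain ⟨k, hfsplit⟩ : ∃ k, ∀ (y : EuclideanSpace ℝ (Fin n)) (t : ℝ),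
      f (y, t) = inner ℝ q y + t * k := by
    refine ⟨f (0, 1), fun y t => ?_⟩
    have : ((y, t) : EuclideanSpace ℝ (Fin n) × ℝ) = (y, 0) + t • (0, 1) := by simp
    rw [this, map_add, map_smul, smul_eq_mul, hq']
  have hneg : k < 0 := by
    have h1 := hf (0, v 0 + 1) ⟨hP0, by simp⟩
    rw [hfsplit, hfsplit] at h1
    linarith
  refine ⟨(-k⁻¹) • q, fun y hy => ?_⟩
  -- Graph points lie only on the boundary of the strict epigraph; they are approached from the
  -- heights `v y + ε / (-k)`, which cost exactly `ε`.
  have hle : f (y, v y) ≤ f (0, v 0) := by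
    refine le_of_forall_pos_lt_add fun ε hε => ?_
    have h1 := hf (y, v y + ε / (-k)) ⟨hy, by
      have : 0 < ε / (-k) := div_pos hε (by linarith)
      simpa using this⟩
    rw [hfsplit] at h1
    rw [hfsplit y (v y)]
    have h2 : ε / (-k) * k = -ε := by rw [div_neg, neg_mul, div_mul_cancel₀ _ hneg.ne]
    rw [add_mul, h2] at h1
    linarith
  rw [hfsplit, hfsplit, inner_zero_right] at hle
  rw [real_inner_smul_left]
  have h3 : inner ℝ q y ≤ (v 0 - v y) * k := by linarith
  have h4 : -k⁻¹ * inner ℝ q y ≤ -k⁻¹ * ((v 0 - v y) * k) :=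
    mul_le_mul_of_nonneg_left h3 (by
      have := inv_lt_zero.2 hneg
      linarith)
  have h5 : -k⁻¹ * ((v 0 - v y) * k) = v y - v 0 := by
    have := hneg.ne
    field_simp
    ring
  linarith

lemma exists_legendre_neg (hPo : IsOpen P) (hP0 : 0 ∈ P) (hv : ConvexOn ℝ P v) :
    ∃ p, legendre P v p ≤ -v 0 := by
  obtain ⟨p, hp⟩ := exists_subgradient hPo hP0 hv
  exact ⟨p, legendre_le ⟨0, hP0⟩ fun y hy => by linarith [hp y hy]⟩

/-- Testing the supremum at the point of norm `r / 2` in the direction of `x` gives `u(x) ≥ (r / 2)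
‖x‖ - B`, where `B` bounds `v` on a closed ball inside `P`. -/
lemma exists_ball_legendre_le (hPo : IsOpen P) (hPb : Bornology.IsBounded P) (hP0 : 0 ∈ P)
    {c : ℝ} (hv : ContinuousOn v P) (hc : ∀ y ∈ P, c ≤ v y) :
    ∃ R, ∀ x, legendre P v x ≤ 0 → ‖x‖ ≤ R := by
  obtain ⟨r, hr, hrP⟩ := Metric.isOpen_iff.1 hPo 0 hP0
  have hsub : Metric.closedBall (0 : EuclideanSpace ℝ (Fin n)) (r / 2) ⊆ P :=
    (Metric.closedBall_subset_ball (by linarith)).trans hrP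
  obtain ⟨B, hB⟩ := (isCompact_closedBall (0 : EuclideanSpace ℝ (Fin n)) (r / 2)).bddAbove_image
    (hv.mono hsub)
  refine ⟨B / (r / 2), fun x hx => ?_⟩
  rw [le_div_iff₀ (by linarith)]
  rcases eq_or_ne x 0 with rfl | hx0
  · have h0 : (0 : EuclideanSpace ℝ (Fin n)) ∈ Metric.closedBall (0 : EuclideanSpace ℝ (Fin n))
      (r / 2) := Metric.mem_closedBall_self (by linarith)
    have h1 := hB (mem_image_of_mem v h0)
    have h2 := le_legendre hPb hc 0 (hsub h0)
    simp only [inner_zero_left, norm_zero, zero_mul] at h2 ⊢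
    linarith
  · have hxn : 0 < ‖x‖ := norm_pos_iff.2 hx0
    have hy : (r / 2 / ‖x‖) • x ∈ Metric.closedBall (0 : EuclideanSpace ℝ (Fin n)) (r / 2) := by
      rw [mem_closedBall_zero_iff, norm_smul, Real.norm_of_nonneg (by positivity)]
      field_simp
      exact le_rfl
    have h1 := hB (mem_image_of_mem v hy)
    have h2 := le_legendre hPb hc x (hsub hy)
    rw [real_inner_smul_right, real_inner_self_eq_norm_sq] at h2
    have h3 : r / 2 / ‖x‖ * ‖x‖ ^ 2 = ‖x‖ * (r / 2) := by field_simp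
    linarith

/-- If the sublevel set `{u ≤ 0}` is bounded and nonempty, then `u` attains its minimum. -/
lemma exists_argmin_legendre (hPb : Bornology.IsBounded P) (hne : P.Nonempty)
    {c R : ℝ} (hc : ∀ y ∈ P, c ≤ v y) (hR : ∀ x, legendre P v x ≤ 0 → ‖x‖ ≤ R)
    {p : EuclideanSpace ℝ (Fin n)} (hp : legendre P v p ≤ 0) :
    ∃ p₀, legendre P v p₀ ≤ legendre P v p ∧ ∀ x, legendre P v p₀ ≤ legendre P v x := by
  have hcont := continuous_legendre hPb hne hc
  obtain ⟨p₀, hp₀, hmin⟩ := (isCompact_closedBall (0 : EuclideanSpace ℝ (Fin n)) R).exists_isMinOn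
    ⟨p, mem_closedBall_zero_iff.2 (hR p hp)⟩ hcont.continuousOn
  have h1 := hmin (mem_closedBall_zero_iff.2 (hR p hp))
  refine ⟨p₀, h1, fun x => ?_⟩
  by_cases hx : legendre P v x ≤ 0
  · exact hmin (mem_closedBall_zero_iff.2 (hR x hx))
  · simp only [mem_ofPred_eq] at h1
    linarith

end FreeBdyMA

namespace FreeBdyMA

variable {n : ℕ} {P : Set (EuclideanSpace ℝ (Fin n))} {h : EuclideanSpace ℝ (Fin n) → ℝ}

/-! ### The measure `h dy` on `P` -/

/-- The measure `h(y) dy` on `P`. -/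
noncomputable def weight (P : Set (EuclideanSpace ℝ (Fin n)))
    (h : EuclideanSpace ℝ (Fin n) → ℝ) : Measure (EuclideanSpace ℝ (Fin n)) :=
  (volume.restrict P).withDensity fun y => ENNReal.ofReal (h y)

lemma ae_mem_weight (hPo : IsOpen P) : ∀ᵐ y ∂weight P h, y ∈ P :=
  (withDensity_absolutelyContinuous _ _).ae_le (ae_restrict_mem hPo.measurableSet)

lemma CondA1.ae_nonneg (hA : CondA1 P h) (hPo : IsOpen P) :
    ∀ᵐ y ∂(volume.restrict P), 0 ≤ h y :=
  (ae_restrict_mem hPo.measurableSet).mono fun y hy => hA.nonneg y (subset_closure hy)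

lemma integrable_weight_iff {F : Type*} [NormedAddCommGroup F] [NormedSpace ℝ F]
    (hA : CondA1 P h) (hPo : IsOpen P) {f : EuclideanSpace ℝ (Fin n) → F} :
    Integrable f (weight P h) ↔ IntegrableOn (fun y => h y • f y) P := by
  unfold weight
  rw [integrable_withDensity_iff_integrable_smul₀' hA.measurable.ennreal_ofReal
    (Eventually.of_forall fun _ => ENNReal.ofReal_lt_top)]
  refine integrable_congr ?_
  filter_upwards [hA.ae_nonneg hPo] with y hy
  rw [ENNReal.toReal_ofReal hy]

lemma integral_weight {F : Type*} [NormedAddCommGroup F] [NormedSpace ℝ F]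
    (hA : CondA1 P h) (hPo : IsOpen P) (f : EuclideanSpace ℝ (Fin n) → F) :
    ∫ y, f y ∂weight P h = ∫ y in P, h y • f y := by
  unfold weight
  rw [integral_withDensity_eq_integral_toReal_smul₀ hA.measurable.ennreal_ofReal
    (Eventually.of_forall fun _ => ENNReal.ofReal_lt_top)]
  refine integral_congr_ae ?_
  filter_upwards [hA.ae_nonneg hPo] with y hy
  rw [ENNReal.toReal_ofReal hy]

lemma lintegral_weight (hA : CondA1 P h) (f : EuclideanSpace ℝ (Fin n) → ℝ≥0∞) :
    ∫⁻ y, f y ∂weight P h = ∫⁻ y in P, ENNReal.ofReal (h y) * f y := by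
  unfold weight
  rw [lintegral_withDensity_eq_lintegral_mul_non_measurable₀ _ hA.measurable.ennreal_ofReal
    (Eventually.of_forall fun _ => ENNReal.ofReal_lt_top)]
  rfl

lemma exists_weight_le (hA : CondA1 P h) (hPo : IsOpen P) :
    ∃ C : ℝ, 0 ≤ C ∧ weight P h ≤ ENNReal.ofReal C • volume := by
  obtain ⟨C, hC⟩ := hA.bounded
  refine ⟨max C 0, le_max_right _ _, ?_⟩
  calc weight P h ≤ (volume.restrict P).withDensity fun _ => ENNReal.ofReal (max C 0) := by
        refine withDensity_mono ?_
        filter_upwards [ae_restrict_mem hPo.measurableSet] with y hy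
        exact ENNReal.ofReal_le_ofReal ((hC y hy).trans (le_max_left _ _))
    _ = ENNReal.ofReal (max C 0) • volume.restrict P := withDensity_const _
    _ ≤ ENNReal.ofReal (max C 0) • volume := by
        gcongr
        exact Measure.restrict_le_self

lemma isFiniteMeasure_weight (hA : CondA1 P h) (hPo : IsOpen P) (hPb : Bornology.IsBounded P) :
    IsFiniteMeasure (weight P h) := by
  obtain ⟨C, hC⟩ := hA.bounded
  refine ⟨?_⟩
  unfold weight
  rw [withDensity_apply _ MeasurableSet.univ, Measure.restrict_univ]
  calc ∫⁻ y in P, ENNReal.ofReal (h y) ≤ ∫⁻ _ in P, ENNReal.ofReal C := by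
        refine lintegral_mono_ae ?_
        filter_upwards [ae_restrict_mem hPo.measurableSet] with y hy
        exact ENNReal.ofReal_le_ofReal (hC y hy)
    _ < ⊤ := by
        rw [lintegral_const, Measure.restrict_apply_univ]
        exact ENNReal.mul_lt_top ENNReal.ofReal_lt_top hPb.measure_lt_top

lemma weight_ne_zero (hA : CondA1 P h) (hPo : IsOpen P) (hne : P.Nonempty) : weight P h ≠ 0 := by
  intro h0
  unfold weight at h0
  rw [withDensity_eq_zero_iff hA.measurable.ennreal_ofReal] at h0
  have hpos : ∀ y ∈ P, 0 < h y := fun y hy => by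
    obtain ⟨c, hc, hcy⟩ := hA.pos {y} (by simpa using hy) isCompact_singleton
    exact hc.trans_le (hcy y rfl)
  have h1 : ∀ᵐ y ∂(volume.restrict P), False := by
    filter_upwards [h0, ae_restrict_mem hPo.measurableSet] with y hy hyP
    have := hpos y hyP
    simp only [Pi.zero_apply, ENNReal.ofReal_eq_zero] at hy
    linarith
  rw [ae_restrict_iff' hPo.measurableSet] at h1
  have h2 : volume P = 0 := measure_mono_null (fun y hy => by simpa using hy) h1
  exact (hPo.measure_pos volume hne).ne' h2

lemma integral_h_eq (hA : CondA1 P h) (hPo : IsOpen P) :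
    ∫ y in P, h y = (weight P h).real univ := by
  have := integral_weight hA hPo (fun _ => (1 : ℝ))
  simpa using this.symm

lemma mem_classCP_iff (hA : CondA1 P h) (hPo : IsOpen P) {g : ℝ → ℝ}
    {v : EuclideanSpace ℝ (Fin n) → ℝ} :
    v ∈ classCP P h g ↔ v ∈ classCplus P ∧ Integrable (fun y => g (v y) • y) (weight P h) ∧
      ∫ y, g (v y) • y ∂weight P h = 0 := by
  rw [integrable_weight_iff hA hPo, integral_weight hA hPo]
  simp only [classCP, mem_ofPred_eq, smul_smul, mul_comm (g _)]

lemma integrableOn_iff_weight (hA : CondA1 P h) (hPo : IsOpen P)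
    (f : EuclideanSpace ℝ (Fin n) → ℝ) :
    IntegrableOn (fun y => f y * h y) P ↔ Integrable f (weight P h) := by
  rw [integrable_weight_iff hA hPo]
  simp only [smul_eq_mul, mul_comm]

lemma funJ_of_integrable (hA : CondA1 P h) (hPo : IsOpen P) {G : ℝ → ℝ}
    {v : EuclideanSpace ℝ (Fin n) → ℝ} (hv : Integrable (fun y => G (v y)) (weight P h)) :
    funJ P h G v = ((Ginv G (⨍ y, G (v y) ∂weight P h) : ℝ) : EReal) := by
  unfold funJ
  rw [if_pos ((integrableOn_iff_weight hA hPo _).2 hv), integral_h_eq hA hPo, average_eq,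
    integral_weight hA hPo, smul_eq_mul]
  simp only [smul_eq_mul, mul_comm]

lemma funJ_of_not_integrable (hA : CondA1 P h) (hPo : IsOpen P) {G : ℝ → ℝ}
    {v : EuclideanSpace ℝ (Fin n) → ℝ} (hv : ¬ Integrable (fun y => G (v y)) (weight P h))
    (hv' : ∫⁻ y, ENNReal.ofReal (-(G (v y))) ∂weight P h ≠ ⊤) :
    funJ P h G v = ⊤ := by
  unfold funJ
  rw [if_neg (mt (integrableOn_iff_weight hA hPo _).1 hv), if_neg]
  rw [lintegral_weight hA] at hv'
  convert hv' using 2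
  refine lintegral_congr_ae ?_
  filter_upwards [hA.ae_nonneg hPo] with y hy
  rw [← ENNReal.ofReal_mul hy]
  ring_nf

end FreeBdyMA

namespace FreeBdyMA

variable {n : ℕ} {P : Set (EuclideanSpace ℝ (Fin n))} {v : EuclideanSpace ℝ (Fin n) → ℝ}

/-! ### A simplex of almost maximal volume in the sublevel set `{u ≤ 0}` -/

/-- Rows are chosen in `K` with maximal `|det|`. Replacing row `i` by `x` multiplies the determinant
by the `i`-th coordinate of `x` in the basis of rows, so maximality bounds that coordinate by `1`.
The multiples of the unit vectors in `K` ensure that the maximum is not zero. -/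
lemma exists_matrix_max_det {K : Set (Fin n → ℝ)} (hK : IsCompact K) {r : ℝ} (hr : 0 < r)
    (hrK : ∀ i, Pi.single i r ∈ K) :
    ∃ A : Matrix (Fin n) (Fin n) ℝ, (∀ i, A i ∈ K) ∧ A.det ≠ 0 ∧
      ∀ x ∈ K, ∃ t : Fin n → ℝ, (∀ i, |t i| ≤ 1) ∧ x = ∑ i, t i • A i := by
  have hcomp : IsCompact {A : Matrix (Fin n) (Fin n) ℝ | ∀ i, A i ∈ K} := by
    have := isCompact_pi_infinite (s := fun _ : Fin n => K) fun _ => hK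
    exact this
  have hdiag : Matrix.diagonal (fun _ : Fin n => r) ∈
      {A : Matrix (Fin n) (Fin n) ℝ | ∀ i, A i ∈ K} := by
    intro i
    convert hrK i using 1
    ext j
    by_cases hij : i = j
    · subst hij; simp
    · simp [Matrix.diagonal, hij, Ne.symm hij]
  have hcont : Continuous fun A : Matrix (Fin n) (Fin n) ℝ => |A.det| :=
    (Continuous.matrix_det continuous_id).abs
  obtain ⟨A, hA, hmax⟩ := hcomp.exists_isMaxOn ⟨_, hdiag⟩ hcont.continuousOn
  have hpos : 0 < |A.det| := by
    have h1 : |(Matrix.diagonal (fun _ : Fin n => r)).det| ≤ |A.det| := hmax hdiag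
    rw [Matrix.det_diagonal] at h1
    refine lt_of_lt_of_le ?_ h1
    simp only [Finset.prod_const]
    positivity
  have hdet : A.det ≠ 0 := abs_pos.1 hpos
  refine ⟨A, hA, hdet, fun x hx => ?_⟩
  have hunit : IsUnit A.det := isUnit_iff_ne_zero.2 hdet
  have hx' : x = ∑ i, (Matrix.vecMul x A⁻¹) i • A i := by
    rw [← Matrix.vecMul_eq_sum, Matrix.vecMul_vecMul, Matrix.nonsing_inv_mul _ hunit,
      Matrix.vecMul_one]
  refine ⟨Matrix.vecMul x A⁻¹, fun i => ?_, hx'⟩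
  have hmem : A.updateRow i x ∈ {A : Matrix (Fin n) (Fin n) ℝ | ∀ i, A i ∈ K} := by
    intro j
    by_cases hij : j = i
    · subst hij; rwa [Matrix.updateRow_self]
    · rw [Matrix.updateRow_ne hij]; exact hA j
  have h1 : |(A.updateRow i x).det| ≤ |A.det| := hmax hmem
  have h2 : (A.updateRow i x).det = (Matrix.vecMul x A⁻¹) i * A.det := by
    conv_lhs => rw [hx']
    rw [Matrix.det_updateRow_sum, smul_eq_mul]
  rw [h2, abs_mul] at h1
  exact le_of_mul_le_mul_right (by linarith) hpos

/-- A frame for `v`: the minimum `-m` of the Legendre transform is attained at `p₀`, the points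
`p₀ + e i` lie in `{u ≤ 0}`, and every point of `{u ≤ 0}` has coordinates in `[-1, 1]` with respect
to the frame. The map `T` collects the inner products with the `e i`. -/
structure IsFrame (P : Set (EuclideanSpace ℝ (Fin n))) (v : EuclideanSpace ℝ (Fin n) → ℝ) (m : ℝ)
    (p₀ : EuclideanSpace ℝ (Fin n)) (e : Fin n → EuclideanSpace ℝ (Fin n))
    (T : EuclideanSpace ℝ (Fin n) →ₗ[ℝ] EuclideanSpace ℝ (Fin n)) : Prop where
  pos : 0 < m
  min_le : ∀ x, -m ≤ legendre P v x
  min_eq : legendre P v p₀ = -m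
  det_ne : LinearMap.det T ≠ 0
  apply_eq : ∀ y i, T y i = inner ℝ (e i) y
  vertex : ∀ i, legendre P v (p₀ + e i) ≤ 0
  span : ∀ x, legendre P v x ≤ 0 → ∃ t : Fin n → ℝ, (∀ i, |t i| ≤ 1) ∧ x = p₀ + ∑ i, t i • e i

/-- The determinant is maximized over the translate of `{u ≤ 0}` that puts the minimum point of `u`
at the origin. This set is bounded because `u` is coercive, and contains a ball around `0` because
`u(p₀) < 0` and `u` is continuous. -/
lemma exists_isFrame (hPo : IsOpen P) (hPb : Bornology.IsBounded P) (hP0 : 0 ∈ P)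
    (hv : ConvexOn ℝ P v) (hpos : ∀ y ∈ P, 0 < v y) :
    ∃ m p₀ e T, IsFrame P v m p₀ e T := by
  have hcont : ContinuousOn v P := by
    have := hv.continuousOn_interior
    rwa [hPo.interior_eq] at this
  have hc : ∀ y ∈ P, (0 : ℝ) ≤ v y := fun y hy => (hpos y hy).le
  obtain ⟨R, hR⟩ := exists_ball_legendre_le hPo hPb hP0 hcont hc
  obtain ⟨p, hp⟩ := exists_legendre_neg hPo hP0 hv
  have hv0 := hpos 0 hP0
  obtain ⟨p₀, hp₀, hmin⟩ := exists_argmin_legendre hPb ⟨0, hP0⟩ hc hR (p := p) (by linarith)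
  have hlc := continuous_legendre hPb ⟨0, hP0⟩ hc
  have hneg : legendre P v p₀ < 0 := by linarith
  set K : Set (Fin n → ℝ) := {x | legendre P v (p₀ + WithLp.toLp 2 x) ≤ 0} with hK
  have hKclosed : IsClosed K :=
    isClosed_le (hlc.comp (continuous_const.add (PiLp.continuous_toLp 2 _))) continuous_const
  have hKb : Bornology.IsBounded K := by
    refine Metric.isBounded_closedBall (x := (0 : Fin n → ℝ)) (r := R + ‖p₀‖) |>.subset ?_
    intro x hx
    have h1 := hR _ hx
    rw [mem_closedBall_zero_iff]
    have h2 : ‖x‖ ≤ ‖WithLp.toLp 2 x‖ := by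
      refine (pi_norm_le_iff_of_nonneg (norm_nonneg _)).2 fun i => ?_
      exact PiLp.norm_apply_le (WithLp.toLp 2 x) i
    have h3 : ‖WithLp.toLp 2 x‖ ≤ ‖p₀ + WithLp.toLp 2 x‖ + ‖p₀‖ := by
      have := norm_sub_le (p₀ + WithLp.toLp 2 x) p₀
      simpa using this
    linarith
  have hKc : IsCompact K := Metric.isCompact_of_isClosed_isBounded hKclosed hKb
  obtain ⟨r, hr, hrK⟩ : ∃ r > 0, ∀ x, ‖x‖ ≤ r → legendre P v (p₀ + x) ≤ 0 := by
    have h1 : ∀ᶠ x in 𝓝 (0 : EuclideanSpace ℝ (Fin n)), legendre P v (p₀ + x) < 0 := by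
      have h2 : Continuous fun x => legendre P v (p₀ + x) := hlc.comp (continuous_const.add
        continuous_id)
      refine h2.continuousAt.eventually_lt continuousAt_const ?_
      simpa using hneg
    obtain ⟨r, hr, hrs⟩ := Metric.eventually_nhds_iff_ball.1 h1
    refine ⟨r / 2, by linarith, fun x hx => (hrs x ?_).le⟩
    rw [mem_ball_zero_iff]
    linarith
  obtain ⟨A, hAK, hdet, hspan⟩ := exists_matrix_max_det hKc hr (fun i => by
    refine hrK _ ?_
    have : WithLp.toLp 2 (Pi.single i r) = EuclideanSpace.single i r := rfl
    rw [this, PiLp.norm_single, Real.norm_of_nonneg hr.le])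
  refine ⟨-legendre P v p₀, p₀, fun i => WithLp.toLp 2 (A i), Matrix.toEuclideanLin A, by linarith,
    fun x => by linarith [hmin x], by ring, ?_, ?_, fun i => hAK i, fun x hx => ?_⟩
  · rw [show Matrix.toEuclideanLin A = _ from congrFun (congrArg DFunLike.coe
      (Matrix.toLpLin_eq_toLin 2 2)) A, LinearMap.det_toLin]
    exact hdet
  · intro y i
    rw [Matrix.toLpLin_apply]
    simp [Matrix.mulVec, dotProduct, PiLp.inner_apply, mul_comm]
  · obtain ⟨t, ht, htx⟩ := hspan (x - p₀).ofLp (by simpa [hK] using hx)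
    refine ⟨t, ht, ?_⟩
    have : x - p₀ = ∑ i, t i • WithLp.toLp 2 (A i) := by
      apply (WithLp.ofLp_injective 2)
      rw [htx]
      simp
    rw [← this]
    abel

variable {m : ℝ} {p₀ : EuclideanSpace ℝ (Fin n)} {e : Fin n → EuclideanSpace ℝ (Fin n)}
  {T : EuclideanSpace ℝ (Fin n) →ₗ[ℝ] EuclideanSpace ℝ (Fin n)}

lemma IsFrame.le_sub_inner (hf : IsFrame P v m p₀ e T) (hPb : Bornology.IsBounded P)
    (hpos : ∀ y ∈ P, 0 < v y) {y : EuclideanSpace ℝ (Fin n)} (hy : y ∈ P) :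
    m ≤ v y - inner ℝ p₀ y := by
  have := le_legendre hPb (fun y hy => (hpos y hy).le) p₀ hy
  rw [hf.min_eq] at this
  linarith

/-- After a suitable affine change, `v` dominates the norm of the frame. -/
lemma IsFrame.exists_le_sub_inner (hf : IsFrame P v m p₀ e T) (hPb : Bornology.IsBounded P)
    (hpos : ∀ y ∈ P, 0 < v y) :
    ∃ p, ∀ y ∈ P, 1 / ((n : ℝ) + 1) ^ 2 * max m ‖T y‖ ≤ v y - inner ℝ p y := by
  -- The slope is the barycentre of the `n + 1` points `p₀` and `p₀ + e i`. At each of them `u ≤ 0`,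
  -- so the tilt of `v` by this slope is an average of the nonnegative quantities `W` and `W - ⟨e i,
  -- y⟩`.
  refine ⟨p₀ + ((n : ℝ) + 1)⁻¹ • ∑ i, e i, fun y hy => ?_⟩
  have hW := hf.le_sub_inner hPb hpos hy
  have hz : ∀ i, inner ℝ (e i) y ≤ v y - inner ℝ p₀ y := fun i => by
    have h1 := le_legendre hPb (fun y hy => (hpos y hy).le) (p₀ + e i) hy
    have h2 := hf.vertex i
    rw [inner_add_left] at h1
    linarith
  set W := v y - inner ℝ p₀ y with hWdef
  have hN : (0 : ℝ) < (n : ℝ) + 1 := by positivity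
  have hexp : v y - inner ℝ (p₀ + ((n : ℝ) + 1)⁻¹ • ∑ i, e i) y =
      ((n : ℝ) + 1)⁻¹ * (W + ∑ i, (W - inner ℝ (e i) y)) := by
    rw [inner_add_left, real_inner_smul_left, sum_inner, Finset.sum_sub_distrib]
    simp only [Finset.sum_const, Finset.card_univ, Fintype.card_fin, nsmul_eq_mul]
    field_simp
    rw [hWdef]
    ring
  have hS : 0 ≤ ∑ i, (W - inner ℝ (e i) y) := Finset.sum_nonneg fun i _ => by linarith [hz i]
  have hTy : ‖T y‖ ≤ ∑ i, |inner ℝ (e i) y| := by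
    have h1 : T y = ∑ i, EuclideanSpace.single i (T y i) := by
      ext j
      simp [Pi.single_apply]
    rw [h1]
    refine (norm_sum_le _ _).trans (le_of_eq ?_)
    refine Finset.sum_congr rfl fun i _ => ?_
    rw [PiLp.norm_single, hf.apply_eq, Real.norm_eq_abs]
  have hTy' : ‖T y‖ ≤ n * W + ∑ i, (W - inner ℝ (e i) y) := by
    refine hTy.trans ?_
    -- As `⟨e i, y⟩ ≤ W` and `0 ≤ W`, the absolute value is at most `2 W - ⟨e i, y⟩`: the one-sided
    -- bounds become two-sided at the price of one more `W`.
    have h2 : ∑ i, |inner ℝ (e i) y| ≤ ∑ i : Fin n, (W + (W - inner ℝ (e i) y)) := by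
      refine Finset.sum_le_sum fun i _ => abs_le.2 ⟨?_, ?_⟩
      · linarith [hz i, hf.pos]
      · linarith [hz i, hf.pos]
    rw [Finset.sum_add_distrib] at h2
    simpa using h2
  rw [hexp]
  have h3 : max m ‖T y‖ ≤ ((n : ℝ) + 1) * (W + ∑ i, (W - inner ℝ (e i) y)) := by
    refine max_le ?_ ?_
    · have : (0 : ℝ) ≤ n := by positivity
      nlinarith [hf.pos]
    · have : (0 : ℝ) ≤ n := by positivity
      have hm := hf.pos
      nlinarith
  calc 1 / ((n : ℝ) + 1) ^ 2 * max m ‖T y‖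
      ≤ 1 / ((n : ℝ) + 1) ^ 2 * (((n : ℝ) + 1) * (W + ∑ i, (W - inner ℝ (e i) y))) := by gcongr
    _ = _ := by field_simp

lemma IsFrame.norm_sub_le (hf : IsFrame P v m p₀ e T) {l : ℝ} (hl : ∀ i, ‖e i‖ ≤ l)
    {x : EuclideanSpace ℝ (Fin n)} (hx : legendre P v x ≤ 0) : ‖x - p₀‖ ≤ n * l := by
  obtain ⟨t, ht, rfl⟩ := hf.span x hx
  rw [add_sub_cancel_left]
  refine (norm_sum_le _ _).trans ?_
  calc ∑ i, ‖t i • e i‖ ≤ ∑ _i : Fin n, l := by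
        refine Finset.sum_le_sum fun i _ => ?_
        rw [norm_smul, Real.norm_eq_abs]
        calc |t i| * ‖e i‖ ≤ 1 * l := by
              gcongr
              · exact ht i
              · exact hl i
          _ = l := one_mul l
    _ = n * l := by simp

/-- The origin itself lies in `{u ≤ 0}` because `v > 0`, so `p₀` is within `n l` of the origin; this
removes the dependence on the position of `p₀`. -/
lemma IsFrame.norm_le (hf : IsFrame P v m p₀ e T) (hne : P.Nonempty)
    (hpos : ∀ y ∈ P, 0 < v y) {l : ℝ} (hl : ∀ i, ‖e i‖ ≤ l)
    {x : EuclideanSpace ℝ (Fin n)} (hx : legendre P v x ≤ 0) : ‖x‖ ≤ 2 * n * l := by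
  have h0 : legendre P v 0 ≤ 0 := legendre_le hne fun y hy => by
    rw [inner_zero_left]
    linarith [hpos y hy]
  have h1 := hf.norm_sub_le hl hx
  have h2 := hf.norm_sub_le hl h0
  rw [zero_sub, norm_neg] at h2
  have := norm_sub_norm_le x p₀
  linarith

/-- The volume of `{u ≤ 0}` is controlled by the determinant of a frame. -/
lemma IsFrame.volume_le (hf : IsFrame P v m p₀ e T) :
    volume {x | legendre P v x ≤ 0} ≤ ENNReal.ofReal |LinearMap.det T| *
      volume (Metric.closedBall (0 : EuclideanSpace ℝ (Fin n)) n) := by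
  -- The adjoint of `T` sends a coordinate vector `t` to `∑ t i • e i`, so `{u ≤ 0}` lies in `p₀`
  -- plus the image of a ball; the radius `n` bounds the norm of vectors with coordinates in `[-1,
  -- 1]`.
  set S := LinearMap.adjoint T with hS
  have hdet : |LinearMap.det S| = |LinearMap.det T| := by
    rw [hS, ← LinearMap.det_toMatrix (EuclideanSpace.basisFun (Fin n) ℝ).toBasis,
      LinearMap.toMatrix_adjoint, Matrix.det_conjTranspose, star_trivial, LinearMap.det_toMatrix]
  have hSapp : ∀ t : EuclideanSpace ℝ (Fin n), S t = ∑ i, t i • e i := by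
    intro t
    refine ext_inner_right ℝ fun y => ?_
    rw [hS, LinearMap.adjoint_inner_left, sum_inner, PiLp.inner_apply]
    refine Finset.sum_congr rfl fun i _ => ?_
    rw [real_inner_smul_left, hf.apply_eq]
    simp [mul_comm]
  have hsub : {x | legendre P v x ≤ 0} ⊆
      (fun z => p₀ + z) '' (S '' Metric.closedBall (0 : EuclideanSpace ℝ (Fin n)) n) := by
    intro x hx
    obtain ⟨t, ht, rfl⟩ := hf.span x hx
    refine ⟨_, ⟨WithLp.toLp 2 t, ?_, rfl⟩, ?_⟩
    · rw [mem_closedBall_zero_iff]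
      have h1 : WithLp.toLp 2 t = ∑ i, EuclideanSpace.single i (t i) := by
        ext j
        simp [Pi.single_apply]
      rw [h1]
      refine (norm_sum_le _ _).trans ?_
      calc ∑ i, ‖EuclideanSpace.single i (t i)‖ ≤ ∑ _i : Fin n, (1 : ℝ) := by
            refine Finset.sum_le_sum fun i _ => ?_
            rw [PiLp.norm_single, Real.norm_eq_abs]
            exact ht i
        _ = n := by simp
    · simp [hSapp]
  refine (measure_mono hsub).trans ?_
  rw [image_add_left, measure_preimage_add, Measure.addHaar_image_linearMap, hdet]

end FreeBdyMA

namespace FreeBdyMA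

variable {n : ℕ} {P : Set (EuclideanSpace ℝ (Fin n))} {h : EuclideanSpace ℝ (Fin n) → ℝ}
  {v : EuclideanSpace ℝ (Fin n) → ℝ} {f g F G : ℝ → ℝ}

/-! ### Consequences of the structural conditions -/

/-- The properties of `(F, G)` shared by the three structural conditions. -/
structure GoodPair (g F G : ℝ → ℝ) : Prop where
  F_mono : StrictMonoOn F (Ici 0)
  F_cont : ContinuousOn F (Ici 0)
  F_zero : F 0 = 0
  G_concave : ConcaveOn ℝ (Ioi 0) G
  G_mono : StrictMonoOn G (Ioi 0)
  G_deriv : ∀ s, 0 < s → HasDerivAt G (g s) s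

lemma IsAntiderivPair.goodPair (hp : IsAntiderivPair f g F G) (hG : ConcaveOn ℝ (Ioi 0) G) :
    GoodPair g F G where
  F_mono := by
    intro a ha b hb hab
    have ha' : (0 : ℝ) ≤ a := ha
    have hint : IntervalIntegrable f volume a b :=
      (hp.f_int a ha).symm.trans (hp.f_int b hb)
    rw [hp.F_eq a ha, hp.F_eq b hb, ← sub_pos,
      intervalIntegral.integral_interval_sub_left (hp.f_int b hb) (hp.f_int a ha)]
    exact intervalIntegral.intervalIntegral_pos_of_pos_on hint
      (fun x hx => hp.f_pos x (ha'.trans_lt hx.1)) hab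
  F_cont := by
    intro x hx
    have hx' : (0 : ℝ) ≤ x := hx
    have hcont : ContinuousOn (fun s => ∫ t in (0 : ℝ)..s, f t) (Icc 0 (x + 1)) := by
      have h1 : IntegrableOn f (uIcc 0 (x + 1)) := by
        rw [uIcc_of_le (by linarith), integrableOn_Icc_iff_integrableOn_Ioc]
        exact (hp.f_int (x + 1) (by linarith)).1
      have := intervalIntegral.continuousOn_primitive_interval h1
      rwa [uIcc_of_le (by linarith)] at this
    have h2 : ContinuousWithinAt (fun s => ∫ t in (0 : ℝ)..s, f t) (Ici 0) x := by
      refine (hcont x ⟨hx', by linarith⟩).mono_of_mem_nhdsWithin ?_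
      rw [← Ici_inter_Iic]
      exact inter_mem_nhdsWithin _ (Iic_mem_nhds (by linarith))
    exact h2.congr (fun y hy => hp.F_eq y hy) (hp.F_eq x hx)
  F_zero := by simp [hp.F_eq 0 le_rfl]
  G_concave := hG
  G_mono := by
    refine strictMonoOn_of_deriv_pos (convex_Ioi 0)
      (fun x hx => (hp.G_deriv x hx).continuousAt.continuousWithinAt) fun x hx => ?_
    rw [interior_Ioi] at hx
    rw [(hp.G_deriv x hx).deriv]
    exact hp.g_pos x hx
  G_deriv := hp.G_deriv

lemma GoodPair.G_cont (hp : GoodPair g F G) : ContinuousOn G (Ioi 0) :=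
  fun x hx => (hp.G_deriv x hx).continuousAt.continuousWithinAt

lemma GoodPair.F_pos (hp : GoodPair g F G) {s : ℝ} (hs : 0 < s) : 0 < F s := by
  have := hp.F_mono (show (0 : ℝ) ∈ Ici 0 from self_mem_Ici) (show s ∈ Ici 0 from hs.le) hs
  rwa [hp.F_zero] at this

lemma GoodPair.F_nonneg (hp : GoodPair g F G) {s : ℝ} (hs : 0 ≤ s) : 0 ≤ F s := by
  rcases hs.eq_or_lt with rfl | hs
  · rw [hp.F_zero]
  · exact (hp.F_pos hs).le

lemma GoodPair.F_le (hp : GoodPair g F G) {s t : ℝ} (hs : 0 ≤ s) (hst : s ≤ t) : F s ≤ F t :=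
  hp.F_mono.monotoneOn hs (hs.trans hst) hst

lemma GoodPair.G_le (hp : GoodPair g F G) {s t : ℝ} (hs : 0 < s) (hst : s ≤ t) : G s ≤ G t :=
  hp.G_mono.monotoneOn hs (hs.trans_le hst) hst

lemma GoodPair.le_of_G_le (hp : GoodPair g F G) {s t : ℝ} (hs : 0 < s) (ht : 0 < t)
    (hst : G s ≤ G t) : s ≤ t :=
  (hp.G_mono.le_iff_le hs ht).1 hst

lemma GoodPair.le_tangent (hp : GoodPair g F G) {s t : ℝ} (hs : 0 < s) (ht : 0 < t) :
    G t ≤ G s + g s * (t - s) := by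
  rcases lt_trichotomy s t with hst | rfl | hst
  · have := hp.G_concave.slope_le_of_hasDerivAt hs ht hst (hp.G_deriv s hs)
    rw [slope_def_field, div_le_iff₀ (by linarith)] at this
    linarith
  · simp
  · have := hp.G_concave.le_slope_of_hasDerivAt ht hs hst (hp.G_deriv s hs)
    rw [slope_def_field, le_div_iff₀ (by linarith)] at this
    linarith

lemma GoodPair.Ginv_eq (hp : GoodPair g F G) {s : ℝ} (hs : 0 < s) : Ginv G (G s) = s :=
  hp.G_mono.injOn.leftInvOn_invFunOn hs

/-! ### Averages of `G(v)` and tilts of normalized functions -/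

section Measure

variable {μ : Measure (EuclideanSpace ℝ (Fin n))}

lemma integrable_of_continuousOn [IsFiniteMeasure μ] (hPb : Bornology.IsBounded P) (hμ : ∀ᵐ y ∂μ, y ∈ P)
    {F : Type*} [NormedAddCommGroup F] [NormedSpace ℝ F] {φ : EuclideanSpace ℝ (Fin n) → F}
    (hφ : ContinuousOn φ (closure P)) : Integrable φ μ := by
  have hcomp : IsCompact (closure P) := hPb.isCompact_closure
  have hμ' : ∀ᵐ y ∂μ, y ∈ closure P := hμ.mono fun y hy => subset_closure hy
  obtain ⟨C, hC⟩ := hcomp.exists_bound_of_continuousOn hφ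
  have h1 := hφ.aestronglyMeasurable_of_isCompact (μ := μ) hcomp isClosed_closure.measurableSet
  rw [Measure.restrict_eq_self_of_ae_mem hμ'] at h1
  exact Integrable.of_bound h1 C (hμ'.mono fun y hy => hC y hy)

/-- The average lies between two values of `G ∘ v` attained on `P`, so the intermediate value
theorem puts it in the range of `G`. Hence `Ginv` is a genuine inverse at every average that occurs.
-/
lemma exists_eq_average [IsFiniteMeasure μ] (hp : GoodPair g F G) (hμ : ∀ᵐ y ∂μ, y ∈ P) (hμ0 : μ ≠ 0)
    (hpos : ∀ y ∈ P, 0 < v y) (hint : Integrable (fun y => G (v y)) μ) :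
    ∃ s, 0 < s ∧ G s = ⨍ y, G (v y) ∂μ := by
  have hnull : μ Pᶜ = 0 := hμ
  obtain ⟨y, hy, hy1⟩ := exists_notMem_null_le_average hμ0 hint hnull
  obtain ⟨z, hz, hz1⟩ := exists_notMem_null_average_le hμ0 hint hnull
  have hy' := hpos y (not_not.1 hy)
  have hz' := hpos z (not_not.1 hz)
  have hsub : uIcc (v y) (v z) ⊆ Ioi 0 := fun t ht => (lt_min hy' hz').trans_le ht.1
  obtain ⟨s, hs, hs1⟩ := intermediate_value_uIcc (hp.G_cont.mono hsub)
    (mem_uIcc_of_le hy1 hz1)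
  exact ⟨s, hsub hs, hs1⟩

/-- For `v` normalized, affine perturbations of `v` do not increase `∫ G(v)`. -/
lemma integral_G_le (hp : GoodPair g F G) (hμ : ∀ᵐ y ∂μ, y ∈ P)
    (hgi : Integrable (fun y => g (v y) • y) μ) (hg0 : ∫ y, g (v y) • y ∂μ = 0)
    (hpos : ∀ y ∈ P, 0 < v y) (hint : Integrable (fun y => G (v y)) μ)
    {w : EuclideanSpace ℝ (Fin n) → ℝ} {p : EuclideanSpace ℝ (Fin n)}
    (hw : ∀ y ∈ P, 0 < w y) (hwv : ∀ y ∈ P, w y ≤ v y - inner ℝ p y)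
    (hwi : Integrable (fun y => G (w y)) μ) :
    ∫ y, G (w y) ∂μ ≤ ∫ y, G (v y) ∂μ := by
  have hi : Integrable (fun y => inner ℝ p (g (v y) • y)) μ := hgi.const_inner p
  have hz : ∫ y, inner ℝ p (g (v y) • y) ∂μ = 0 := by
    rw [integral_inner hgi, hg0, inner_zero_right]
  -- Tangent line of `G` at `v y`: moving the argument to `v y - ⟨p, y⟩` changes `G` by at most
  -- `-g(v y) ⟨p, y⟩`, which integrates to zero by the normalization.
  calc ∫ y, G (w y) ∂μ ≤ ∫ y, (G (v y) - inner ℝ p (g (v y) • y)) ∂μ := by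
        refine integral_mono_ae hwi (hint.sub hi) ?_
        filter_upwards [hμ] with y hy
        have h1 := hp.G_le (hw y hy) (hwv y hy)
        have h2 := hp.le_tangent (hpos y hy) ((hw y hy).trans_le (hwv y hy))
        rw [real_inner_smul_right]
        have h3 : g (v y) * (v y - inner ℝ p y - v y) = -(g (v y) * inner ℝ p y) := by ring
        linarith
    _ = ∫ y, G (v y) ∂μ := by rw [integral_sub hint hi, hz, sub_zero]

/-- The tangent line inequality read backwards: a tilt bounded below by `c` gives `-G(v) ≤ -⟨p, g(v)
y⟩ - G(c)`, whose right side is integrable. So `∫ G(v)` is never `-∞` on the normalized class, and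
nonintegrability there means `J = +∞`. -/
lemma lintegral_neg_G_ne_top [IsFiniteMeasure μ] (hp : GoodPair g F G) (hμ : ∀ᵐ y ∂μ, y ∈ P)
    (hgi : Integrable (fun y => g (v y) • y) μ) (hpos : ∀ y ∈ P, 0 < v y)
    {c : ℝ} (hc : 0 < c) {p : EuclideanSpace ℝ (Fin n)}
    (hcv : ∀ y ∈ P, c ≤ v y - inner ℝ p y) :
    ∫⁻ y, ENNReal.ofReal (-(G (v y))) ∂μ ≠ ⊤ := by
  have hi : Integrable (fun y => -inner ℝ p (g (v y) • y) - G c) μ :=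
    (hgi.const_inner p).neg.sub (integrable_const _)
  refine ne_top_of_le_ne_top hi.lintegral_lt_top.ne (lintegral_mono_ae ?_)
  filter_upwards [hμ] with y hy
  refine ENNReal.ofReal_le_ofReal ?_
  have h1 := hp.G_le hc (hcv y hy)
  have h2 := hp.le_tangent (hpos y hy) (hc.trans_le (hcv y hy))
  rw [real_inner_smul_right]
  have h3 : g (v y) * (v y - inner ℝ p y - v y) = -(g (v y) * inner ℝ p y) := by ring
  linarith

end Measure

/-! ### The functional `I` -/

lemma funI_le (hp : GoodPair g F G) (hc : Continuous (legendre P v)) {m : ℝ}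
    (hm : ∀ x, -m ≤ legendre P v x) :
    funI P F v ≤ ENNReal.ofReal (F m) * volume {x | legendre P v x ≤ 0} := by
  unfold funI
  calc ∫⁻ x in {x | legendre P v x < 0}, ENNReal.ofReal (F (-legendre P v x))
      ≤ ∫⁻ _x in {x | legendre P v x < 0}, ENNReal.ofReal (F m) := by
        refine setLIntegral_mono' ?_ fun x hx => ?_
        · exact (isOpen_lt hc continuous_const).measurableSet
        · refine ENNReal.ofReal_le_ofReal (hp.F_le ?_ (by linarith [hm x]))
          have : legendre P v x < 0 := hx
          linarith
    _ = ENNReal.ofReal (F m) * volume {x | legendre P v x < 0} := by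
        rw [lintegral_const, Measure.restrict_apply_univ]
    _ ≤ _ := by
        gcongr
        exact fun h => le_of_lt h

lemma funI_pos (hp : GoodPair g F G) (hc : Continuous (legendre P v)) {p}
    (hneg : legendre P v p < 0) : 0 < funI P F v := by
  have hopen : IsOpen {x | legendre P v x < 0} := isOpen_lt hc continuous_const
  unfold funI
  rw [pos_iff_ne_zero, Ne, lintegral_eq_zero_iff']
  · intro h0
    have h1 : ∀ᵐ x ∂(volume.restrict {x | legendre P v x < 0}), False := by
      filter_upwards [h0, ae_restrict_mem hopen.measurableSet] with x hx hx'
      have hx'' : legendre P v x < 0 := hx'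
      have := hp.F_pos (s := -legendre P v x) (by linarith)
      simp only [Pi.zero_apply, ENNReal.ofReal_eq_zero] at hx
      linarith
    rw [ae_restrict_iff' hopen.measurableSet] at h1
    exact (hopen.measure_pos volume ⟨p, hneg⟩).ne'
      (measure_mono_null (fun y hy => by simpa using hy) h1)
  · refine AEMeasurable.ennreal_ofReal ?_
    have : ContinuousOn (fun x => F (-legendre P v x)) {x | legendre P v x < 0} :=
      hp.F_cont.comp hc.neg.continuousOn fun x hx => by
        have : legendre P v x < 0 := hx
        simp only [mem_Ici]
        linarith
    exact this.aemeasurable hopen.measurableSet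

lemma funI_sub_inner (p : EuclideanSpace ℝ (Fin n)) :
    funI P F (fun y => v y - inner ℝ p y) = funI P F v := by
  unfold funI
  simp only [legendre_sub_inner]
  have hmp : MeasurePreserving (fun x : EuclideanSpace ℝ (Fin n) => x + p) volume volume :=
    measurePreserving_add_right volume p
  have hemb : MeasurableEmbedding fun x : EuclideanSpace ℝ (Fin n) => x + p :=
    measurableEmbedding_addRight p
  exact hmp.setLIntegral_comp_preimage_emb hemb
    (fun x => ENNReal.ofReal (F (-legendre P v x))) {x | legendre P v x < 0}

end FreeBdyMA

namespace FreeBdyMA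

variable {n : ℕ} {P : Set (EuclideanSpace ℝ (Fin n))} {v : EuclideanSpace ℝ (Fin n) → ℝ}
  {g F G : ℝ → ℝ} {m : ℝ} {p₀ : EuclideanSpace ℝ (Fin n)}
  {e : Fin n → EuclideanSpace ℝ (Fin n)}
  {T : EuclideanSpace ℝ (Fin n) →ₗ[ℝ] EuclideanSpace ℝ (Fin n)}
  {μ : Measure (EuclideanSpace ℝ (Fin n))}

/-! ### Estimates in terms of a frame -/

/-- The determinant form of the bound is the one that cancels against the factor `|det T|⁻¹` in
integrals of functions of `T y`; the cruder form in the longest edge is used when only lengths are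
controlled. -/
lemma IsFrame.funI_le_det (hf : IsFrame P v m p₀ e T) (hp : GoodPair g F G)
    (hc : Continuous (legendre P v)) :
    funI P F v ≤ ENNReal.ofReal (F m * (|LinearMap.det T| *
      (volume (Metric.closedBall (0 : EuclideanSpace ℝ (Fin n)) n)).toReal)) := by
  rw [ENNReal.ofReal_mul (hp.F_nonneg hf.pos.le), ENNReal.ofReal_mul (abs_nonneg _),
    ENNReal.ofReal_toReal measure_closedBall_lt_top.ne]
  refine (funI_le hp hc hf.min_le).trans ?_
  gcongr
  exact hf.volume_le

lemma IsFrame.funI_le_pow (hf : IsFrame P v m p₀ e T) (hp : GoodPair g F G)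
    (hc : Continuous (legendre P v)) {l : ℝ} (hl0 : 0 ≤ l) (hl : ∀ i, ‖e i‖ ≤ l) :
    funI P F v ≤ ENNReal.ofReal (F m * (l ^ n *
      (volume (Metric.closedBall (0 : EuclideanSpace ℝ (Fin n)) n)).toReal)) := by
  rw [ENNReal.ofReal_mul (hp.F_nonneg hf.pos.le), ENNReal.ofReal_mul (by positivity),
    ENNReal.ofReal_toReal measure_closedBall_lt_top.ne]
  refine (funI_le hp hc hf.min_le).trans ?_
  gcongr
  calc volume {x | legendre P v x ≤ 0} ≤ volume (Metric.closedBall p₀ (l * n)) := by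
        refine measure_mono fun x hx => ?_
        rw [mem_closedBall_iff_norm]
        linarith [hf.norm_sub_le hl hx]
    _ = _ := by
        rw [Measure.addHaar_closedBall_mul volume p₀ hl0 (by positivity)]
        simp

lemma IsFrame.continuous_integrand (hm : 0 < m) (hp : GoodPair g F G) {κ : ℝ} (hκ : 0 < κ) :
    Continuous fun y => G (κ * max m ‖T y‖) := by
  have h1 : Continuous fun y => κ * max m ‖T y‖ :=
    continuous_const.mul (continuous_const.max (LinearMap.continuous_of_finiteDimensional T).norm)
  refine hp.G_cont.comp_continuous h1 fun y => ?_
  exact mul_pos hκ (lt_max_of_lt_left hm)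

/-- A slab around a hyperplane through the origin has small measure. -/
lemma exists_slab_le (hn : 1 ≤ n) (hPb : Bornology.IsBounded P) (hμ : ∀ᵐ y ∂μ, y ∈ P) {C : ℝ}
    (hC0 : 0 ≤ C) (hC : μ ≤ ENNReal.ofReal C • volume) {η : ℝ} (hη : 0 < η) :
    ∃ δ, 0 < δ ∧ ∀ e : EuclideanSpace ℝ (Fin n),
      μ {y | |inner ℝ e y| < δ * ‖e‖} ≤ ENNReal.ofReal η := by
  obtain ⟨ρ, hρ0, hρ⟩ : ∃ ρ > 0, ∀ y ∈ P, ‖y‖ ≤ ρ := hPb.exists_pos_norm_le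
  -- In an orthonormal basis containing `e / ‖e‖`, the slab meets `P` inside a box with one side `2
  -- δ` and the others `2 ρ`, of `μ`-measure at most `C * 2 δ * (2 ρ)^(n-1)`. The summand `1` only
  -- keeps `D` positive.
  set D : ℝ := C * (2 * (2 * ρ) ^ (n - 1)) + 1 with hD
  have hD0 : 0 < D := by positivity
  refine ⟨η / D, by positivity, fun e => ?_⟩
  rcases eq_or_ne e 0 with rfl | he
  · simp
  set δ := η / D
  have hδ : 0 < δ := by positivity
  have i₀ : Fin n := ⟨0, hn⟩
  have hen : 0 < ‖e‖ := norm_pos_iff.2 he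
  obtain ⟨b, hb⟩ : ∃ b : OrthonormalBasis (Fin n) ℝ (EuclideanSpace ℝ (Fin n)),
      ∀ i ∈ ({i₀} : Set (Fin n)), b i = ‖e‖⁻¹ • e := by
    refine Orthonormal.exists_orthonormalBasis_extension_of_card_eq (by simp)
      (v := fun _ => ‖e‖⁻¹ • e) ⟨fun i => ?_, fun i j hij => ?_⟩
    · simp [norm_smul, hen.ne']
    · exact absurd (Subsingleton.elim i j) hij
  have hb0 : b i₀ = ‖e‖⁻¹ • e := hb i₀ rfl
  have hmp := (PiLp.volume_preserving_ofLp (Fin n)).comp b.measurePreserving_measurableEquiv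
  set B : Set (Fin n → ℝ) := pi univ fun i => if i = i₀ then Ioo (-δ) δ else Icc (-ρ) ρ with hB
  have hsub : {y | |inner ℝ e y| < δ * ‖e‖} ∩ P ⊆
      (WithLp.ofLp ∘ b.measurableEquiv) ⁻¹' B := by
    rintro y ⟨hy, hyP⟩ i -
    have hcoord : (WithLp.ofLp ∘ b.measurableEquiv) y i = inner ℝ (b i) y :=
      b.repr_apply_apply y i
    rw [hcoord]
    by_cases hi : i = i₀
    · subst hi
      simp only [if_true]
      have hy' : |inner ℝ e y| < δ * ‖e‖ := hy
      rw [hb0, real_inner_smul_left, mem_Ioo, ← abs_lt, abs_mul, abs_of_pos (inv_pos.2 hen),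
        inv_mul_lt_iff₀ hen]
      linarith
    · simp only [hi, if_false]
      rw [mem_Icc, ← abs_le]
      have h1 := abs_real_inner_le_norm (b i) y
      rw [b.norm_eq_one, one_mul] at h1
      exact h1.trans (hρ y hyP)
  have hvol : volume B = ENNReal.ofReal (2 * δ * (2 * ρ) ^ (n - 1)) := by
    rw [hB, volume_pi_pi, ← Finset.mul_prod_erase _ _ (Finset.mem_univ i₀)]
    have h1 : ∏ x ∈ Finset.univ.erase i₀,
        volume (if x = i₀ then Ioo (-δ) δ else Icc (-ρ) ρ) =
        ∏ x ∈ Finset.univ.erase i₀, ENNReal.ofReal (2 * ρ) := by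
      refine Finset.prod_congr rfl fun x hx => ?_
      rw [if_neg (Finset.ne_of_mem_erase hx), Real.volume_Icc]
      congr 1
      ring
    rw [h1, if_pos rfl, Real.volume_Ioo, Finset.prod_const, Finset.card_erase_of_mem
      (Finset.mem_univ _), Finset.card_univ, Fintype.card_fin,
      ← ENNReal.ofReal_pow (by positivity), ← ENNReal.ofReal_mul (by linarith)]
    congr 1
    ring
  have hBm : MeasurableSet B := by
    refine MeasurableSet.univ_pi fun i => ?_
    by_cases hi : i = i₀
    · simp [hi]
    · simp [hi]
  calc μ {y | |inner ℝ e y| < δ * ‖e‖}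
      ≤ μ ({y | |inner ℝ e y| < δ * ‖e‖} ∩ P) :=
        measure_mono_ae (hμ.mono fun y hy hyS => ⟨hyS, hy⟩)
    _ ≤ μ ((WithLp.ofLp ∘ b.measurableEquiv) ⁻¹' B) := measure_mono hsub
    _ ≤ (ENNReal.ofReal C • volume) ((WithLp.ofLp ∘ b.measurableEquiv) ⁻¹' B) := hC _
    _ = ENNReal.ofReal C * volume B := by
        rw [Measure.smul_apply, smul_eq_mul, hmp.measure_preimage hBm.nullMeasurableSet]
    _ = ENNReal.ofReal (C * (2 * δ * (2 * ρ) ^ (n - 1))) := by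
        rw [hvol, ENNReal.ofReal_mul hC0]
    _ ≤ ENNReal.ofReal η := by
        refine ENNReal.ofReal_le_ofReal ?_
        have h1 : δ * D = η := div_mul_cancel₀ _ hD0.ne'
        calc C * (2 * δ * (2 * ρ) ^ (n - 1)) = δ * (D - 1) := by rw [hD]; ring
          _ ≤ δ * D := by gcongr; linarith
          _ = η := h1

variable [IsFiniteMeasure μ]

/-- Outside the slab orthogonal to `e i` one has `‖T y‖ ≥ |⟨e i, y⟩| ≥ δ ‖e i‖`, so the integrand is
at least its value at that length; inside the slab it is still at least `G(κ m)`, and the slab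
carries mass at most `η`. -/
lemma IsFrame.integral_ge (hPb : Bornology.IsBounded P) (hμ : ∀ᵐ y ∂μ, y ∈ P)
    (hf : IsFrame P v m p₀ e T) (hp : GoodPair g F G) {κ η δ : ℝ} (hκ : 0 < κ) {i : Fin n}
    (hslab : μ {y | |inner ℝ (e i) y| < δ * ‖e i‖} ≤ ENNReal.ofReal η) (hη : 0 ≤ η) :
    μ.real univ * G (κ * max m (δ * ‖e i‖)) -
      η * (G (κ * max m (δ * ‖e i‖)) - G (κ * m)) ≤ ∫ y, G (κ * max m ‖T y‖) ∂μ := by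
  set S := {y | |inner ℝ (e i) y| < δ * ‖e i‖} with hS
  set b := G (κ * max m (δ * ‖e i‖))
  set a := G (κ * m)
  have hm := hf.pos
  have hab : a ≤ b := hp.G_le (by positivity) (by gcongr; exact le_max_left _ _)
  have hSm : MeasurableSet S := (isOpen_lt (by fun_prop) continuous_const).measurableSet
  have hi : Integrable (fun y => b - S.indicator (fun _ => b - a) y) μ :=
    (integrable_const _).sub ((integrable_const _).indicator hSm)
  have hcalc : ∫ y, (b - S.indicator (fun _ => b - a) y) ∂μ =
      μ.real univ * b - μ.real S * (b - a) := by
    rw [integral_sub (integrable_const _) ((integrable_const _).indicator hSm), integral_const,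
      integral_indicator_const _ hSm, smul_eq_mul, smul_eq_mul]
  have hSη : μ.real S ≤ η := ENNReal.toReal_le_of_le_ofReal hη hslab
  calc _ ≤ μ.real univ * b - μ.real S * (b - a) := by
        have := mul_le_mul_of_nonneg_right hSη (sub_nonneg.2 hab)
        linarith
    _ ≤ _ := by
        rw [← hcalc]
        refine integral_mono hi (integrable_of_continuousOn hPb hμ
          (IsFrame.continuous_integrand hm hp hκ).continuousOn) fun y => ?_
        by_cases hy : y ∈ S
        · simp only [indicator_of_mem hy]
          have : a ≤ G (κ * max m ‖T y‖) :=
            hp.G_le (by positivity) (by gcongr; exact le_max_left _ _)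
          linarith
        · simp only [indicator_of_notMem hy]
          have h1 : δ * ‖e i‖ ≤ |inner ℝ (e i) y| := not_lt.1 hy
          have h2 : |inner ℝ (e i) y| ≤ ‖T y‖ := by
            rw [← hf.apply_eq, ← Real.norm_eq_abs]
            exact PiLp.norm_apply_le (T y) i
          have : b ≤ G (κ * max m ‖T y‖) := by
            refine hp.G_le (mul_pos hκ (lt_max_of_lt_left hm)) ?_
            gcongr
            exact h1.trans h2
          linarith

end FreeBdyMA

namespace FreeBdyMA

variable {n : ℕ} {P : Set (EuclideanSpace ℝ (Fin n))} {h : EuclideanSpace ℝ (Fin n) → ℝ}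
  {v : EuclideanSpace ℝ (Fin n) → ℝ} {g F G : ℝ → ℝ} {m : ℝ} {p₀ : EuclideanSpace ℝ (Fin n)}
  {e : Fin n → EuclideanSpace ℝ (Fin n)}
  {T : EuclideanSpace ℝ (Fin n) →ₗ[ℝ] EuclideanSpace ℝ (Fin n)}

/-! ### Regularization and the energy of normalized functions -/

lemma funI_eq_lintegral (hp : GoodPair g F G) (hc : Continuous (legendre P v)) :
    funI P F v = ∫⁻ x, ENNReal.ofReal (F (max (-legendre P v x) 0)) := by
  unfold funI
  rw [← lintegral_indicator (isOpen_lt hc continuous_const).measurableSet]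
  congr 1
  ext x
  by_cases hx : legendre P v x < 0
  · rw [indicator_of_mem (by exact hx), max_eq_left (by linarith)]
  · rw [indicator_of_notMem (by exact hx), max_eq_right (by linarith), hp.F_zero,
      ENNReal.ofReal_zero]

/-- Since `F 0 = 0`, the varying domain `{u < 0}` can be traded for a fixed ball, as dominated
convergence along a sequence requires. -/
lemma funI_eq_setLIntegral (hp : GoodPair g F G) (hc : Continuous (legendre P v)) {R : ℝ}
    (hR : ∀ x, legendre P v x < 0 → ‖x‖ ≤ R) :
    funI P F v = ∫⁻ x in Metric.closedBall 0 R, ENNReal.ofReal (F (max (-legendre P v x) 0)) := by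
  rw [funI_eq_lintegral hp hc, ← lintegral_indicator measurableSet_closedBall]
  congr 1
  ext x
  by_cases hx : x ∈ Metric.closedBall (0 : EuclideanSpace ℝ (Fin n)) R
  · rw [indicator_of_mem hx]
  · rw [indicator_of_notMem hx, max_eq_right, hp.F_zero, ENNReal.ofReal_zero]
    by_contra hlt
    exact hx (mem_closedBall_zero_iff.2 (hR x (by linarith)))

/-- Replacing `v` by the Legendre transform of `u` restricted to `{u ≤ 0}` decreases `v` and
keeps the negative part of `u`. -/
lemma exists_regularization (hPb : Bornology.IsBounded P) (hne : P.Nonempty)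
    (hf : IsFrame P v m p₀ e T) (hpos : ∀ y ∈ P, 0 < v y) {l : ℝ} (hl : ∀ i, ‖e i‖ ≤ l)
    (hl0 : 0 ≤ l) :
    ∃ w : EuclideanSpace ℝ (Fin n) → ℝ, ConvexOn ℝ univ w ∧
      LipschitzWith (Real.toNNReal (2 * n * l)) w ∧ (∀ y ∈ P, w y ≤ v y) ∧
      (∀ y, m ≤ w y - inner ℝ p₀ y) ∧ (∀ y, w y ≤ 2 * n * l * ‖y‖ + m) ∧
      ∀ x, max (-legendre P w x) 0 = max (-legendre P v x) 0 := by
  have hv0 : ∀ y ∈ P, (0 : ℝ) ≤ v y := fun y hy => (hpos y hy).le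
  set K := {x | legendre P v x ≤ 0} with hK
  have hp₀K : p₀ ∈ K := by
    have := hf.min_eq
    have := hf.pos
    simp only [hK, mem_ofPred_eq]
    linarith
  have hKne : Nonempty K := ⟨⟨p₀, hp₀K⟩⟩
  -- The supremum defining the biconjugate of `v` is restricted to the slopes in `K`. These are
  -- bounded by `2 n l`, which becomes the Lipschitz constant.
  set w : EuclideanSpace ℝ (Fin n) → ℝ :=
    fun y => ⨆ x : K, (inner ℝ (x : EuclideanSpace ℝ (Fin n)) y - legendre P v x) with hw
  have hterm : ∀ y, ∀ x ∈ K, inner ℝ x y - legendre P v x ≤ 2 * n * l * ‖y‖ + m := by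
    intro y x hx
    have h1 := hf.norm_le hne hpos hl hx
    have h2 := real_inner_le_norm x y
    have h3 := mul_le_mul_of_nonneg_right h1 (norm_nonneg y)
    linarith [hf.min_le x]
  have hbdd : ∀ y, BddAbove (range fun x : K =>
      inner ℝ (x : EuclideanSpace ℝ (Fin n)) y - legendre P v x) := by
    rintro y
    refine ⟨2 * n * l * ‖y‖ + m, ?_⟩
    rintro _ ⟨x, rfl⟩
    exact hterm y x x.2
  have hle : ∀ y, ∀ x ∈ K, inner ℝ x y - legendre P v x ≤ w y := fun y x hx =>
    le_ciSup (hbdd y) (⟨x, hx⟩ : K)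
  have hwv : ∀ y ∈ P, w y ≤ v y := fun y hy => ciSup_le fun x => by
    linarith [le_legendre hPb hv0 x hy]
  have hwm : ∀ y, m ≤ w y - inner ℝ p₀ y := fun y => by
    have := hle y p₀ hp₀K
    rw [hf.min_eq] at this
    linarith
  refine ⟨w, ⟨convex_univ, fun y _ z _ a b ha hb hab => ciSup_le fun x => ?_⟩, ?_, hwv, hwm,
    fun y => ciSup_le fun x => hterm y x x.2, fun x => ?_⟩
  · rw [inner_add_right, real_inner_smul_right, real_inner_smul_right, smul_eq_mul, smul_eq_mul]
    have h1 := mul_le_mul_of_nonneg_left (hle y x x.2) ha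
    have h2 := mul_le_mul_of_nonneg_left (hle z x x.2) hb
    have h3 : a * legendre P v x + b * legendre P v x = legendre P v x := by
      rw [← add_mul, hab, one_mul]
    linarith
  · refine LipschitzWith.of_le_add_mul _ fun y z => ciSup_le fun x => ?_
    have h1 := hle z x x.2
    have h2 := real_inner_le_norm (x : EuclideanSpace ℝ (Fin n)) (y - z)
    have h3 := mul_le_mul_of_nonneg_right (hf.norm_le hne hpos hl x.2) (norm_nonneg (y - z))
    rw [inner_sub_right] at h2
    rw [Real.coe_toNNReal _ (by positivity), dist_eq_norm]
    linarith
  · have hb : ∃ c, ∀ y ∈ P, c ≤ w y := by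
      obtain ⟨R, hR⟩ := hPb.exists_norm_le
      refine ⟨m - ‖p₀‖ * R, fun y hy => ?_⟩
      have h1 := hwm y
      have h2 := abs_real_inner_le_norm p₀ y
      have h3 := mul_le_mul_of_nonneg_left (hR y hy) (norm_nonneg p₀)
      have h4 := neg_abs_le (inner ℝ p₀ y)
      linarith
    obtain ⟨c, hc⟩ := hb
    -- As `w ≤ v`, the transform of `w` is at least `u`; on `K` the definition of `w` gives the
    -- reverse inequality, and off `K` both transforms are positive, so both truncations vanish.
    have h1 : legendre P v x ≤ legendre P w x := by
      have := legendre_le_add (w := v) (ε := 0) hPb hne hc (fun y hy => by linarith [hwv y hy]) x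
      linarith
    by_cases hx : x ∈ K
    · have h2 : legendre P w x ≤ legendre P v x := legendre_le hne fun y _ => by
        linarith [hle y x hx]
      rw [le_antisymm h2 h1]
    · have hx' : 0 < legendre P v x := not_le.1 hx
      rw [max_eq_right (by linarith), max_eq_right (by linarith)]

/-- The standing assumptions on `P` and `h`. -/
structure IsConvexDomain (P : Set (EuclideanSpace ℝ (Fin n)))
    (h : EuclideanSpace ℝ (Fin n) → ℝ) : Prop where
  one_le : 1 ≤ n
  isOpen : IsOpen P
  convex : Convex ℝ P
  bounded : Bornology.IsBounded P
  zero_mem : 0 ∈ P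
  condA1 : CondA1 P h

lemma IsConvexDomain.nonempty (hD : IsConvexDomain P h) : P.Nonempty := ⟨0, hD.zero_mem⟩

lemma IsConvexDomain.ae_mem (hD : IsConvexDomain P h) : ∀ᵐ y ∂weight P h, y ∈ P := ae_mem_weight hD.isOpen

lemma IsConvexDomain.isFiniteMeasure (hD : IsConvexDomain P h) : IsFiniteMeasure (weight P h) :=
  isFiniteMeasure_weight hD.condA1 hD.isOpen hD.bounded

lemma IsConvexDomain.weight_ne_zero (hD : IsConvexDomain P h) : weight P h ≠ 0 :=
  FreeBdyMA.weight_ne_zero hD.condA1 hD.isOpen hD.nonempty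

lemma IsConvexDomain.weight_pos (hD : IsConvexDomain P h) : 0 < (weight P h).real univ := by
  have := hD.isFiniteMeasure
  have : NeZero (weight P h) := ⟨hD.weight_ne_zero⟩
  exact measureReal_univ_pos

lemma IsConvexDomain.pos_of_mem {v : EuclideanSpace ℝ (Fin n) → ℝ} (hv : v ∈ classCplus P) :
    ∀ y ∈ P, 0 < v y := fun y hy => hv.2 y (subset_closure hy)

lemma IsConvexDomain.continuous_legendre (hD : IsConvexDomain P h) (hv : v ∈ classCplus P) :
    Continuous (legendre P v) :=
  FreeBdyMA.continuous_legendre hD.bounded hD.nonempty (c := 0)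
    fun y hy => (hv.2 y (subset_closure hy)).le

lemma IsConvexDomain.exists_isFrame (hD : IsConvexDomain P h) (hv : v ∈ classCplus P) :
    ∃ m p₀ e T, IsFrame P v m p₀ e T :=
  FreeBdyMA.exists_isFrame hD.isOpen hD.bounded hD.zero_mem (hv.1.subset subset_closure hD.convex)
    (IsConvexDomain.pos_of_mem hv)

lemma IsFrame.funI_ne_top (hf : IsFrame P v m p₀ e T) (hp : GoodPair g F G)
    (hc : Continuous (legendre P v)) : funI P F v ≠ ⊤ :=
  ne_top_of_le_ne_top ENNReal.ofReal_ne_top (hf.funI_le_det hp hc)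

lemma IsFrame.funI_toReal_pos (hf : IsFrame P v m p₀ e T) (hp : GoodPair g F G)
    (hc : Continuous (legendre P v)) : 0 < (funI P F v).toReal :=
  ENNReal.toReal_pos (funI_pos hp hc (p := p₀) (by rw [hf.min_eq]; linarith [hf.pos])).ne'
    (hf.funI_ne_top hp hc)

lemma energy_of_average (hD : IsConvexDomain P h) (hp : GoodPair g F G) (hv : v ∈ classCplus P)
    (hint : Integrable (fun y => G (v y)) (weight P h)) {s : ℝ} (hs : 0 < s)
    (hGs : G s = ⨍ y, G (v y) ∂weight P h) (Λ : ℝ) :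
    energy P h F G Λ v = ((-Real.log (funI P F v).toReal + Λ * s : ℝ) : EReal) := by
  obtain ⟨m, p₀, e, T, hf⟩ := hD.exists_isFrame hv
  have hc := hD.continuous_legendre hv
  have hpos := hf.funI_toReal_pos hp hc
  unfold energy
  rw [funJ_of_integrable hD.condA1 hD.isOpen hint, ← hGs, hp.Ginv_eq hs,
    ENNReal.log_pos_real (ENNReal.toReal_pos_iff.1 hpos).1.ne' (hf.funI_ne_top hp hc)]
  push_cast
  rfl

lemma energy_of_not_integrable (hD : IsConvexDomain P h) (hp : GoodPair g F G)
    (hv : v ∈ classCP P h g) (hint : ¬ Integrable (fun y => G (v y)) (weight P h)) {Λ : ℝ}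
    (hΛ : 0 < Λ) : energy P h F G Λ v = ⊤ := by
  have := hD.isFiniteMeasure
  obtain ⟨hv1, hv2, hv3⟩ := (mem_classCP_iff hD.condA1 hD.isOpen).1 hv
  obtain ⟨m, p₀, e, T, hf⟩ := hD.exists_isFrame hv1
  have hc := hD.continuous_legendre hv1
  have hpos := hf.funI_toReal_pos hp hc
  unfold energy
  rw [funJ_of_not_integrable hD.condA1 hD.isOpen hint (lintegral_neg_G_ne_top hp hD.ae_mem hv2
    (IsConvexDomain.pos_of_mem hv1) hf.pos fun y hy =>
      hf.le_sub_inner hD.bounded (IsConvexDomain.pos_of_mem hv1) hy),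
    ENNReal.log_pos_real (ENNReal.toReal_pos_iff.1 hpos).1.ne' (hf.funI_ne_top hp hc),
    EReal.coe_mul_top_of_pos hΛ, ← EReal.coe_neg, EReal.coe_add_top]

lemma exists_average (hD : IsConvexDomain P h) (hp : GoodPair g F G) (hv : v ∈ classCplus P)
    (hint : Integrable (fun y => G (v y)) (weight P h)) :
    ∃ s, 0 < s ∧ G s = ⨍ y, G (v y) ∂weight P h := by
  have := hD.isFiniteMeasure
  exact exists_eq_average hp hD.ae_mem hD.weight_ne_zero (IsConvexDomain.pos_of_mem hv) hint

lemma weight_mul_eq_integral (hD : IsConvexDomain P h) {s : ℝ}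
    (hGs : G s = ⨍ y, G (v y) ∂weight P h) :
    (weight P h).real univ * G s = ∫ y, G (v y) ∂weight P h := by
  rw [hGs, average_eq, smul_eq_mul, mul_inv_cancel_left₀ hD.weight_pos.ne']

/-- The tilt of `v` by `p₀` lies above the constant `m`, so comparison with this constant bounds
`J(v)` from below. -/
lemma IsFrame.le_average (hf : IsFrame P v m p₀ e T) (hD : IsConvexDomain P h) (hp : GoodPair g F G)
    (hv : v ∈ classCP P h g) (hint : Integrable (fun y => G (v y)) (weight P h)) {s : ℝ}
    (hs : 0 < s) (hGs : G s = ⨍ y, G (v y) ∂weight P h) : m ≤ s := by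
  have := hD.isFiniteMeasure
  obtain ⟨hv1, hv2, hv3⟩ := (mem_classCP_iff hD.condA1 hD.isOpen).1 hv
  have h1 := integral_G_le hp hD.ae_mem hv2 hv3 (IsConvexDomain.pos_of_mem hv1) hint
    (w := fun _ => m) (p := p₀) (fun _ _ => hf.pos)
    (fun y hy => hf.le_sub_inner hD.bounded (IsConvexDomain.pos_of_mem hv1) hy) (integrable_const _)
  rw [integral_const, ← weight_mul_eq_integral hD hGs, smul_eq_mul] at h1
  exact hp.le_of_G_le hf.pos hs (le_of_mul_le_mul_left h1 hD.weight_pos)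

/-- The same comparison with the sharper barrier `κ max(m, ‖T y‖)`. This is the inequality through
which `J` controls the frame. -/
lemma IsFrame.integral_le (hf : IsFrame P v m p₀ e T) (hD : IsConvexDomain P h) (hp : GoodPair g F G)
    (hv : v ∈ classCP P h g) (hint : Integrable (fun y => G (v y)) (weight P h)) {s : ℝ}
    (hGs : G s = ⨍ y, G (v y) ∂weight P h) :
    ∫ y, G (1 / ((n : ℝ) + 1) ^ 2 * max m ‖T y‖) ∂weight P h ≤ (weight P h).real univ * G s := by
  have := hD.isFiniteMeasure
  obtain ⟨hv1, hv2, hv3⟩ := (mem_classCP_iff hD.condA1 hD.isOpen).1 hv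
  obtain ⟨p, hpv⟩ := hf.exists_le_sub_inner hD.bounded (IsConvexDomain.pos_of_mem hv1)
  rw [weight_mul_eq_integral hD hGs]
  refine integral_G_le hp hD.ae_mem hv2 hv3 (IsConvexDomain.pos_of_mem hv1) hint (p := p)
    (fun y _ => mul_pos (by positivity) (lt_max_of_lt_left hf.pos)) hpv ?_
  exact integrable_of_continuousOn hD.bounded hD.ae_mem
    (IsFrame.continuous_integrand hf.pos hp (by positivity)).continuousOn

end FreeBdyMA

namespace FreeBdyMA

variable {n : ℕ} {P : Set (EuclideanSpace ℝ (Fin n))} {h : EuclideanSpace ℝ (Fin n) → ℝ}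
  {g F G : ℝ → ℝ}

/-! ### Existence of minimizers for coercive energies -/

/-- Sublevel sets of the energy are bounded, in terms of frames. -/
def IsCoercive (P : Set (EuclideanSpace ℝ (Fin n))) (h : EuclideanSpace ℝ (Fin n) → ℝ)
    (g F G : ℝ → ℝ) (Λ : ℝ) : Prop :=
  ∀ E : ℝ, ∃ m₀ R L : ℝ, 0 < m₀ ∧ 0 ≤ L ∧ ∀ v ∈ classCP P h g,
    Integrable (fun y => G (v y)) (weight P h) → ∀ s, 0 < s → G s = ⨍ y, G (v y) ∂weight P h →
    -Real.log (funI P F v).toReal + Λ * s ≤ E → ∀ m p₀ e T, IsFrame P v m p₀ e T →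
    m₀ ≤ m ∧ s ≤ R ∧ ∀ i, ‖e i‖ ≤ L

/-- Every Lipschitz convex function can be normalized by adding an affine function. -/
def HasNormalization (P : Set (EuclideanSpace ℝ (Fin n))) (h : EuclideanSpace ℝ (Fin n) → ℝ)
    (g : ℝ → ℝ) : Prop :=
  ∀ (w : EuclideanSpace ℝ (Fin n) → ℝ) (K : NNReal), ConvexOn ℝ (closure P) w →
    LipschitzOnWith K w (closure P) →
    (∃ p c, 0 < c ∧ ∀ y ∈ closure P, c ≤ w y - inner ℝ p y) →
    ∃ p, (fun y => w y - inner ℝ p y) ∈ classCP P h g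

lemma exists_subseq_tendsto (hPb : Bornology.IsBounded P) {w : ℕ → EuclideanSpace ℝ (Fin n) → ℝ}
    {K : NNReal} (hw : ∀ k, LipschitzWith K (w k)) {B : ℝ} (hB : ∀ k, ∀ y ∈ closure P, |w k y| ≤ B) :
    ∃ (W : EuclideanSpace ℝ (Fin n) → ℝ) (φ : ℕ → ℕ), StrictMono φ ∧
      LipschitzOnWith K W (closure P) ∧ TendstoUniformlyOn (fun k => w (φ k)) W atTop (closure P) := by
  have hcomp : CompactSpace (closure P) := isCompact_iff_compactSpace.1 hPb.isCompact_closure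
  set A : Set (BoundedContinuousFunction (closure P) ℝ) :=
    {f | LipschitzWith K f ∧ ∀ y, f y ∈ Icc (-B) B} with hA
  have hAc : IsCompact A := by
    refine BoundedContinuousFunction.arzela_ascoli₂ (Icc (-B) B) isCompact_Icc A ?_
      (fun f y hf => hf.2 y) ?_
    · have h1 : A = (fun f : BoundedContinuousFunction (closure P) ℝ => (f : closure P → ℝ)) ⁻¹'
          ({f : closure P → ℝ | LipschitzWith K f} ∩ {f | ∀ y, f y ∈ Icc (-B) B}) := rfl
      rw [h1]
      refine IsClosed.preimage BoundedContinuousFunction.continuous_coe ?_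
      refine (isClosed_setOfPred_lipschitzWith K).inter ?_
      rw [ofPred_forall]
      exact isClosed_iInter fun y => isClosed_Icc.preimage (continuous_apply y)
    · exact LipschitzWith.uniformEquicontinuous (fun f : A => ((f : _) : closure P → ℝ)) K
        (fun f => f.2.1) |>.equicontinuous
  set f : ℕ → BoundedContinuousFunction (closure P) ℝ := fun k =>
    BoundedContinuousFunction.mkOfCompact ⟨fun y => w k y, (hw k).continuous.comp
      continuous_subtype_val⟩ with hf
  have hfA : ∀ k, f k ∈ A := fun k =>
    ⟨fun y z => hw k y z, fun y => abs_le.1 (hB k y y.2)⟩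
  obtain ⟨W, hW, φ, hφ, hlim⟩ := hAc.tendsto_subseq hfA
  classical
  -- Arzelà–Ascoli gives a limit on `closure P` only; the value `0` elsewhere is arbitrary.
  set W' : EuclideanSpace ℝ (Fin n) → ℝ := fun y => if hy : y ∈ closure P then W ⟨y, hy⟩ else 0
    with hW'
  have hWeq : ∀ y (hy : y ∈ closure P), W' y = W ⟨y, hy⟩ := fun y hy => dif_pos hy
  refine ⟨W', φ, hφ, ?_, ?_⟩
  · intro y hy z hz
    rw [hWeq y hy, hWeq z hz]
    exact hW.1 ⟨y, hy⟩ ⟨z, hz⟩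
  · rw [Metric.tendstoUniformlyOn_iff]
    intro ε hε
    filter_upwards [(Metric.tendsto_nhds.1 hlim) ε hε] with k hk y hy
    rw [hWeq y hy, dist_comm]
    exact (BoundedContinuousFunction.dist_coe_le_dist (f := (f ∘ φ) k) (g := W) ⟨y, hy⟩).trans_lt hk

/-- The functional `I` is continuous under uniform convergence with uniformly bounded `{u < 0}`. -/
lemma tendsto_funI (hPb : Bornology.IsBounded P) (hne : P.Nonempty) (hp : GoodPair g F G)
    {w : ℕ → EuclideanSpace ℝ (Fin n) → ℝ} {W : EuclideanSpace ℝ (Fin n) → ℝ} {B R M : ℝ}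
    (hB : ∀ k, ∀ y ∈ P, -B ≤ w k y) (hWB : ∀ y ∈ P, -B ≤ W y)
    (hlim : TendstoUniformlyOn w W atTop P)
    (hR : ∀ k x, legendre P (w k) x < 0 → ‖x‖ ≤ R) (hM : ∀ k x, -M ≤ legendre P (w k) x) :
    Tendsto (fun k => funI P F (w k)) atTop (𝓝 (funI P F W)) := by
  have hc : ∀ k, Continuous (legendre P (w k)) := fun k => continuous_legendre hPb hne (hB k)
  have hcW : Continuous (legendre P W) := continuous_legendre hPb hne hWB
  have hpt : ∀ x, Tendsto (fun k => legendre P (w k) x) atTop (𝓝 (legendre P W x)) := by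
    intro x
    rw [Metric.tendsto_nhds]
    intro ε hε
    filter_upwards [(Metric.tendstoUniformlyOn_iff.1 hlim) (ε / 2) (by linarith)] with k hk
    have h1 := legendre_le_add (w := W) (ε := ε / 2) hPb hne (hB k) (fun y hy => by
      have := hk y hy
      rw [Real.dist_eq, abs_lt] at this
      linarith) x
    have h2 := legendre_le_add (v := W) (w := w k) (ε := ε / 2) hPb hne hWB (fun y hy => by
      have := hk y hy
      rw [Real.dist_eq, abs_lt] at this
      linarith) x
    rw [Real.dist_eq, abs_lt]
    constructor <;> linarith
  have hRW : ∀ x, legendre P W x < 0 → ‖x‖ ≤ R := fun x hx => by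
    obtain ⟨k, hk⟩ := ((hpt x).eventually_lt_const hx).exists
    exact hR k x hk
  rw [funI_eq_setLIntegral hp hcW hRW]
  simp_rw [fun k => funI_eq_setLIntegral hp (hc k) (hR k)]
  have hFc : Continuous fun x : ℝ => F (max (-x) 0) :=
    hp.F_cont.comp_continuous (by fun_prop) fun x => mem_Ici.2 (le_max_right _ _)
  refine tendsto_lintegral_of_dominated_convergence (fun _ => ENNReal.ofReal (F (max M 0)))
    (fun k => (ENNReal.continuous_ofReal.comp (hFc.comp (hc k))).measurable)
    (fun k => Eventually.of_forall fun x => ?_) ?_ (Eventually.of_forall fun x => ?_)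
  · refine ENNReal.ofReal_le_ofReal (hp.F_le (le_max_right _ _) ?_)
    exact max_le_max_right _ (by linarith [hM k x])
  · rw [lintegral_const, Measure.restrict_apply_univ]
    exact (ENNReal.mul_lt_top ENNReal.ofReal_lt_top measure_closedBall_lt_top).ne
  · exact (ENNReal.continuous_ofReal.tendsto _).comp ((hFc.tendsto _).comp (hpt x))

/-- The common lower bound `c > 0` keeps all arguments away from the singularity of `G` at `0`, and
uniform convergence bounds them above, so a constant dominates. -/
lemma tendsto_integral_G {μ : Measure (EuclideanSpace ℝ (Fin n))} [IsFiniteMeasure μ]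
    (hPb : Bornology.IsBounded P) (hμ : ∀ᵐ y ∂μ, y ∈ P) (hp : GoodPair g F G)
    {w : ℕ → EuclideanSpace ℝ (Fin n) → ℝ} {W : EuclideanSpace ℝ (Fin n) → ℝ} {c : ℝ}
    (hw : ∀ k, ContinuousOn (w k) (closure P)) (hW : ContinuousOn W (closure P)) (hc : 0 < c)
    (hcw : ∀ k, ∀ y ∈ closure P, c ≤ w k y) (hcW : ∀ y ∈ closure P, c ≤ W y)
    (hlim : TendstoUniformlyOn w W atTop (closure P)) :
    Tendsto (fun k => ∫ y, G (w k y) ∂μ) atTop (𝓝 (∫ y, G (W y) ∂μ)) := by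
  obtain ⟨B, hB⟩ := hPb.isCompact_closure.exists_bound_of_continuousOn hW
  have hev : ∀ᶠ k in atTop, ∀ y ∈ closure P, w k y ≤ B + 1 := by
    filter_upwards [(Metric.tendstoUniformlyOn_iff.1 hlim) 1 one_pos] with k hk y hy
    have h1 := hk y hy
    have h2 := hB y hy
    rw [Real.dist_eq, abs_lt] at h1
    rw [Real.norm_eq_abs, abs_le] at h2
    linarith
  refine tendsto_integral_filter_of_dominated_convergence
    (fun _ => max |G c| |G (B + 1)|) ?_ ?_ (integrable_const _) ?_
  · refine Eventually.of_forall fun k => ?_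
    exact (integrable_of_continuousOn hPb hμ (hp.G_cont.comp (hw k) fun y hy =>
      hc.trans_le (hcw k y hy))).aestronglyMeasurable
  · filter_upwards [hev] with k hk
    filter_upwards [hμ] with y hy
    have hy' := subset_closure hy
    have h1 := hp.G_le hc (hcw k y hy')
    have h2 := hp.G_le (hc.trans_le (hcw k y hy')) (hk y hy')
    rw [Real.norm_eq_abs]
    exact abs_le_max_abs_abs h1 h2
  · filter_upwards [hμ] with y hy
    have hy' := subset_closure hy
    exact ((hp.G_deriv _ (hc.trans_le (hcW y hy'))).continuousAt.tendsto).comp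
      (hlim.tendsto_at hy')

end FreeBdyMA

/-! ### The direct method -/

namespace FreeBdyMA

variable {n : ℕ} {P : Set (EuclideanSpace ℝ (Fin n))} {h : EuclideanSpace ℝ (Fin n) → ℝ}
  {g F G : ℝ → ℝ}

lemma exists_energy_lt_top (hD : IsConvexDomain P h) (hp : GoodPair g F G)
    (hN : HasNormalization P h g) (Λ : ℝ) :
    ∃ v ∈ classCP P h g, energy P h F G Λ v < ⊤ := by
  have := hD.isFiniteMeasure
  obtain ⟨p, hv⟩ := hN (fun _ => 1) 0 (convexOn_const _ hD.convex.closure)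
    (LipschitzWith.const (1 : ℝ)).lipschitzOnWith ⟨0, 1, one_pos, fun y _ => by simp⟩
  have hint : Integrable (fun y => G (1 - inner ℝ p y)) (weight P h) := by
    refine integrable_of_continuousOn hD.bounded hD.ae_mem ?_
    refine hp.G_cont.comp (by fun_prop) fun y hy => hv.1.2 y hy
  obtain ⟨s, hs, hGs⟩ := exists_average hD hp hv.1 hint
  refine ⟨_, hv, ?_⟩
  rw [energy_of_average hD hp hv.1 hint hs hGs]
  exact EReal.coe_lt_top _

/-- One member of a minimizing sequence, together with its regularization. -/
lemma exists_regularized (hD : IsConvexDomain P h) (hp : GoodPair g F G) {Λ : ℝ} (hΛ : 0 < Λ)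
    {E m₀ R L : ℝ} (hm₀ : 0 < m₀) (hL : 0 ≤ L)
    (hco : ∀ v ∈ classCP P h g,
      Integrable (fun y => G (v y)) (weight P h) → ∀ s, 0 < s → G s = ⨍ y, G (v y) ∂weight P h →
      -Real.log (funI P F v).toReal + Λ * s ≤ E → ∀ m p₀ e T, IsFrame P v m p₀ e T →
      m₀ ≤ m ∧ s ≤ R ∧ ∀ i, ‖e i‖ ≤ L)
    {v : EuclideanSpace ℝ (Fin n) → ℝ} (hv : v ∈ classCP P h g)
    (hvE : energy P h F G Λ v < E) :
    ∃ (w : EuclideanSpace ℝ (Fin n) → ℝ) (s : ℝ) (p : EuclideanSpace ℝ (Fin n)),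
      ConvexOn ℝ univ w ∧ LipschitzWith (Real.toNNReal (2 * n * L)) w ∧ s ∈ Icc m₀ R ∧
      ‖p‖ ≤ 2 * n * L ∧ (∀ y, m₀ ≤ w y - inner ℝ p y) ∧ (∀ y, w y ≤ 2 * n * L * ‖y‖ + R) ∧
      (∀ x, legendre P w x < 0 → ‖x‖ ≤ 2 * n * L) ∧ (∀ x, -R ≤ legendre P w x) ∧
      energy P h F G Λ v = ((-Real.log (funI P F w).toReal + Λ * s : ℝ) : EReal) ∧
      ∀ q c, 0 < c → (∀ y ∈ closure P, c ≤ w y - inner ℝ q y) →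
        ∫ y, G (w y - inner ℝ q y) ∂weight P h ≤ (weight P h).real univ * G s := by
  have := hD.isFiniteMeasure
  have hint : Integrable (fun y => G (v y)) (weight P h) := by
    by_contra hint
    rw [energy_of_not_integrable hD hp hv hint hΛ] at hvE
    exact absurd hvE (by simp)
  obtain ⟨hv1, hv2, hv3⟩ := (mem_classCP_iff hD.condA1 hD.isOpen).1 hv
  have hpos := IsConvexDomain.pos_of_mem hv1
  obtain ⟨s, hs, hGs⟩ := exists_average hD hp hv1 hint
  have hen := energy_of_average hD hp hv1 hint hs hGs Λ
  rw [hen] at hvE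
  obtain ⟨m, p₀, e, T, hf⟩ := hD.exists_isFrame hv1
  obtain ⟨hm, hsR, hl⟩ := hco v hv hint s hs hGs (EReal.coe_lt_coe_iff.1 hvE).le m p₀ e T hf
  have hms := hf.le_average hD hp hv hint hs hGs
  obtain ⟨w, hw1, hw2, hw3, hw4, hw5, hw6⟩ :=
    exists_regularization hD.bounded hD.nonempty hf hpos hl hL
  have hwP : ∃ c, ∀ y ∈ P, c ≤ w y := by
    obtain ⟨B, hB⟩ := hD.bounded.isCompact_closure.exists_bound_of_continuousOn
      hw2.continuous.continuousOn
    exact ⟨-B, fun y hy => (abs_le.1 (hB y (subset_closure hy))).1⟩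
  obtain ⟨c, hc⟩ := hwP
  have hwc := continuous_legendre hD.bounded hD.nonempty hc
  have hI : funI P F w = funI P F v := by
    rw [funI_eq_lintegral hp hwc, funI_eq_lintegral hp (hD.continuous_legendre hv1)]
    simp_rw [hw6]
  refine ⟨w, s, p₀, hw1, hw2, ⟨hm.trans hms, hsR⟩, ?_, fun y => hm.trans (hw4 y), fun y => ?_,
    fun x hx => ?_, fun x => ?_, ?_, fun q c hc hcq => ?_⟩
  · exact hf.norm_le hD.nonempty hpos hl (by rw [hf.min_eq]; linarith [hf.pos])
  · linarith [hw5 y]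
  · refine hf.norm_le hD.nonempty hpos hl ?_
    have h1 := hw6 x
    rw [max_eq_left (by linarith)] at h1
    by_contra h2
    rw [max_eq_right (by linarith)] at h1
    linarith
  · have h1 := hw6 x
    have h2 := le_max_left (-legendre P w x) 0
    have h3 : max (-legendre P v x) 0 ≤ m := max_le (by linarith [hf.min_le x]) hf.pos.le
    linarith
  · rw [hen, hI]
  -- The regularization `w` need not be normalized. What it inherits from `v`, because `w ≤ v`, is
  -- this inequality for all admissible slopes `q`, a form of the normalization that is stable under
  -- limits.
  · rw [weight_mul_eq_integral hD hGs]
    refine integral_G_le hp hD.ae_mem hv2 hv3 hpos hint (p := q)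
      (fun y hy => hc.trans_le (hcq y (subset_closure hy))) (fun y hy => by linarith [hw3 y hy]) ?_
    refine integrable_of_continuousOn hD.bounded hD.ae_mem (hp.G_cont.comp ?_ fun y hy =>
      hc.trans_le (hcq y hy))
    exact (hw2.continuous.sub (by fun_prop)).continuousOn

/-- A coercive energy attains its infimum. -/
theorem attainsInf_of_isCoercive (hD : IsConvexDomain P h) (hp : GoodPair g F G)
    (hN : HasNormalization P h g) {Λ : ℝ} (hΛ : 0 < Λ) (hco : IsCoercive P h g F G Λ) :
    AttainsInf P h g F G Λ := by
  have := hD.isFiniteMeasure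
  obtain ⟨v₁, hv₁, hv₁top⟩ := exists_energy_lt_top hD hp hN Λ
  set S : Set EReal := energy P h F G Λ '' classCP P h g with hS
  have hSinf : sInf S = ⨅ w ∈ classCP P h g, energy P h F G Λ w := sInf_image
  obtain ⟨a, ha, halim, haS⟩ := exists_seq_tendsto_sInf (S := S) ⟨_, mem_image_of_mem _ hv₁⟩
    (OrderBot.bddBelow S)
  have hlt : sInf S < ⊤ := (sInf_le (mem_image_of_mem _ hv₁)).trans_lt hv₁top
  -- A real level above the infimum: from index `k₀` on the minimizing sequence lies below it, where
  -- coercivity gives uniform bounds.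
  obtain ⟨E, hE1, -⟩ := EReal.lt_iff_exists_real_btwn.1 hlt
  obtain ⟨k₀, hk₀⟩ := (halim.eventually_lt_const hE1).exists_forall_of_atTop
  obtain ⟨m₀, R, L, hm₀, hL, hcoE⟩ := hco E
  have hstep : ∀ k, ∃ (w : EuclideanSpace ℝ (Fin n) → ℝ) (s : ℝ) (p : EuclideanSpace ℝ (Fin n)),
      ConvexOn ℝ univ w ∧ LipschitzWith (Real.toNNReal (2 * n * L)) w ∧ s ∈ Icc m₀ R ∧
      ‖p‖ ≤ 2 * n * L ∧ (∀ y, m₀ ≤ w y - inner ℝ p y) ∧ (∀ y, w y ≤ 2 * n * L * ‖y‖ + R) ∧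
      (∀ x, legendre P w x < 0 → ‖x‖ ≤ 2 * n * L) ∧ (∀ x, -R ≤ legendre P w x) ∧
      a (k + k₀) = ((-Real.log (funI P F w).toReal + Λ * s : ℝ) : EReal) ∧
      ∀ q c, 0 < c → (∀ y ∈ closure P, c ≤ w y - inner ℝ q y) →
        ∫ y, G (w y - inner ℝ q y) ∂weight P h ≤ (weight P h).real univ * G s := by
    intro k
    obtain ⟨v, hv, hva⟩ := haS (k + k₀)
    have hvE : energy P h F G Λ v < E := by
      rw [hva]
      exact hk₀ _ (Nat.le_add_left _ _)
    obtain ⟨w, s, p, hh⟩ := exists_regularized hD hp hΛ hm₀ hL hcoE hv hvE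
    rw [hva] at hh
    exact ⟨w, s, p, hh⟩
  choose w s p hconv hlip hs hpn hlow hup hball hmin hen hG using hstep
  obtain ⟨ρ, hρ0, hρ⟩ : ∃ ρ > 0, ∀ y ∈ closure P, ‖y‖ ≤ ρ :=
    hD.bounded.closure.exists_pos_norm_le
  have hR0 : 0 ≤ R := hm₀.le.trans ((hs 0).1.trans (hs 0).2)
  set B := 2 * n * L * ρ + R with hB
  have hnL : 0 ≤ 2 * n * L := by positivity
  have hwB : ∀ k, ∀ y ∈ closure P, |w k y| ≤ B := by
    intro k y hy
    have h1 := hup k y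
    have h2 := hlow k y
    have h3 := mul_le_mul_of_nonneg_left (hρ y hy) hnL
    have h4 := abs_real_inner_le_norm (p k) y
    have h5 := mul_le_mul_of_nonneg_right (hpn k) (norm_nonneg y)
    have h6 := neg_abs_le (inner ℝ (p k) y)
    rw [abs_le]
    constructor <;> linarith
  obtain ⟨W, φ₀, hφ₀, hWlip, hlim₀⟩ := exists_subseq_tendsto hD.bounded hlip hwB
  obtain ⟨⟨s', p'⟩, hsp, φ₁, hφ₁, hsplim⟩ :=
    (isCompact_Icc.prod (isCompact_closedBall (0 : EuclideanSpace ℝ (Fin n)) (2 * n * L))).tendsto_subseq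
    (x := fun k => (s (φ₀ k), p (φ₀ k))) fun k => ⟨hs _, mem_closedBall_zero_iff.2 (hpn _)⟩
  have hslim : Tendsto (fun k => s (φ₀ (φ₁ k))) atTop (𝓝 s') :=
    (continuous_fst.tendsto _).comp hsplim
  have hplim : Tendsto (fun k => p (φ₀ (φ₁ k))) atTop (𝓝 p') :=
    (continuous_snd.tendsto _).comp hsplim
  have hs' : 0 < s' := hm₀.trans_le hsp.1.1
  have hφ : Tendsto (fun k => φ₀ (φ₁ k)) atTop atTop := hφ₀.tendsto_atTop.comp hφ₁.tendsto_atTop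
  have hlim : TendstoUniformlyOn (fun k => w (φ₀ (φ₁ k))) W atTop (closure P) := by
    rw [Metric.tendstoUniformlyOn_iff] at hlim₀ ⊢
    exact fun ε hε => hφ₁.tendsto_atTop.eventually (hlim₀ ε hε)
  have hpt : ∀ y ∈ closure P, Tendsto (fun k => w (φ₀ (φ₁ k)) y) atTop (𝓝 (W y)) :=
    fun y hy => hlim.tendsto_at hy
  have hWconv : ConvexOn ℝ (closure P) W := by
    refine ⟨hD.convex.closure, fun y hy z hz α β hα hβ hαβ => ?_⟩
    refine le_of_tendsto_of_tendsto' (hpt _ (hD.convex.closure hy hz hα hβ hαβ))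
      (((hpt y hy).const_smul α).add ((hpt z hz).const_smul β)) fun k => ?_
    exact (hconv _).2 (mem_univ y) (mem_univ z) hα hβ hαβ
  have hWlow : ∀ y ∈ closure P, m₀ ≤ W y - inner ℝ p' y := fun y hy =>
    ge_of_tendsto' ((hpt y hy).sub (hplim.inner tendsto_const_nhds)) fun k => hlow _ y
  -- The limit `W` has a tilt bounded below by `m₀`, hence can be normalized. The slope `q` found
  -- here is then applied to the whole sequence as well.
  obtain ⟨q, hq⟩ := hN W _ hWconv hWlip ⟨p', m₀, hm₀, hWlow⟩
  set V : EuclideanSpace ℝ (Fin n) → ℝ := fun y => W y - inner ℝ q y with hV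
  have hVc : ContinuousOn V (closure P) := hWlip.continuousOn.sub (by fun_prop)
  obtain ⟨y₀, hy₀, hVmin⟩ := hD.bounded.isCompact_closure.exists_isMinOn
    ⟨0, subset_closure hD.zero_mem⟩ hVc
  set c := V y₀ with hc
  have hc0 : 0 < c := hq.1.2 y₀ hy₀
  have hVge : ∀ y ∈ closure P, c ≤ V y := fun y hy => hVmin hy
  have hev : ∀ᶠ k in atTop, ∀ y ∈ closure P, c / 2 ≤ w (φ₀ (φ₁ k)) y - inner ℝ q y := by
    filter_upwards [(Metric.tendstoUniformlyOn_iff.1 hlim) (c / 2) (by linarith)] with k hk y hy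
    have h1 := hk y hy
    have h2 := hVge y hy
    rw [Real.dist_eq, abs_lt] at h1
    simp only [hV] at h2
    linarith
  obtain ⟨k₁, hk₁⟩ := eventually_atTop.1 hev
  have hshift : Tendsto (fun k => k + k₁) atTop atTop := tendsto_add_atTop_nat k₁
  have hGlim : Tendsto (fun k => ∫ y, G (w (φ₀ (φ₁ (k + k₁))) y - inner ℝ q y) ∂weight P h) atTop
      (𝓝 (∫ y, G (V y) ∂weight P h)) := by
    refine tendsto_integral_G (c := c / 2) hD.bounded hD.ae_mem hp
      (w := fun k y => w (φ₀ (φ₁ (k + k₁))) y - inner ℝ q y)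
      (fun k => ((hlip _).continuous.sub (by fun_prop)).continuousOn) hVc (by linarith)
      (fun k => hk₁ _ (Nat.le_add_left _ _)) (fun y hy => by linarith [hVge y hy]) ?_
    rw [Metric.tendstoUniformlyOn_iff] at hlim ⊢
    intro ε hε
    filter_upwards [hshift.eventually (hlim ε hε)] with k hk y hy
    have := hk y hy
    simpa [hV] using this
  have hVint : Integrable (fun y => G (V y)) (weight P h) :=
    integrable_of_continuousOn hD.bounded hD.ae_mem
      (hp.G_cont.comp hVc fun y hy => hc0.trans_le (hVge y hy))
  obtain ⟨sV, hsV, hGsV⟩ := exists_average hD hp hq.1 hVint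
  -- For the fixed slope `q`, the tilted regularizations satisfy `∫ G ≤ H G(s)` along the sequence;
  -- in the limit this gives `J(V) ≤ s'`. Only this direction is needed, because `Λ > 0`.
  have hsle : sV ≤ s' := by
    refine hp.le_of_G_le hsV hs' (le_of_mul_le_mul_left ?_ hD.weight_pos)
    rw [weight_mul_eq_integral hD hGsV]
    refine le_of_tendsto_of_tendsto' hGlim
      (((((hp.G_deriv s' hs').continuousAt.tendsto).comp (hslim.comp hshift))).const_mul
        ((weight P h).real univ)) fun k => ?_
    exact hG _ q (c / 2) (by linarith) (hk₁ _ (Nat.le_add_left _ _))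
  have hIlim : Tendsto (fun k => funI P F (w (φ₀ (φ₁ k)))) atTop (𝓝 (funI P F V)) := by
    rw [hV, funI_sub_inner]
    have hWB : ∀ y ∈ closure P, -B ≤ W y := fun y hy =>
      ge_of_tendsto' (hpt y hy) fun k => (abs_le.1 (hwB _ y hy)).1
    exact tendsto_funI (B := B) hD.bounded hD.nonempty hp
      (fun k y hy => (abs_le.1 (hwB _ y (subset_closure hy))).1)
      (fun y hy => hWB y (subset_closure hy)) (hlim.mono subset_closure)
      (fun k x hx => hball _ x hx) fun k x => hmin _ x
  obtain ⟨m, p₀, e, T, hf⟩ := hD.exists_isFrame hq.1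
  have hlc := hD.continuous_legendre hq.1
  have hIpos := hf.funI_toReal_pos hp hlc
  have hIr : Tendsto (fun k => (funI P F (w (φ₀ (φ₁ k)))).toReal) atTop
      (𝓝 (funI P F V).toReal) :=
    (ENNReal.tendsto_toReal (hf.funI_ne_top hp hlc)).comp hIlim
  have henlim : Tendsto (fun k => a (φ₀ (φ₁ k) + k₀)) atTop
      (𝓝 ((-Real.log (funI P F V).toReal + Λ * s' : ℝ) : EReal)) := by
    simp_rw [hen]
    refine (continuous_coe_real_ereal.tendsto _).comp ?_
    exact ((hIr.log hIpos.ne').neg).add (hslim.const_mul Λ)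
  have hinf : sInf S = ((-Real.log (funI P F V).toReal + Λ * s' : ℝ) : EReal) := by
    refine tendsto_nhds_unique ?_ henlim
    exact halim.comp ((tendsto_add_atTop_nat k₀).comp hφ)
  have henV := energy_of_average hD hp hq.1 hVint hsV hGsV Λ
  refine ⟨V, hq, ?_, ?_, ?_⟩
  · rw [henV]; exact EReal.coe_ne_bot _
  · rw [henV]; exact EReal.coe_ne_top _
  · rw [← hSinf]
    refine le_antisymm ?_ (sInf_le (mem_image_of_mem _ hq))
    rw [henV, hinf, EReal.coe_le_coe_iff]
    have := mul_le_mul_of_nonneg_left hsle hΛ.le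
    linarith

end FreeBdyMA

namespace FreeBdyMA

variable {n : ℕ} {P : Set (EuclideanSpace ℝ (Fin n))} {h : EuclideanSpace ℝ (Fin n) → ℝ}
  {g F G : ℝ → ℝ}

/-! ### Normalization of Lipschitz convex functions -/

lemma GoodPair.g_pos (hp : GoodPair g F G) {s : ℝ} (hs : 0 < s) : 0 < g s := by
  have h1 := hp.le_tangent hs (t := s + 1) (by linarith)
  have h2 := hp.G_mono (show s ∈ Ioi 0 from hs) (show s + 1 ∈ Ioi 0 by simp; linarith)
    (by linarith)
  simp only [add_sub_cancel_left, mul_one] at h1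
  linarith

lemma GoodPair.g_le (hp : GoodPair g F G) {s t : ℝ} (hs : 0 < s) (hst : s ≤ t) : g t ≤ g s := by
  rcases hst.eq_or_lt with rfl | hlt
  · exact le_rfl
  have ht := hs.trans_le hst
  have h1 := hp.le_tangent hs ht
  have h2 := hp.le_tangent ht hs
  have h3 : 0 ≤ (g s - g t) * (t - s) := by linarith
  have := nonneg_of_mul_nonneg_left h3 (by linarith)
  linarith

lemma mem_classCplus_sub_inner {w : EuclideanSpace ℝ (Fin n) → ℝ}
    (hw : ConvexOn ℝ (closure P) w) {p : EuclideanSpace ℝ (Fin n)}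
    (hpos : ∀ y ∈ closure P, 0 < w y - inner ℝ p y) :
    (fun y => w y - inner ℝ p y) ∈ classCplus P := by
  refine ⟨⟨hw.1, fun y hy z hz a b ha hb hab => ?_⟩, hpos⟩
  have := hw.2 hy hz ha hb hab
  simp only [inner_add_right, real_inner_smul_right, smul_eq_mul] at this ⊢
  linarith

/-- When `g` is constant, every positive convex function is normalized. -/
lemma hasNormalization_of_const (hD : IsConvexDomain P h) (hb : BarycenterZero P h) {c : ℝ}
    (hg : ∀ s, 0 < s → g s = c) : HasNormalization P h g := by
  intro w K hw _ ⟨p, c', hc', hwc⟩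
  have := hD.isFiniteMeasure
  have hpos : ∀ y ∈ closure P, 0 < w y - inner ℝ p y := fun y hy => hc'.trans_le (hwc y hy)
  refine ⟨p, (mem_classCP_iff hD.condA1 hD.isOpen).2 ⟨mem_classCplus_sub_inner hw hpos, ?_⟩⟩
  have hae : (fun y => g (w y - inner ℝ p y) • y) =ᵐ[weight P h] fun y => c • y := by
    filter_upwards [hD.ae_mem] with y hy
    rw [hg _ (hpos y (subset_closure hy))]
  refine ⟨(integrable_congr hae).2 (integrable_of_continuousOn hD.bounded hD.ae_mem
    (by fun_prop)), ?_⟩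
  rw [integral_congr_ae hae, integral_smul, integral_weight hD.condA1 hD.isOpen]
  have hb' : ∫ y in P, h y • y = 0 := hb
  rw [hb', smul_zero]

/-! ### The singularity of `G` and the first order condition -/

section Divergence

variable {μ : Measure (EuclideanSpace ℝ (Fin n))} [IsFiniteMeasure μ]

/-- The singularity of `G` at `0` is not integrable, at any point of `closure P`. -/
def HasDivergence (P : Set (EuclideanSpace ℝ (Fin n))) (h : EuclideanSpace ℝ (Fin n) → ℝ)
    (G : ℝ → ℝ) : Prop :=
  ∀ y₀ ∈ closure P, ∀ K : ℝ, 0 < K →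
    ∫⁻ y, ENNReal.ofReal (-G (K * ‖y - y₀‖)) ∂weight P h = ⊤

/-- Fatou: if the integrals regularized by `ε` stayed above `B` as `ε → 0`, the singular integral
would be finite. The point `y₀`, where the pointwise limit is not available, has measure zero. -/
lemma exists_integral_G_lt (hPb : Bornology.IsBounded P) (hμ : ∀ᵐ y ∂μ, y ∈ P)
    (hp : GoodPair g F G) {y₀ : EuclideanSpace ℝ (Fin n)} (hy₀ : μ {y₀} = 0) {K : ℝ} (hK : 0 < K)
    (hdiv : ∫⁻ y, ENNReal.ofReal (-G (K * ‖y - y₀‖)) ∂μ = ⊤) (B : ℝ) :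
    ∃ ε, 0 < ε ∧ ∫ y, G (K * ‖y - y₀‖ + ε) ∂μ < B := by
  by_contra! hcon
  obtain ⟨ρ, hρ0, hρ⟩ : ∃ ρ > 0, ∀ y ∈ P, ‖y - y₀‖ ≤ ρ := by
    obtain ⟨ρ, hρ0, hρ⟩ := hPb.exists_pos_norm_le
    refine ⟨ρ + ‖y₀‖, by positivity, fun y hy => (norm_sub_le _ _).trans ?_⟩
    gcongr
    exact hρ y hy
  -- This constant dominates `G(K ‖y - y₀‖ + ε)` on `P` for all `ε ≤ 1`, so that `C - G` is
  -- nonnegative and Fatou applies.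
  set C := |G (K * ρ + 1)| with hC
  set ε : ℕ → ℝ := fun j => 1 / ((j : ℝ) + 1) with hε
  have hε0 : ∀ j, 0 < ε j := fun j => Nat.one_div_pos_of_nat
  have hε1 : ∀ j, ε j ≤ 1 := fun j => by
    simp only [hε]
    rw [div_le_one (by positivity)]
    linarith [Nat.cast_nonneg (α := ℝ) j]
  have hεlim : Tendsto ε atTop (𝓝 0) := tendsto_one_div_add_atTop_nhds_zero_nat
  have hcont : ∀ j, Continuous fun y => G (K * ‖y - y₀‖ + ε j) := fun j =>
    hp.G_cont.comp_continuous (by fun_prop) fun y =>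
      add_pos_of_nonneg_of_pos (by positivity) (hε0 j)
  have hint : ∀ j, Integrable (fun y => G (K * ‖y - y₀‖ + ε j)) μ := fun j =>
    integrable_of_continuousOn hPb hμ (hcont j).continuousOn
  have hbd : ∀ j, ∫⁻ y, ENNReal.ofReal (C - G (K * ‖y - y₀‖ + ε j)) ∂μ ≤
      ENNReal.ofReal (μ.real univ * C - B) := by
    intro j
    have hi : Integrable (fun y => C - G (K * ‖y - y₀‖ + ε j)) μ :=
      (integrable_const C).sub (hint j)
    rw [← ofReal_integral_eq_lintegral_ofReal hi]
    · refine ENNReal.ofReal_le_ofReal ?_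
      rw [integral_sub (integrable_const _) (hint j), integral_const, smul_eq_mul]
      linarith [hcon (ε j) (hε0 j)]
    · filter_upwards [hμ] with y hy
      have h1 : G (K * ‖y - y₀‖ + ε j) ≤ G (K * ρ + 1) := by
        refine hp.G_le (add_pos_of_nonneg_of_pos (by positivity) (hε0 j)) ?_
        gcongr
        · exact hρ y hy
        · exact hε1 j
      have := le_abs_self (G (K * ρ + 1))
      simp only [Pi.zero_apply]
      linarith
  have hfatou := lintegral_liminf_le (μ := μ) (u := atTop)
    (f := fun (j : ℕ) (y : EuclideanSpace ℝ (Fin n)) =>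
      ENNReal.ofReal (C - G (K * ‖y - y₀‖ + ε j)))
    fun j => (ENNReal.continuous_ofReal.comp (continuous_const.sub (hcont j))).measurable
  have hle : ∫⁻ y, ENNReal.ofReal (-G (K * ‖y - y₀‖)) ∂μ ≤
      ∫⁻ y, liminf (fun j => ENNReal.ofReal (C - G (K * ‖y - y₀‖ + ε j))) atTop ∂μ := by
    have hne : ∀ᵐ y ∂μ, y ≠ y₀ := by
      rw [ae_iff]
      simpa using hy₀
    refine lintegral_mono_ae ?_
    filter_upwards [hne] with y hy
    have hpos : 0 < K * ‖y - y₀‖ := mul_pos hK (norm_pos_iff.2 (sub_ne_zero.2 hy))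
    have h1 : Tendsto (fun j => K * ‖y - y₀‖ + ε j) atTop (𝓝 (K * ‖y - y₀‖)) := by
      simpa using hεlim.const_add (K * ‖y - y₀‖)
    have h2 := (ENNReal.continuous_ofReal.tendsto _).comp
      (((hp.G_deriv _ hpos).continuousAt.tendsto.comp h1).const_sub C)
    have h3 := h2.liminf_eq
    simp only [Function.comp_def] at h3
    rw [h3]
    refine ENNReal.ofReal_le_ofReal ?_
    have := abs_nonneg (G (K * ρ + 1))
    linarith
  have hlim : liminf (fun j => ∫⁻ y, ENNReal.ofReal (C - G (K * ‖y - y₀‖ + ε j)) ∂μ) atTop ≤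
      ENNReal.ofReal (μ.real univ * C - B) :=
    (liminf_le_liminf (Eventually.of_forall hbd)).trans (by simp)
  rw [hdiv] at hle
  exact absurd (hle.trans (hfatou.trans hlim)) (by simp)

/-- The first order condition at a maximum of `p ↦ ∫ G(V - ⟨p, y⟩)`. -/
lemma integral_g_smul_eq_zero (hPb : Bornology.IsBounded P) (hμ : ∀ᵐ y ∂μ, y ∈ P)
    (hp : GoodPair g F G) {V : EuclideanSpace ℝ (Fin n) → ℝ} (hV : ContinuousOn V (closure P))
    {c : ℝ} (hc : 0 < c) (hVc : ∀ y ∈ closure P, c ≤ V y)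
    (hmax : ∀ p, (∀ y ∈ closure P, 0 < V y - inner ℝ p y) →
      ∫ y, G (V y - inner ℝ p y) ∂μ ≤ ∫ y, G (V y) ∂μ) :
    Integrable (fun y => g (V y) • y) μ ∧ ∫ y, g (V y) • y ∂μ = 0 := by
  obtain ⟨ρ, hρ0, hρ⟩ : ∃ ρ > 0, ∀ y ∈ closure P, ‖y‖ ≤ ρ := hPb.closure.exists_pos_norm_le
  have hVae : AEMeasurable V μ :=
    (integrable_of_continuousOn hPb hμ hV).aestronglyMeasurable.aemeasurable
  -- No regularity of `g` is assumed; it is measurable along `V` because it agrees there with `deriv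
  -- G`.
  have hgm : AEStronglyMeasurable (fun y => g (V y)) μ := by
    have h1 : AEMeasurable (fun y => deriv G (V y)) μ :=
      (measurable_deriv G).comp_aemeasurable hVae
    refine (h1.congr ?_).aestronglyMeasurable
    filter_upwards [hμ] with y hy
    exact (hp.G_deriv _ (hc.trans_le (hVc y (subset_closure hy)))).deriv
  have hgi : Integrable (fun y => g (V y) • y) μ := by
    refine Integrable.of_bound (hgm.smul aestronglyMeasurable_id) (g c * ρ) ?_
    filter_upwards [hμ] with y hy
    have hy' := subset_closure hy
    have h1 := hp.g_le hc (hVc y hy')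
    have h2 := hp.g_pos (hc.trans_le (hVc y hy'))
    rw [norm_smul, Real.norm_of_nonneg h2.le]
    exact mul_le_mul h1 (hρ y hy') (norm_nonneg _) (hp.g_pos hc).le
  refine ⟨hgi, ?_⟩
  refine ext_inner_left ℝ fun q => ?_
  rw [inner_zero_right, ← integral_inner hgi]
  -- For `|t| < r` the tilt by `t • q` stays above `c / 2`, where `g` is bounded by `g (c / 2)`;
  -- this allows differentiation under the integral.
  set r := c / 2 / (‖q‖ * ρ + 1) with hr
  have hr0 : 0 < r := by positivity
  have hlow : ∀ t ∈ Metric.ball (0 : ℝ) r, ∀ y ∈ closure P, c / 2 ≤ V y - t * inner ℝ q y := by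
    intro t ht y hy
    rw [mem_ball_zero_iff, Real.norm_eq_abs] at ht
    have h1 := abs_real_inner_le_norm q y
    have h2 : |t * inner ℝ q y| ≤ r * (‖q‖ * ρ + 1) := by
      rw [abs_mul]
      refine mul_le_mul ht.le (h1.trans ?_) (abs_nonneg _) hr0.le
      have := mul_le_mul_of_nonneg_left (hρ y hy) (norm_nonneg q)
      linarith
    have h3 : r * (‖q‖ * ρ + 1) = c / 2 := div_mul_cancel₀ _ (by positivity)
    have h4 := le_abs_self (t * inner ℝ q y)
    linarith [hVc y hy]
  have hder := hasDerivAt_integral_of_dominated_loc_of_deriv_le (μ := μ) (𝕜 := ℝ) (x₀ := 0)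
    (s := Metric.ball (0 : ℝ) r) (F := fun t y => G (V y - t * inner ℝ q y))
    (F' := fun t y => g (V y - t * inner ℝ q y) * (-inner ℝ q y))
    (bound := fun _ => g (c / 2) * (‖q‖ * ρ)) (Metric.ball_mem_nhds _ hr0) ?_ ?_ ?_ ?_
    (integrable_const _) ?_
  · have hloc : IsLocalMax (fun t => ∫ y, G (V y - t * inner ℝ q y) ∂μ) 0 := by
      filter_upwards [Metric.ball_mem_nhds (0 : ℝ) hr0] with t ht
      have := hmax (t • q) fun y hy => by
        rw [real_inner_smul_left]
        exact (by linarith : (0 : ℝ) < c / 2).trans_le (hlow t ht y hy)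
      simpa [real_inner_smul_left] using this
    have h0 := hloc.hasDerivAt_eq_zero hder.2
    simp only [zero_mul, sub_zero, mul_neg, integral_neg, neg_eq_zero] at h0
    simpa only [real_inner_smul_right] using h0
  · filter_upwards [Metric.ball_mem_nhds (0 : ℝ) hr0] with t ht
    refine (integrable_of_continuousOn hPb hμ (hp.G_cont.comp
      (hV.sub (by fun_prop)) fun y hy => ?_)).aestronglyMeasurable
    exact (by linarith : (0 : ℝ) < c / 2).trans_le (hlow t ht y hy)
  · simp only [zero_mul, sub_zero]
    exact integrable_of_continuousOn hPb hμ (hp.G_cont.comp hV fun y hy => hc.trans_le (hVc y hy))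
  · simp only [zero_mul, sub_zero]
    refine hgm.mul ?_
    have : Continuous fun y : EuclideanSpace ℝ (Fin n) => -inner ℝ q y := by fun_prop
    exact this.aestronglyMeasurable
  · filter_upwards [hμ] with y hy t ht
    have hy' := subset_closure hy
    have h1 := hlow t ht y hy'
    have h2 := hp.g_le (by linarith) h1
    have h3 := hp.g_pos (lt_of_lt_of_le (by linarith) h1)
    rw [norm_mul, norm_neg, Real.norm_of_nonneg h3.le]
    refine mul_le_mul h2 ?_ (norm_nonneg _) (hp.g_pos (by linarith)).le
    exact (norm_inner_le_norm q y).trans (by gcongr; exact hρ y hy')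
  · filter_upwards [hμ] with y hy t ht
    have h1 := hlow t ht y (subset_closure hy)
    have h2 : HasDerivAt (fun t : ℝ => V y - t * inner ℝ q y) (-inner ℝ q y) t := by
      simpa using ((hasDerivAt_id t).mul_const (inner ℝ q y)).const_sub (V y)
    exact (hp.G_deriv _ (lt_of_lt_of_le (by linarith) h1)).comp t h2

end Divergence

end FreeBdyMA

/-! ### Normalization by maximizing over slopes -/

namespace FreeBdyMA

variable {n : ℕ} {P : Set (EuclideanSpace ℝ (Fin n))} {h : EuclideanSpace ℝ (Fin n) → ℝ}
  {g F G : ℝ → ℝ}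

lemma IsConvexDomain.weight_singleton (hD : IsConvexDomain P h) (y : EuclideanSpace ℝ (Fin n)) :
    weight P h {y} = 0 := by
  have hne : NeZero n := ⟨by have := hD.one_le; omega⟩
  obtain ⟨C, -, hC⟩ := exists_weight_le hD.condA1 hD.isOpen
  refine le_antisymm ((hC {y}).trans ?_) bot_le
  rw [Measure.smul_apply, smul_eq_mul, measure_singleton y, mul_zero]

/-- If `G` has a nonintegrable singularity, every Lipschitz convex function can be normalized. -/
lemma hasNormalization_of_divergence (hD : IsConvexDomain P h) (hp : GoodPair g F G)
    (hdiv : HasDivergence P h G) : HasNormalization P h g := by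
  intro w K hw hlip ⟨p₁, c₁, hc₁, hwc₁⟩
  have := hD.isFiniteMeasure
  have hwcont : ContinuousOn w (closure P) := hlip.continuousOn
  obtain ⟨ρ, hρ0, hρ⟩ : ∃ ρ > 0, ∀ y ∈ closure P, ‖y‖ ≤ ρ :=
    hD.bounded.closure.exists_pos_norm_le
  obtain ⟨B, hB⟩ := hD.bounded.isCompact_closure.exists_bound_of_continuousOn hwcont
  set A : Set (EuclideanSpace ℝ (Fin n)) := {p | ∀ y ∈ closure P, 0 < w y - inner ℝ p y} with hA
  set Φ : EuclideanSpace ℝ (Fin n) → ℝ := fun p => ∫ y, G (w y - inner ℝ p y) ∂weight P h with hΦ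
  have hp₁ : p₁ ∈ A := fun y hy => hc₁.trans_le (hwc₁ y hy)
  obtain ⟨R, hR⟩ := exists_ball_legendre_le hD.isOpen hD.bounded hD.zero_mem
    (hwcont.mono subset_closure) (c := -B)
    fun y hy => (abs_le.1 (hB y (subset_closure hy))).1
  -- An admissible slope satisfies `legendre P w p ≤ 0`, so the admissible slopes form a bounded set
  -- and a maximizing sequence has a limit point.
  have hAR : ∀ p ∈ A, ‖p‖ ≤ R := fun p hp => hR p (legendre_le hD.nonempty fun y hy => by
    linarith [hp y (subset_closure hy)])
  have hint : ∀ p ∈ A, Integrable (fun y => G (w y - inner ℝ p y)) (weight P h) := fun p hpA =>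
    integrable_of_continuousOn hD.bounded hD.ae_mem
      (hp.G_cont.comp (hwcont.sub (by fun_prop)) hpA)
  have hbdd : BddAbove (Φ '' A) := by
    refine ⟨(weight P h).real univ * G (B + R * ρ), ?_⟩
    rintro _ ⟨p, hpA, rfl⟩
    rw [← smul_eq_mul, ← integral_const]
    refine integral_mono_ae (hint p hpA) (integrable_const _) ?_
    filter_upwards [hD.ae_mem] with y hy
    have hy' := subset_closure hy
    refine hp.G_le (hpA y hy') ?_
    have h1 := (abs_le.1 (hB y hy')).2
    have h2 := neg_abs_le (inner ℝ p y)
    have h3 := abs_real_inner_le_norm p y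
    have h4 : ‖p‖ * ‖y‖ ≤ R * ρ := mul_le_mul (hAR p hpA) (hρ y hy') (norm_nonneg _)
      ((norm_nonneg p).trans (hAR p hpA))
    linarith
  obtain ⟨a, -, halim, haA⟩ := exists_seq_tendsto_sSup (S := Φ '' A) ⟨_, mem_image_of_mem _ hp₁⟩
    hbdd
  choose p hpA hpa using haA
  obtain ⟨q, hq, φ, hφ, hlim⟩ :=
    (isCompact_closedBall (0 : EuclideanSpace ℝ (Fin n)) R).tendsto_subseq
    (x := p) fun k => mem_closedBall_zero_iff.2 (hAR _ (hpA k))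
  have hΦlim : Tendsto (fun k => Φ (p (φ k))) atTop (𝓝 (sSup (Φ '' A))) := by
    simp_rw [hpa]
    exact halim.comp hφ.tendsto_atTop
  have hdist : ∀ ε > 0, ∀ᶠ k in atTop, ∀ y ∈ closure P,
      |inner ℝ (p (φ k)) y - inner ℝ q y| < ε := by
    intro ε hε
    filter_upwards [(Metric.tendsto_nhds.1 hlim) (ε / ρ) (by positivity)] with k hk y hy
    rw [← inner_sub_left]
    rw [dist_eq_norm] at hk
    calc |inner ℝ (p (φ k) - q) y| ≤ ‖p (φ k) - q‖ * ‖y‖ := abs_real_inner_le_norm _ _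
      _ ≤ ‖p (φ k) - q‖ * ρ := by gcongr; exact hρ y hy
      _ < ε / ρ * ρ := by gcongr; exact hk
      _ = ε := div_mul_cancel₀ _ hρ0.ne'
  have hqA : q ∈ A := by
    intro y₀ hy₀
    by_contra hneg
    -- If the limiting tilt were nonpositive at `y₀`, the Lipschitz bound would place the tilts of
    -- the sequence below `K' ‖y - y₀‖ + ε`, and divergence at `y₀` would push their integrals below
    -- the supremum minus `1`.
    set K' : ℝ := K + ‖q‖ + 1 with hK'
    have hK'0 : 0 < K' := by positivity
    obtain ⟨ε, hε, hlt⟩ := exists_integral_G_lt hD.bounded hD.ae_mem hp (hD.weight_singleton y₀)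
      hK'0 (hdiv y₀ hy₀ K' hK'0) (sSup (Φ '' A) - 1)
    obtain ⟨k, hk1, hk2⟩ := ((hdist ε hε).and
      (hΦlim.eventually (lt_mem_nhds (show sSup (Φ '' A) - 1 < sSup (Φ '' A) by linarith)))).exists
    have hle : Φ (p (φ k)) ≤ ∫ y, G (K' * ‖y - y₀‖ + ε) ∂weight P h := by
      have hci : Continuous fun y => G (K' * ‖y - y₀‖ + ε) :=
        hp.G_cont.comp_continuous (by fun_prop) fun y => by
          have := mul_nonneg hK'0.le (norm_nonneg (y - y₀))
          simp only [mem_Ioi]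
          linarith
      refine integral_mono_ae (hint _ (hpA _))
        (integrable_of_continuousOn hD.bounded hD.ae_mem hci.continuousOn) ?_
      filter_upwards [hD.ae_mem] with y hy
      have hy' := subset_closure hy
      refine hp.G_le (hpA _ y hy') ?_
      have h1 := (abs_lt.1 (hk1 y hy')).1
      have h2 := hlip.dist_le_mul y hy' y₀ hy₀
      rw [Real.dist_eq, dist_eq_norm] at h2
      have h3 := le_abs_self (w y - w y₀)
      have h4 := abs_real_inner_le_norm q (y - y₀)
      have h5 := neg_abs_le (inner ℝ q (y - y₀))
      rw [inner_sub_right] at h4 h5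
      rw [hK', add_mul, add_mul, one_mul]
      linarith [norm_nonneg (y - y₀)]
    linarith
  set V : EuclideanSpace ℝ (Fin n) → ℝ := fun y => w y - inner ℝ q y with hV
  have hVc : ContinuousOn V (closure P) := hwcont.sub (by fun_prop)
  obtain ⟨y₀, hy₀, hVmin⟩ := hD.bounded.isCompact_closure.exists_isMinOn
    ⟨0, subset_closure hD.zero_mem⟩ hVc
  have hc0 : 0 < V y₀ := hqA y₀ hy₀
  have hVge : ∀ y ∈ closure P, V y₀ ≤ V y := fun y hy => hVmin hy
  obtain ⟨k₁, hk₁⟩ := eventually_atTop.1 (hdist (V y₀ / 2) (by linarith))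
  have hΦq : Φ q = sSup (Φ '' A) := by
    refine tendsto_nhds_unique ?_ (hΦlim.comp (tendsto_add_atTop_nat k₁))
    refine tendsto_integral_G (c := V y₀ / 2) hD.bounded hD.ae_mem hp
      (w := fun k y => w y - inner ℝ (p (φ (k + k₁))) y)
      (fun k => hwcont.sub (by fun_prop)) hVc (by linarith)
      (fun k y hy => ?_) (fun y hy => by linarith [hVge y hy]) ?_
    · have h1 := (abs_lt.1 (hk₁ (k + k₁) (Nat.le_add_left _ _) y hy)).2
      have h2 := hVge y hy
      simp only [hV] at h1 h2 ⊢
      linarith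
    · rw [Metric.tendstoUniformlyOn_iff]
      intro ε hε
      filter_upwards [(tendsto_add_atTop_nat k₁).eventually (hdist ε hε)] with k hk y hy
      have := hk y hy
      rw [Real.dist_eq]
      convert this using 1
      ring_nf
  refine ⟨q, (mem_classCP_iff hD.condA1 hD.isOpen).2 ⟨mem_classCplus_sub_inner hw hqA, ?_⟩⟩
  refine integral_g_smul_eq_zero hD.bounded hD.ae_mem hp hVc hc0 hVge fun r hr => ?_
  have hqr : q + r ∈ A := fun y hy => by
    have : 0 < w y - inner ℝ q y - inner ℝ r y := hr y hy
    rw [inner_add_left]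
    linarith
  have h1 : Φ (q + r) ≤ Φ q := by
    rw [hΦq]
    exact le_csSup hbdd (mem_image_of_mem _ hqr)
  simp only [hΦ, inner_add_left] at h1
  simpa only [hV, sub_sub] using h1

end FreeBdyMA

namespace FreeBdyMA

variable {n : ℕ} {P : Set (EuclideanSpace ℝ (Fin n))} {h : EuclideanSpace ℝ (Fin n) → ℝ}
  {g F G : ℝ → ℝ}

/-! ### Nonintegrability of `G` at the points of `closure P` -/

/-- Integration of radial functions over cones. -/
lemma setLIntegral_cone (hn : 1 ≤ n) {U : Set (EuclideanSpace ℝ (Fin n))} (hU : IsOpen U)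
    (hcone : ∀ z ∈ U, ∀ t : ℝ, 0 < t → t • z ∈ U) {ψ : ℝ → ℝ≥0∞}
    (hψ : Measurable fun r : Ioi (0 : ℝ) => ψ r) :
    ∫⁻ z in U, ψ ‖z‖ = (volume : Measure (EuclideanSpace ℝ (Fin n))).toSphere
      {σ | (σ : EuclideanSpace ℝ (Fin n)) ∈ U} *
      ∫⁻ r in Ioi (0 : ℝ), ENNReal.ofReal (r ^ (n - 1)) * ψ r := by
  have hne : NeZero n := ⟨by omega⟩
  set vol : Measure (EuclideanSpace ℝ (Fin n)) := volume with hvol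
  set S : Set (Metric.sphere (0 : EuclideanSpace ℝ (Fin n)) 1) :=
    {σ | (σ : EuclideanSpace ℝ (Fin n)) ∈ U} with hS
  have hSm : MeasurableSet S := (hU.preimage continuous_subtype_val).measurableSet
  have hfr : Module.finrank ℝ (EuclideanSpace ℝ (Fin n)) = n := by simp
  have hmp := vol.measurePreserving_homeomorphUnitSphereProd
  have hUc : ∀ x : ({0}ᶜ : Set (EuclideanSpace ℝ (Fin n))),
      (homeomorphUnitSphereProd _ x).1 ∈ S ↔ (x : EuclideanSpace ℝ (Fin n)) ∈ U := by
    intro x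
    have hx : 0 < ‖(x : EuclideanSpace ℝ (Fin n))‖ := norm_pos_iff.2 x.2
    have h1 : ((homeomorphUnitSphereProd _ x).1 : EuclideanSpace ℝ (Fin n)) =
        ‖(x : EuclideanSpace ℝ (Fin n))‖⁻¹ • (x : EuclideanSpace ℝ (Fin n)) := by simp
    simp only [hS, mem_ofPred_eq, h1]
    refine ⟨fun hm => ?_, fun hm => hcone _ hm _ (inv_pos.2 hx)⟩
    have := hcone _ hm _ hx
    rwa [smul_smul, mul_inv_cancel₀ hx.ne', one_smul] at this
  set f : Metric.sphere (0 : EuclideanSpace ℝ (Fin n)) 1 × Ioi (0 : ℝ) → ℝ≥0∞ :=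
    fun q => S.indicator (fun _ => 1) q.1 * ψ q.2 with hf
  calc ∫⁻ z in U, ψ ‖z‖ = ∫⁻ z, U.indicator (fun z => ψ ‖z‖) z ∂vol :=
        (lintegral_indicator hU.measurableSet _).symm
    _ = ∫⁻ z in ({0}ᶜ : Set (EuclideanSpace ℝ (Fin n))), U.indicator (fun z => ψ ‖z‖) z ∂vol := by
        rw [restrict_compl_singleton]
    _ = ∫⁻ z : ({0}ᶜ : Set (EuclideanSpace ℝ (Fin n))), U.indicator (fun z => ψ ‖z‖) z
          ∂(vol.comap (↑)) :=
        (lintegral_subtype_comap (measurableSet_singleton _).compl _).symm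
    _ = ∫⁻ z : ({0}ᶜ : Set (EuclideanSpace ℝ (Fin n))),
          f (homeomorphUnitSphereProd _ z) ∂(vol.comap (↑)) := by
        refine lintegral_congr fun z => ?_
        rw [hf]
        by_cases hz : (z : EuclideanSpace ℝ (Fin n)) ∈ U
        · simp only [indicator_of_mem hz, indicator_of_mem ((hUc z).2 hz), one_mul,
            homeomorphUnitSphereProd_apply_snd_coe]
        · simp only [indicator_of_notMem hz, indicator_of_notMem (mt (hUc z).1 hz), zero_mul]
    _ = ∫⁻ q, f q ∂(vol.toSphere.prod (Measure.volumeIoiPow (Module.finrank ℝ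
            (EuclideanSpace ℝ (Fin n)) - 1))) :=
        hmp.lintegral_comp_emb (Homeomorph.measurableEmbedding _) f
    _ = (∫⁻ σ, S.indicator (fun _ => 1) σ ∂vol.toSphere) *
          ∫⁻ r : Ioi (0 : ℝ), ψ r ∂(Measure.volumeIoiPow (Module.finrank ℝ
            (EuclideanSpace ℝ (Fin n)) - 1)) :=
        lintegral_prod_mul (measurable_const.indicator hSm).aemeasurable hψ.aemeasurable
    _ = _ := by
        rw [lintegral_indicator_const hSm, one_mul, hfr, Measure.volumeIoiPow,
          lintegral_withDensity_eq_lintegral_mul _ (by fun_prop) hψ]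
        congr 1
        exact lintegral_subtype_comap measurableSet_Ioi
          (fun r : ℝ => ENNReal.ofReal (r ^ (n - 1)) * ψ r)

/-- The divergence of `∫ G(s) s^a ds` at `0` localizes and is invariant under scaling. -/
lemma setLIntegral_Ioo_eq_top (hp : GoodPair g F G) {a : ℝ} (ha : 0 ≤ a)
    (hdiv : ∫⁻ s in Ioc (0 : ℝ) 1, ENNReal.ofReal (-(G s * s ^ a)) = ⊤) {K r : ℝ} (hK : 0 < K)
    (hr : 0 < r) : ∫⁻ s in Ioo 0 r, ENNReal.ofReal (s ^ a * -G (K * s)) = ⊤ := by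
  -- `G` is bounded on `[ρ, 1]`, so the divergence is already present on `(0, ρ)`; the substitution
  -- `s ↦ K s` then costs only constant factors.
  set ρ := min (K * r) 1 with hρ
  have hρ0 : 0 < ρ := lt_min (by positivity) one_pos
  have hfin : ∫⁻ s in Icc ρ 1, ENNReal.ofReal (-(G s * s ^ a)) ≠ ⊤ := by
    have hc : ContinuousOn (fun s => -(G s * s ^ a)) (Icc ρ 1) := by
      refine ((hp.G_cont.mono fun s hs => hρ0.trans_le hs.1).mul ?_).neg
      exact (Real.continuous_rpow_const ha).continuousOn
    exact (hc.integrableOn_Icc).lintegral_lt_top.ne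
  have h1 : ∫⁻ s in Ioo 0 ρ, ENNReal.ofReal (-(G s * s ^ a)) = ⊤ := by
    by_contra hne
    have hsub : Ioc (0 : ℝ) 1 ⊆ Ioo 0 ρ ∪ Icc ρ 1 := fun s hs => by
      rcases lt_or_ge s ρ with h | h
      · exact Or.inl ⟨hs.1, h⟩
      · exact Or.inr ⟨h, hs.2⟩
    have h2 := (lintegral_mono_set (μ := volume)
      (f := fun s => ENNReal.ofReal (-(G s * s ^ a))) hsub).trans (lintegral_union_le _ _ _)
    rw [hdiv, top_le_iff, ENNReal.add_eq_top] at h2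
    exact h2.elim hne hfin
  have h3 : ∫⁻ s in Ioo 0 (K * r), ENNReal.ofReal (-(G s * s ^ a)) = ⊤ := by
    rw [← top_le_iff, ← h1]
    exact lintegral_mono_set (Ioo_subset_Ioo_right (min_le_left _ _))
  set f : ℝ → ℝ≥0∞ := (Ioo 0 (K * r)).indicator fun s => ENNReal.ofReal (-(G s * s ^ a)) with hf
  have hemb : MeasurableEmbedding fun s : ℝ => K * s :=
    (Homeomorph.mulLeft₀ K hK.ne').measurableEmbedding
  have h4 : ∫⁻ s, f (K * s) = ⊤ := by
    have := hemb.lintegral_map (μ := volume) f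
    rw [← this, Real.map_volume_mul_left hK.ne', lintegral_smul_measure, hf,
      lintegral_indicator measurableSet_Ioo, h3, smul_eq_mul, ENNReal.mul_top]
    simpa using hK.ne'
  have h5 : ∀ s, f (K * s) = ENNReal.ofReal (K ^ a) *
      (Ioo 0 r).indicator (fun s => ENNReal.ofReal (s ^ a * -G (K * s))) s := by
    intro s
    by_cases hs : s ∈ Ioo 0 r
    · have hs' : K * s ∈ Ioo 0 (K * r) := ⟨mul_pos hK hs.1, mul_lt_mul_of_pos_left hs.2 hK⟩
      rw [hf, indicator_of_mem hs', indicator_of_mem hs, ← ENNReal.ofReal_mul (by positivity),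
        Real.mul_rpow hK.le hs.1.le]
      congr 1
      ring
    · have hs' : K * s ∉ Ioo 0 (K * r) := fun h' => hs
        ⟨pos_of_mul_pos_right h'.1 hK.le, lt_of_mul_lt_mul_left h'.2 hK.le⟩
      rw [hf, indicator_of_notMem hs', indicator_of_notMem hs, mul_zero]
  simp_rw [h5] at h4
  rw [lintegral_const_mul' _ _ ENNReal.ofReal_ne_top, lintegral_indicator measurableSet_Ioo] at h4
  by_contra hne
  exact ENNReal.mul_ne_top ENNReal.ofReal_ne_top hne h4

/-- At an interior point `h` is bounded below nearby and the cone is the whole space; at a frontier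
point it is the rotated cone of the vanishing order. Radii below `1` allow the exponent to be raised
to `ν`. -/
lemma exists_cone (hD : IsConvexDomain P h) {ν vo : ℝ} (hvo : IsVanishingOrder P h vo)
    (hν : vo ≤ ν) {y₀ : EuclideanSpace ℝ (Fin n)} (hy₀ : y₀ ∈ closure P) :
    ∃ (U : Set (EuclideanSpace ℝ (Fin n))) (c δ : ℝ), IsOpen U ∧ U.Nonempty ∧
      (∀ z ∈ U, ∀ t : ℝ, 0 < t → t • z ∈ U) ∧ 0 < c ∧ 0 < δ ∧
      ∀ z ∈ U, ‖z‖ < δ → y₀ + z ∈ P ∧ c * ‖z‖ ^ ν ≤ h (y₀ + z) := by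
  obtain ⟨hvo0, K, C, δ, hKo, hKne, hKcone, hC, hδ, hK⟩ := hvo
  have hν0 : 0 ≤ ν := hvo0.trans hν
  by_cases hyP : y₀ ∈ P
  · obtain ⟨r, hr, hrP⟩ := Metric.isOpen_iff.1 hD.isOpen y₀ hyP
    obtain ⟨c, hc, hch⟩ := hD.condA1.pos (Metric.closedBall y₀ (r / 2))
      ((Metric.closedBall_subset_ball (by linarith)).trans hrP) (isCompact_closedBall _ _)
    refine ⟨univ, c, min (r / 2) 1, isOpen_univ, univ_nonempty, fun _ _ _ _ => mem_univ _, hc,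
      lt_min (by linarith) one_pos, fun z _ hz => ?_⟩
    have hz1 : ‖z‖ < r / 2 := hz.trans_le (min_le_left _ _)
    have hz2 : ‖z‖ < 1 := hz.trans_le (min_le_right _ _)
    have hmem : y₀ + z ∈ Metric.closedBall y₀ (r / 2) := by
      rw [mem_closedBall_iff_norm, add_sub_cancel_left]
      exact hz1.le
    refine ⟨hrP (Metric.closedBall_subset_ball (by linarith) hmem), le_trans ?_ (hch _ hmem)⟩
    have := Real.rpow_le_one (norm_nonneg z) hz2.le hν0
    exact mul_le_of_le_one_right hc.le this
  · have hyf : y₀ ∈ frontier P := by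
      rw [hD.isOpen.frontier_eq]
      exact ⟨hy₀, hyP⟩
    obtain ⟨T, hT⟩ := hK y₀ hyf
    refine ⟨T '' K, C⁻¹, min δ 1, ?_, hKne.image _, ?_, inv_pos.2 hC, lt_min hδ one_pos, ?_⟩
    · exact T.toHomeomorph.isOpenMap _ hKo
    · rintro _ ⟨z, hz, rfl⟩ t ht
      exact ⟨t • z, hKcone z hz t ht, by simp⟩
    · rintro _ ⟨z, hz, rfl⟩ hzn
      have h1 : ‖T z‖ < δ := hzn.trans_le (min_le_left _ _)
      have h2 : ‖T z‖ < 1 := hzn.trans_le (min_le_right _ _)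
      obtain ⟨h3, h4⟩ := hT (y₀ + T z) ⟨⟨z, hz, rfl⟩, by
        rwa [mem_ball_iff_norm, add_sub_cancel_left]⟩
      refine ⟨h3, le_trans ?_ h4⟩
      rw [dist_eq_norm, add_sub_cancel_left]
      refine mul_le_mul_of_nonneg_left ?_ (inv_pos.2 hC).le
      -- The apex may belong to the open cone. There the comparison of powers is checked by hand,
      -- because `0 ^ 0 = 1` singles out `vo = 0`.
      rcases (norm_nonneg (T z)).eq_or_lt with h0 | h0
      · by_cases hvo1 : vo = 0
        · rw [hvo1, Real.rpow_zero]
          exact Real.rpow_le_one (norm_nonneg _) h2.le hν0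
        · rw [← h0, Real.zero_rpow hvo1, Real.zero_rpow]
          have : 0 < vo := lt_of_le_of_ne hvo0 (Ne.symm hvo1)
          linarith
      · exact Real.rpow_le_rpow_of_exponent_ge h0 h2.le hν

/-- On the cone at `y₀`, polar coordinates and `h ≥ c r^ν` reduce the integral to `∫ -G(K r)
r^(n+ν-1) dr` near `0`, times the spherical measure of the cone, which is positive as the cone is
open and nonempty. -/
lemma hasDivergence (hD : IsConvexDomain P h) (hp : GoodPair g F G) {ν vo : ℝ}
    (hvo : IsVanishingOrder P h vo) (hν : vo ≤ ν)
    (hdiv : ∫⁻ s in Ioc (0 : ℝ) 1, ENNReal.ofReal (-(G s * s ^ ((n : ℝ) + ν - 1))) = ⊤) :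
    HasDivergence P h G := by
  intro y₀ hy₀ K hK
  have hne : NeZero n := ⟨by have := hD.one_le; omega⟩
  have hν0 : 0 ≤ ν := hvo.1.trans hν
  have hn1 : (1 : ℝ) ≤ n := by exact_mod_cast hD.one_le
  obtain ⟨U, c, δ, hUo, ⟨z₀, hz₀⟩, hUcone, hc, hδ, hU⟩ := exists_cone hD hvo hν hy₀
  set ψ : ℝ → ℝ≥0∞ := (Iio δ).indicator
    fun r => ENNReal.ofReal (c * r ^ ν) * ENNReal.ofReal (-G (K * r)) with hψ
  have hψm : Measurable fun r : Ioi (0 : ℝ) => ψ r := by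
    have h1 : (fun r : Ioi (0 : ℝ) => ψ r) = (Subtype.val ⁻¹' Iio δ).indicator
        fun r : Ioi (0 : ℝ) => ENNReal.ofReal (c * (r : ℝ) ^ ν) *
          ENNReal.ofReal (-G (K * r)) := rfl
    rw [h1]
    refine Measurable.indicator ?_ (measurableSet_Iio.preimage measurable_subtype_coe)
    have hGc : Continuous fun r : Ioi (0 : ℝ) => G (K * r) :=
      hp.G_cont.comp_continuous (by fun_prop) fun r => mul_pos hK r.2
    have hrc : Continuous fun r : Ioi (0 : ℝ) => c * (r : ℝ) ^ ν :=
      continuous_const.mul ((Real.continuous_rpow_const hν0).comp continuous_subtype_val)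
    exact (ENNReal.continuous_ofReal.comp hrc).measurable.mul
      (ENNReal.continuous_ofReal.comp hGc.neg).measurable
  have htop : ∫⁻ z in U, ψ ‖z‖ = ⊤ := by
    rw [setLIntegral_cone hD.one_le hUo hUcone hψm]
    refine ENNReal.mul_eq_top.2 (Or.inl ⟨?_, ?_⟩)
    · have hopen : IsOpen {σ : Metric.sphere (0 : EuclideanSpace ℝ (Fin n)) 1 |
          (σ : EuclideanSpace ℝ (Fin n)) ∈ U} := hUo.preimage continuous_subtype_val
      obtain ⟨z₁, hz₁, hz₁0⟩ : ∃ z ∈ U, z ≠ 0 := by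
        by_cases h0 : z₀ = 0
        · subst h0
          have h1 : ∀ᶠ x in 𝓝[≠] (0 : EuclideanSpace ℝ (Fin n)), x ∈ U ∧ x ≠ 0 :=
            ((hUo.mem_nhds hz₀ : U ∈ 𝓝 0) |> mem_nhdsWithin_of_mem_nhds |> fun hm =>
              (show ∀ᶠ x in 𝓝[≠] (0 : EuclideanSpace ℝ (Fin n)), x ∈ U from hm).and
                self_mem_nhdsWithin)
          exact h1.exists
        · exact ⟨z₀, hz₀, h0⟩
      have hn0 := norm_pos_iff.2 hz₁0
      refine (hopen.measure_pos _ ⟨⟨‖z₁‖⁻¹ • z₁, ?_⟩, ?_⟩).ne'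
      · rw [mem_sphere_zero_iff_norm, norm_smul, norm_inv, norm_norm, inv_mul_cancel₀ hn0.ne']
      · exact hUcone _ hz₁ _ (inv_pos.2 hn0)
    · have h1 := setLIntegral_Ioo_eq_top hp (a := (n : ℝ) + ν - 1) (by linarith) hdiv hK hδ
      rw [← top_le_iff]
      calc (⊤ : ℝ≥0∞) = ENNReal.ofReal c *
            ∫⁻ s in Ioo 0 δ, ENNReal.ofReal (s ^ ((n : ℝ) + ν - 1) * -G (K * s)) := by
            rw [h1, ENNReal.mul_top]
            simpa using hc
        _ = ∫⁻ s in Ioo 0 δ, ENNReal.ofReal (s ^ (n - 1)) * ψ s := by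
            rw [← lintegral_const_mul' _ _ ENNReal.ofReal_ne_top]
            refine setLIntegral_congr_fun measurableSet_Ioo fun s hs => ?_
            have hs0 : 0 < s := hs.1
            simp only [hψ]
            rw [indicator_of_mem (by exact hs.2), ← ENNReal.ofReal_mul hc.le,
              ← ENNReal.ofReal_mul (by positivity), ← ENNReal.ofReal_mul (by positivity)]
            congr 1
            have : s ^ ((n : ℝ) + ν - 1) = s ^ (n - 1) * s ^ ν := by
              rw [← Real.rpow_natCast, ← Real.rpow_add hs0, Nat.cast_sub hD.one_le]
              congr 1
              push_cast
              ring
            rw [this]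
            ring
        _ ≤ _ := lintegral_mono_set fun s hs => hs.1
  rw [lintegral_weight hD.condA1, ← top_le_iff, ← htop]
  have hUm := hUo.measurableSet
  rw [← lintegral_indicator hUm, ← lintegral_indicator hD.isOpen.measurableSet,
    ← lintegral_add_left_eq_self (μ := (volume : Measure (EuclideanSpace ℝ (Fin n))))
      (P.indicator _) y₀]
  refine lintegral_mono fun z => ?_
  by_cases hz : z ∈ U
  · by_cases hzδ : ‖z‖ < δ
    · obtain ⟨h1, h2⟩ := hU z hz hzδ
      rw [indicator_of_mem hz, indicator_of_mem h1, hψ, indicator_of_mem (by exact hzδ),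
        add_sub_cancel_left]
      gcongr
    · rw [indicator_of_mem hz, hψ, indicator_of_notMem (by exact hzδ)]
      exact bot_le
  · rw [indicator_of_notMem hz]
    exact bot_le

end FreeBdyMA

namespace FreeBdyMA

variable {n : ℕ} {P : Set (EuclideanSpace ℝ (Fin n))} {h : EuclideanSpace ℝ (Fin n) → ℝ}
  {v : EuclideanSpace ℝ (Fin n) → ℝ} {g F G : ℝ → ℝ} {s m : ℝ} {p₀ : EuclideanSpace ℝ (Fin n)}
  {e : Fin n → EuclideanSpace ℝ (Fin n)}
  {T : EuclideanSpace ℝ (Fin n) →ₗ[ℝ] EuclideanSpace ℝ (Fin n)}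

/-! ### Coercivity -/

/-- A normalized function `v` with finite energy, the value `s = J(v)`, and a frame. -/
structure IsAdmissible (P : Set (EuclideanSpace ℝ (Fin n))) (h : EuclideanSpace ℝ (Fin n) → ℝ)
    (g G : ℝ → ℝ) (v : EuclideanSpace ℝ (Fin n) → ℝ) (s m : ℝ) (p₀ : EuclideanSpace ℝ (Fin n))
    (e : Fin n → EuclideanSpace ℝ (Fin n))
    (T : EuclideanSpace ℝ (Fin n) →ₗ[ℝ] EuclideanSpace ℝ (Fin n)) : Prop where
  mem : v ∈ classCP P h g
  integrable : Integrable (fun y => G (v y)) (weight P h)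
  s_pos : 0 < s
  G_eq : G s = ⨍ y, G (v y) ∂weight P h
  frame : IsFrame P v m p₀ e T

/-- The ratio between `v` and the norm of a frame. -/
noncomputable def frameRatio (n : ℕ) : ℝ := 1 / ((n : ℝ) + 1) ^ 2

/-- The volume constant in the estimates of `I`. -/
noncomputable def frameVolume (n : ℕ) : ℝ :=
  (volume (Metric.closedBall (0 : EuclideanSpace ℝ (Fin n)) n)).toReal

lemma frameRatio_pos (n : ℕ) : 0 < frameRatio n := by
  unfold frameRatio
  positivity

lemma frameVolume_pos (hn : 1 ≤ n) : 0 < frameVolume n := by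
  have : (0 : ℝ) < n := by exact_mod_cast hn
  exact ENNReal.toReal_pos (Metric.measure_closedBall_pos volume _ this).ne'
    measure_closedBall_lt_top.ne

lemma IsAdmissible.funI_pos (ha : IsAdmissible P h g G v s m p₀ e T) (hD : IsConvexDomain P h)
    (hp : GoodPair g F G) : 0 < (funI P F v).toReal :=
  ha.frame.funI_toReal_pos hp (hD.continuous_legendre ha.mem.1)

lemma IsAdmissible.funI_le_det (ha : IsAdmissible P h g G v s m p₀ e T) (hD : IsConvexDomain P h)
    (hp : GoodPair g F G) :
    (funI P F v).toReal ≤ F m * (|LinearMap.det T| * frameVolume n) :=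
  ENNReal.toReal_le_of_le_ofReal (mul_nonneg (hp.F_nonneg ha.frame.pos.le)
    (mul_nonneg (abs_nonneg _) (frameVolume_pos hD.one_le).le))
    (ha.frame.funI_le_det hp (hD.continuous_legendre ha.mem.1))

lemma IsAdmissible.funI_le_pow (ha : IsAdmissible P h g G v s m p₀ e T) (hD : IsConvexDomain P h)
    (hp : GoodPair g F G) {l : ℝ} (hl0 : 0 ≤ l) (hl : ∀ i, ‖e i‖ ≤ l) :
    (funI P F v).toReal ≤ F m * (l ^ n * frameVolume n) :=
  ENNReal.toReal_le_of_le_ofReal (mul_nonneg (hp.F_nonneg ha.frame.pos.le)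
    (mul_nonneg (by positivity) (frameVolume_pos hD.one_le).le))
    (ha.frame.funI_le_pow hp (hD.continuous_legendre ha.mem.1) hl0 hl)

lemma IsAdmissible.m_le (ha : IsAdmissible P h g G v s m p₀ e T) (hD : IsConvexDomain P h)
    (hp : GoodPair g F G) : m ≤ s :=
  ha.frame.le_average hD hp ha.mem ha.integrable ha.s_pos ha.G_eq

lemma IsAdmissible.integral_le (ha : IsAdmissible P h g G v s m p₀ e T) (hD : IsConvexDomain P h)
    (hp : GoodPair g F G) :
    ∫ y, G (frameRatio n * max m ‖T y‖) ∂weight P h ≤ (weight P h).real univ * G s :=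
  ha.frame.integral_le hD hp ha.mem ha.integrable ha.G_eq

/-- A slab width for which slabs carry at most the fraction `θ` of the mass. -/
def IsSlabWidth (P : Set (EuclideanSpace ℝ (Fin n))) (h : EuclideanSpace ℝ (Fin n) → ℝ)
    (θ δ : ℝ) : Prop :=
  0 < δ ∧ ∀ e : EuclideanSpace ℝ (Fin n), weight P h {y | |inner ℝ e y| < δ * ‖e‖} ≤
    ENNReal.ofReal (θ * (weight P h).real univ)

lemma exists_isSlabWidth (hD : IsConvexDomain P h) {θ : ℝ} (hθ : 0 < θ) :
    ∃ δ, IsSlabWidth P h θ δ := by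
  obtain ⟨C, hC0, hC⟩ := exists_weight_le hD.condA1 hD.isOpen
  exact exists_slab_le hD.one_le hD.bounded hD.ae_mem hC0 hC (mul_pos hθ hD.weight_pos)

/-- The slab estimate along the longest edge, combined with the upper bound by `J`: this turns
control of `s` into control of all edges. -/
lemma IsAdmissible.exists_index (ha : IsAdmissible P h g G v s m p₀ e T)
    (hD : IsConvexDomain P h) (hp : GoodPair g F G) {θ δ : ℝ} (hθ : 0 ≤ θ)
    (hδ : IsSlabWidth P h θ δ) :
    ∃ i, (∀ j, ‖e j‖ ≤ ‖e i‖) ∧ G (frameRatio n * max m (δ * ‖e i‖)) -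
      θ * (G (frameRatio n * max m (δ * ‖e i‖)) - G (frameRatio n * m)) ≤ G s := by
  have := hD.isFiniteMeasure
  have hne : Nonempty (Fin n) := ⟨⟨0, hD.one_le⟩⟩
  obtain ⟨i, hi⟩ := Finite.exists_max fun j => ‖e j‖
  refine ⟨i, hi, ?_⟩
  have h1 := (ha.frame.integral_ge hD.bounded hD.ae_mem hp (frameRatio_pos n) (hδ.2 (e i))
    (mul_nonneg hθ hD.weight_pos.le)).trans (ha.integral_le hD hp)
  refine le_of_mul_le_mul_left ?_ hD.weight_pos
  linarith

lemma GoodPair.exists_le_of_le_F (hp : GoodPair g F G) {c : ℝ} (hc : 0 < c) :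
    ∃ m₀, 0 < m₀ ∧ ∀ m, 0 < m → c ≤ F m → m₀ ≤ m := by
  have h1 : ∀ᶠ x in 𝓝[≥] (0 : ℝ), F x < c := by
    have := (hp.F_cont 0 self_mem_Ici).tendsto
    rw [hp.F_zero] at this
    exact this.eventually_lt_const hc
  obtain ⟨m₀, hm₀, hsub⟩ := mem_nhdsGE_iff_exists_Ico_subset.1 h1
  refine ⟨m₀, hm₀, fun m hm hcm => ?_⟩
  by_contra! hlt
  have : F m < c := hsub ⟨hm.le, hlt⟩
  linarith

/-- A logarithmic upper bound for `I` by `J`, and bounds on frames in terms of `I` and `J`, imply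
coercivity. -/
lemma isCoercive_of_bounds (hD : IsConvexDomain P h) (hp : GoodPair g F G) {Λ B C : ℝ}
    (hB : 0 ≤ B) (hBΛ : B < Λ)
    (hlog : ∀ v s m p₀ e T, IsAdmissible P h g G v s m p₀ e T →
      Real.log (funI P F v).toReal ≤ B * s + C)
    (hframe : ∀ R c, 0 < c → ∃ L, ∀ v s m p₀ e T, IsAdmissible P h g G v s m p₀ e T → s ≤ R →
      c ≤ (funI P F v).toReal → ∀ i, ‖e i‖ ≤ L) :
    IsCoercive P h g F G Λ := by
  intro E
  -- From `E ≥ -log I + Λ s ≥ (Λ - B) s - C`. The energy bound also gives `I ≥ exp(-E)`, and then `I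
  -- ≤ F(m) L'^n V` keeps `m` away from zero.
  set R := (E + C) / (Λ - B) with hR
  obtain ⟨L, hL⟩ := hframe R (Real.exp (-E)) (Real.exp_pos _)
  set L' := max L 1 with hL'
  have hL'0 : 0 < L' := lt_max_of_lt_right one_pos
  have hV := frameVolume_pos hD.one_le
  obtain ⟨m₀, hm₀, hm⟩ := hp.exists_le_of_le_F (c := Real.exp (-E) / (L' ^ n * frameVolume n))
    (by positivity)
  refine ⟨m₀, R, L', hm₀, hL'0.le, fun v hv hint s hs hGs hE m p₀ e T hf => ?_⟩
  have ha : IsAdmissible P h g G v s m p₀ e T := ⟨hv, hint, hs, hGs, hf⟩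
  have hI := ha.funI_pos hD hp
  have hsR : s ≤ R := by
    rw [hR, le_div_iff₀ (by linarith)]
    have := hlog v s m p₀ e T ha
    linarith
  have hIc : Real.exp (-E) ≤ (funI P F v).toReal := by
    rw [← Real.le_log_iff_exp_le hI]
    have : 0 ≤ Λ * s := mul_nonneg (by linarith) hs.le
    linarith
  have hl : ∀ i, ‖e i‖ ≤ L' := fun i => (hL v s m p₀ e T ha hsR hIc i).trans (le_max_left _ _)
  refine ⟨hm m hf.pos ?_, hsR, hl⟩
  rw [div_le_iff₀ (by positivity)]
  exact hIc.trans (ha.funI_le_pow hD hp hL'0.le hl)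

/-- Growth of `F` at infinity. -/
lemma GoodPair.exists_log_F_le (hp : GoodPair g F G) {ψ : ℝ → ℝ} {M : ℝ}
    (hF : IsBigOWith M atTop (fun t => Real.log (F t)) ψ) (hψ : ∀ᶠ t in atTop, |ψ t| ≤ t) :
    ∃ C, ∀ t, 0 < t → Real.log (F t) ≤ max M 0 * t + C := by
  obtain ⟨t₀, ht₀⟩ := eventually_atTop.1 ((hF.bound.and hψ).and (eventually_gt_atTop 0))
  obtain ⟨-, ht₀0⟩ := ht₀ t₀ le_rfl
  refine ⟨|Real.log (F t₀)|, fun t ht => ?_⟩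
  rcases le_or_gt t₀ t with h1 | h1
  · obtain ⟨⟨h2, h3⟩, -⟩ := ht₀ t h1
    have h4 : Real.log (F t) ≤ M * |ψ t| := (le_abs_self _).trans h2
    have h5 : M * |ψ t| ≤ max M 0 * t :=
      mul_le_mul (le_max_left _ _) h3 (abs_nonneg _) (le_max_right _ _)
    linarith [abs_nonneg (Real.log (F t₀))]
  · have h2 := Real.log_le_log (hp.F_pos ht) (hp.F_le ht.le h1.le)
    have h3 : 0 ≤ max M 0 * t := mul_nonneg (le_max_right _ _) ht.le
    linarith [le_abs_self (Real.log (F t₀))]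

lemma exists_mul_log_le (a : ℝ) {η : ℝ} (hη : 0 < η) (ha : 0 ≤ a) :
    ∃ C, ∀ t, 0 < t → a * Real.log t ≤ η * t + C := by
  rcases ha.eq_or_lt with rfl | ha
  · exact ⟨0, fun t ht => by nlinarith⟩
  refine ⟨-a * Real.log (η / a), fun t ht => ?_⟩
  have h1 := Real.log_le_sub_one_of_pos (x := η / a * t) (by positivity)
  rw [Real.log_mul (by positivity) ht.ne'] at h1
  have h2 := mul_le_mul_of_nonneg_left h1 ha.le
  have h3 : a * (η / a * t - 1) = η * t - a := by
    field_simp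
  linarith

/-- Here `G` is affine, so the slab estimate with `θ = 1/2` reads `κ δ ‖e i‖ / 2 ≤ s` for the
longest edge. Hence `I ≤ F(s) (a s)^n V`, and `log I` grows like `M s` plus a logarithm, which is
absorbed by a slope `1/2`. -/
lemma isCoercive_of_isH1 (hD : IsConvexDomain P h) (hp : GoodPair g F G) {M Λ : ℝ}
    (h1 : IsH1 M F G) (hΛ : max M 0 + 1 ≤ Λ) : IsCoercive P h g F G Λ := by
  obtain ⟨c, hc, hGc⟩ := h1.G_deriv_const
  have hG : ∀ t, 0 < t → G t = G 1 + c * (t - 1) := by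
    intro t ht
    have hgc : ∀ x, 0 < x → g x = c := fun x hx => (hp.G_deriv x hx).unique (hGc x hx)
    have h2 := hp.le_tangent one_pos ht
    have h3 := hp.le_tangent ht one_pos
    rw [hgc 1 one_pos] at h2
    rw [hgc t ht] at h3
    linarith
  obtain ⟨δ, hδ⟩ := exists_isSlabWidth hD (θ := 1 / 2) (by norm_num)
  have hδ0 := hδ.1
  set κ := frameRatio n with hκ
  have hκ0 : 0 < κ := frameRatio_pos n
  have hV := frameVolume_pos hD.one_le
  set a := 2 / (κ * δ) with ha
  have ha0 : 0 < a := by positivity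
  have hl : ∀ v s m p₀ e T, IsAdmissible P h g G v s m p₀ e T → ∀ j, ‖e j‖ ≤ a * s := by
    intro v s m p₀ e T hadm j
    obtain ⟨i, hi, hGi⟩ := hadm.exists_index hD hp (by norm_num) hδ
    refine (hi j).trans ?_
    have hm := hadm.frame.pos
    have hm' : 0 < max m (δ * ‖e i‖) := lt_max_of_lt_left hm
    rw [hG _ (mul_pos hκ0 hm'), hG _ (mul_pos hκ0 hm), hG s hadm.s_pos] at hGi
    have h2 : c * (κ * max m (δ * ‖e i‖) / 2) ≤ c * s := by
      have : 0 ≤ c * (κ * m) := by positivity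
      linarith
    have h3 := le_of_mul_le_mul_left h2 hc
    have h4 : κ * (δ * ‖e i‖) ≤ κ * max m (δ * ‖e i‖) := by gcongr; exact le_max_right _ _
    rw [ha, div_mul_eq_mul_div, le_div_iff₀ (by positivity)]
    linarith
  obtain ⟨C₁, hC₁⟩ := hp.exists_log_F_le h1.log_F
    (by filter_upwards [eventually_ge_atTop 0] with t ht; rw [abs_of_nonneg ht])
  obtain ⟨C₂, hC₂⟩ := exists_mul_log_le n (η := 1 / 2) (by norm_num) (by positivity)
  refine isCoercive_of_bounds hD hp (B := max M 0 + 1 / 2)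
    (C := C₁ + C₂ + n * Real.log a + Real.log (frameVolume n))
    (by have := le_max_right M 0; linarith) (by linarith) (fun v s m p₀ e T hadm => ?_)
    fun R c' _ => ⟨a * R, fun v s m p₀ e T hadm hsR _ j =>
      (hl v s m p₀ e T hadm j).trans (by gcongr)⟩
  have hs := hadm.s_pos
  have hI := hadm.funI_pos hD hp
  have h2 := hadm.funI_le_pow hD hp (l := a * s) (by positivity) (hl v s m p₀ e T hadm)
  have h3 : (funI P F v).toReal ≤ F s * ((a * s) ^ n * frameVolume n) := by
    refine h2.trans ?_
    gcongr
    exact hp.F_le hadm.frame.pos.le (hadm.m_le hD hp)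
  have h4 := Real.log_le_log hI h3
  have hFs := hp.F_pos hs
  rw [Real.log_mul hFs.ne' (by positivity), Real.log_mul (by positivity) hV.ne', Real.log_pow,
    Real.log_mul ha0.ne' hs.ne'] at h4
  have h5 := hC₁ s hs
  have h6 := hC₂ s hs
  linarith

end FreeBdyMA

namespace FreeBdyMA

variable {n : ℕ} {P : Set (EuclideanSpace ℝ (Fin n))} {h : EuclideanSpace ℝ (Fin n) → ℝ}
  {v : EuclideanSpace ℝ (Fin n) → ℝ} {g F G : ℝ → ℝ} {s m : ℝ} {p₀ : EuclideanSpace ℝ (Fin n)}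
  {e : Fin n → EuclideanSpace ℝ (Fin n)}
  {T : EuclideanSpace ℝ (Fin n) →ₗ[ℝ] EuclideanSpace ℝ (Fin n)}
  {μ : Measure (EuclideanSpace ℝ (Fin n))}

/-! ### Integrals of radial functions of linear images -/

lemma integral_comp_linearMap_le {C : ℝ} (hC0 : 0 ≤ C) (hC : μ ≤ ENNReal.ofReal C • volume)
    {φ : EuclideanSpace ℝ (Fin n) → ℝ} (hφ0 : ∀ z, 0 ≤ φ z) (hφ : Integrable φ)
    (hT : LinearMap.det T ≠ 0) :
    Integrable (fun y => φ (T y)) μ ∧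
      ∫ y, φ (T y) ∂μ ≤ C * (|LinearMap.det T|⁻¹ * ∫ z, φ z) := by
  have hmap := Measure.map_linearMap_addHaar_eq_smul_addHaar
    (volume : Measure (EuclideanSpace ℝ (Fin n))) hT
  have hTm : AEMeasurable T (volume : Measure (EuclideanSpace ℝ (Fin n))) :=
    (LinearMap.continuous_of_finiteDimensional T).measurable.aemeasurable
  have hφ' : Integrable φ (Measure.map T volume) := by
    rw [hmap]
    exact hφ.smul_measure ENNReal.ofReal_ne_top
  have h1 : Integrable (fun y => φ (T y)) (ENNReal.ofReal C • volume) :=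
    (hφ'.comp_aemeasurable hTm).smul_measure ENNReal.ofReal_ne_top
  refine ⟨h1.mono_measure hC, ?_⟩
  calc ∫ y, φ (T y) ∂μ ≤ ∫ y, φ (T y) ∂(ENNReal.ofReal C • volume) :=
        integral_mono_measure hC (ae_of_all _ fun y => hφ0 _) h1
    _ = C * (|LinearMap.det T|⁻¹ * ∫ z, φ z) := by
        rw [integral_smul_measure, ENNReal.toReal_ofReal hC0, ← integral_map hTm hφ'.1, hmap,
          integral_smul_measure, ENNReal.toReal_ofReal (abs_nonneg _), abs_inv, smul_eq_mul,
          smul_eq_mul]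

lemma integrable_max_one_norm_rpow {p : ℝ} (hp : (n : ℝ) < p) :
    Integrable fun z : EuclideanSpace ℝ (Fin n) => (max 1 ‖z‖) ^ (-p) := by
  have hp0 : 0 < p := n.cast_nonneg.trans_lt hp
  have h1 : Integrable fun z : EuclideanSpace ℝ (Fin n) => 2 ^ p * (1 + ‖z‖) ^ (-p) :=
    (integrable_one_add_norm (by simpa using hp)).const_mul _
  refine h1.mono' (Measurable.aestronglyMeasurable (by fun_prop)) (ae_of_all _ fun z => ?_)
  have h2 : (1 + ‖z‖) / 2 ≤ max 1 ‖z‖ := by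
    linarith [le_max_left 1 ‖z‖, le_max_right 1 ‖z‖]
  have h3 : (0 : ℝ) < max 1 ‖z‖ := lt_max_of_lt_left one_pos
  rw [Real.norm_eq_abs, abs_of_nonneg (by positivity)]
  calc (max 1 ‖z‖) ^ (-p) ≤ ((1 + ‖z‖) / 2) ^ (-p) :=
        Real.rpow_le_rpow_of_nonpos (by positivity) h2 (by linarith)
    _ = 2 ^ p * (1 + ‖z‖) ^ (-p) := by
        rw [Real.div_rpow (by positivity) (by norm_num), Real.rpow_neg (x := 2) (by norm_num),
          div_inv_eq_mul, mul_comm]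

/-- Scaling: with `z = m⁻¹ T y` the integrand is `m^(-(n+γ))` times a fixed function, integrable on
the whole space because `γ > 0`, and the Jacobian contributes `m^n / |det T|`. -/
lemma exists_integral_max_rpow_le {C : ℝ} (hC0 : 0 ≤ C) (hC : μ ≤ ENNReal.ofReal C • volume)
    {γ : ℝ} (hγ : 0 < γ) :
    ∃ C', 0 ≤ C' ∧ ∀ (T : EuclideanSpace ℝ (Fin n) →ₗ[ℝ] EuclideanSpace ℝ (Fin n)) (m : ℝ),
      LinearMap.det T ≠ 0 → 0 < m →
      Integrable (fun y => (max m ‖T y‖) ^ (-((n : ℝ) + γ))) μ ∧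
      ∫ y, (max m ‖T y‖) ^ (-((n : ℝ) + γ)) ∂μ ≤ C' * (|LinearMap.det T|⁻¹ * m ^ (-γ)) := by
  set φ : EuclideanSpace ℝ (Fin n) → ℝ := fun z => (max 1 ‖z‖) ^ (-((n : ℝ) + γ)) with hφ
  have hφ0 : ∀ z, 0 ≤ φ z := fun z => by positivity
  have hφi : Integrable φ := integrable_max_one_norm_rpow (by linarith)
  refine ⟨C * ∫ z, φ z, mul_nonneg hC0 (integral_nonneg hφ0), fun T m hT hm => ?_⟩
  have hdet : LinearMap.det (m⁻¹ • T) = m⁻¹ ^ n * LinearMap.det T := by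
    rw [LinearMap.det_smul, finrank_euclideanSpace_fin]
  have hne : LinearMap.det (m⁻¹ • T) ≠ 0 := by
    rw [hdet]
    positivity
  obtain ⟨hi, hle⟩ := integral_comp_linearMap_le hC0 hC hφ0 hφi hne
  have heq : ∀ y, (max m ‖T y‖) ^ (-((n : ℝ) + γ)) =
      m ^ (-((n : ℝ) + γ)) * φ ((m⁻¹ • T) y) := by
    intro y
    rw [hφ, ← Real.mul_rpow hm.le (by positivity), LinearMap.smul_apply, norm_smul, norm_inv,
      Real.norm_eq_abs, abs_of_pos hm, mul_max_of_nonneg _ _ hm.le, mul_one,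
      mul_inv_cancel_left₀ hm.ne']
  simp_rw [heq]
  refine ⟨hi.const_mul _, ?_⟩
  rw [integral_const_mul]
  refine (mul_le_mul_of_nonneg_left hle (by positivity)).trans_eq ?_
  rw [hdet, abs_mul, abs_of_pos (by positivity : 0 < m⁻¹ ^ n), mul_inv, neg_add,
    Real.rpow_add hm, Real.rpow_neg hm.le, Real.rpow_natCast, inv_pow, inv_inv]
  field_simp

/-- The truncation at `1` removes the singularity, so in polar coordinates only the tail `r > κ⁻¹`
needs the integrability of `G` at infinity. -/
lemma integrable_radial (hn : 1 ≤ n) (hG : IntegrableOn (fun s => G s * s ^ ((n : ℝ) - 1)) (Ioi 1))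
    {κ : ℝ} (hκ : 0 < κ) :
    Integrable fun z : EuclideanSpace ℝ (Fin n) => -G (max 1 (κ * ‖z‖)) := by
  have hne : Nonempty (Fin n) := ⟨⟨0, hn⟩⟩
  refine (integrable_fun_norm_addHaar volume (f := fun r => -G (max 1 (κ * r)))).2 ?_
  rw [finrank_euclideanSpace_fin]
  have h1 : IntegrableOn (fun r : ℝ => r ^ (n - 1) • -G (max 1 (κ * r))) (Ioc 0 κ⁻¹) := by
    have : IntegrableOn (fun r : ℝ => r ^ (n - 1) * -G 1) (Ioc 0 κ⁻¹) :=
      (Continuous.integrableOn_Icc (by fun_prop)).mono_set Ioc_subset_Icc_self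
    refine this.congr_fun (fun r hr => ?_) measurableSet_Ioc
    have : κ * r ≤ 1 := by
      have := mul_le_mul_of_nonneg_left hr.2 hκ.le
      rwa [mul_inv_cancel₀ hκ.ne'] at this
    simp [max_eq_left this]
  have h2 : IntegrableOn (fun r : ℝ => r ^ (n - 1) • -G (max 1 (κ * r))) (Ioi κ⁻¹) := by
    have h3 : IntegrableOn (fun r : ℝ => G (κ * r) * (κ * r) ^ ((n : ℝ) - 1)) (Ioi κ⁻¹) := by
      refine (integrableOn_Ioi_comp_mul_left_iff (fun s => G s * s ^ ((n : ℝ) - 1)) κ⁻¹ hκ).2 ?_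
      rwa [mul_inv_cancel₀ hκ.ne']
    refine IntegrableOn.congr_fun (h3.const_mul (-(κ ^ (n - 1))⁻¹)) (fun r hr => ?_)
      measurableSet_Ioi
    have hr0 : 0 < r := (inv_pos.2 hκ).trans hr
    have : 1 ≤ κ * r := by
      have := mul_le_mul_of_nonneg_left (le_of_lt hr) hκ.le
      rwa [mul_inv_cancel₀ hκ.ne'] at this
    have h4 : (κ * r) ^ ((n : ℝ) - 1) = (κ * r) ^ (n - 1) := by
      rw [← Real.rpow_natCast, Nat.cast_sub hn, Nat.cast_one]
    simp only [h4, max_eq_right this, smul_eq_mul, mul_pow]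
    field_simp
  have h3 := h1.union h2
  rwa [Ioc_union_Ioi_eq_Ioi (inv_pos.2 hκ).le] at h3

end FreeBdyMA

namespace FreeBdyMA

variable {n : ℕ} {P : Set (EuclideanSpace ℝ (Fin n))} {h : EuclideanSpace ℝ (Fin n) → ℝ}
  {v : EuclideanSpace ℝ (Fin n) → ℝ} {g F G : ℝ → ℝ} {s m : ℝ} {p₀ : EuclideanSpace ℝ (Fin n)}
  {e : Fin n → EuclideanSpace ℝ (Fin n)}
  {T : EuclideanSpace ℝ (Fin n) →ₗ[ℝ] EuclideanSpace ℝ (Fin n)}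

/-! ### Coercivity under the third structural condition -/

/-- `-G` is at most a power of exponent `-(n+ν')` where its argument is at most `1`, and an
integrable radial tail elsewhere; after the linear change of variables both carry `|det T|⁻¹`. The
requirement `ν' > 0` makes the power integrable at infinity even if `ν = 0`. -/
lemma exists_integral_neg_G_le (hD : IsConvexDomain P h) {ν γ β₁ β₂ a A d D b B M : ℝ}
    (h3 : IsH3 n ν γ β₁ β₂ a A d D b B M F G) (hp : GoodPair g F G) {ν' κ : ℝ} (hν : ν ≤ ν')
    (hν0 : 0 < ν') (hκ : 0 < κ) :
    ∃ C, 0 ≤ C ∧ ∀ (T : EuclideanSpace ℝ (Fin n) →ₗ[ℝ] EuclideanSpace ℝ (Fin n)) (m : ℝ),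
      LinearMap.det T ≠ 0 → 0 < m →
      -∫ y, G (κ * max m ‖T y‖) ∂weight P h ≤ C * (|LinearMap.det T|⁻¹ * (m ^ (-ν') + 1)) := by
  have := hD.isFiniteMeasure
  obtain ⟨C₀, hC0, hC⟩ := exists_weight_le hD.condA1 hD.isOpen
  obtain ⟨C₁, hC₁, hrad⟩ := exists_integral_max_rpow_le hC0 hC hν0
  have hA : 0 < A := by
    have h1 := h3.G_lower 1 (by norm_num)
    have h2 := h3.G_neg 1 one_pos
    rw [Real.one_rpow, mul_one] at h1
    linarith
  set ω : EuclideanSpace ℝ (Fin n) → ℝ := fun z => -G (max 1 (κ * ‖z‖)) with hω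
  have hω0 : ∀ z, 0 ≤ ω z := fun z =>
    (neg_pos.2 (h3.G_neg _ (lt_max_of_lt_left one_pos))).le
  have hωi : Integrable ω := integrable_radial hD.one_le h3.G_int hκ
  set C₂ := C₀ * ∫ z, ω z with hC₂
  have hC₂0 : 0 ≤ C₂ := mul_nonneg hC0 (integral_nonneg hω0)
  set a₁ := A * κ ^ (-((n : ℝ) + ν')) with ha₁
  have ha₁0 : 0 < a₁ := by positivity
  refine ⟨max (a₁ * C₁) C₂, le_max_of_le_right hC₂0, fun T m hT hm => ?_⟩
  obtain ⟨hi₁, hle₁⟩ := hrad T m hT hm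
  obtain ⟨hi₂, hle₂⟩ := integral_comp_linearMap_le hC0 hC hω0 hωi hT
  have hpt : ∀ y, -G (κ * max m ‖T y‖) ≤
      a₁ * (max m ‖T y‖) ^ (-((n : ℝ) + ν')) + ω (T y) := by
    intro y
    have hmax : 0 < max m ‖T y‖ := lt_max_of_lt_left hm
    have ht : 0 < κ * max m ‖T y‖ := mul_pos hκ hmax
    rcases le_or_gt (κ * max m ‖T y‖) 1 with h1 | h1
    · have h2 := h3.G_lower _ ⟨ht, h1⟩
      have h4 : (κ * max m ‖T y‖) ^ (-((n : ℝ) + ν)) ≤ (κ * max m ‖T y‖) ^ (-((n : ℝ) + ν')) :=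
        Real.rpow_le_rpow_of_exponent_ge ht h1 (by linarith)
      have h5 := mul_le_mul_of_nonneg_left h4 hA.le
      rw [Real.mul_rpow (z := -((n : ℝ) + ν')) hκ.le hmax.le, ← mul_assoc] at h5
      linarith [hω0 (T y)]
    · have h2 : G (max 1 (κ * ‖T y‖)) ≤ G (κ * max m ‖T y‖) := by
        refine hp.G_le (lt_max_of_lt_left one_pos) (max_le h1.le ?_)
        gcongr
        exact le_max_right _ _
      have h4 : 0 ≤ a₁ * (max m ‖T y‖) ^ (-((n : ℝ) + ν')) := by positivity
      simp only [hω]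
      linarith
  have hint : Integrable (fun y => G (κ * max m ‖T y‖)) (weight P h) :=
    integrable_of_continuousOn hD.bounded hD.ae_mem
      (IsFrame.continuous_integrand hm hp hκ).continuousOn
  have hle := integral_mono hint.neg ((hi₁.const_mul a₁).add hi₂) hpt
  simp only [Pi.neg_apply] at hle
  rw [integral_neg, integral_add' (hi₁.const_mul a₁) hi₂, integral_const_mul] at hle
  have hd : 0 ≤ |LinearMap.det T|⁻¹ := by positivity
  have hpow : 0 ≤ m ^ (-ν') := by positivity
  calc -∫ y, G (κ * max m ‖T y‖) ∂weight P h
      ≤ a₁ * (C₁ * (|LinearMap.det T|⁻¹ * m ^ (-ν'))) + C₂ * |LinearMap.det T|⁻¹ := by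
        refine hle.trans (add_le_add (mul_le_mul_of_nonneg_left hle₁ ha₁0.le) ?_)
        linarith
    _ = (a₁ * C₁) * (|LinearMap.det T|⁻¹ * m ^ (-ν')) + C₂ * |LinearMap.det T|⁻¹ := by ring
    _ ≤ max (a₁ * C₁) C₂ * (|LinearMap.det T|⁻¹ * m ^ (-ν')) +
        max (a₁ * C₁) C₂ * |LinearMap.det T|⁻¹ := by
        gcongr
        · exact le_max_left _ _
        · exact le_max_right _ _
    _ = _ := by ring

/-- The determinant cancels between the volume bound for `I` and the bound for `-G(s)`, leaving a
function of `m` only. -/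
lemma exists_funI_mul_le (hD : IsConvexDomain P h) {ν γ β₁ β₂ a A d D b B M : ℝ}
    (h3 : IsH3 n ν γ β₁ β₂ a A d D b B M F G) (hp : GoodPair g F G) {ν' : ℝ} (hν : ν ≤ ν')
    (hν0 : 0 < ν') :
    ∃ C, 0 ≤ C ∧ ∀ v s m p₀ e T, IsAdmissible P h g G v s m p₀ e T →
      (funI P F v).toReal * -G s ≤ C * (F m * (m ^ (-ν') + 1)) := by
  obtain ⟨C, hC, hle⟩ := exists_integral_neg_G_le hD h3 hp hν hν0 (frameRatio_pos n)
  have hH := hD.weight_pos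
  have hV := frameVolume_pos hD.one_le
  refine ⟨C * frameVolume n / (weight P h).real univ, by positivity,
    fun v s m p₀ e T ha => ?_⟩
  have hm := ha.frame.pos
  have hdet : 0 < |LinearMap.det T| := abs_pos.2 ha.frame.det_ne
  have hF := hp.F_pos hm
  have h1 := hle T m ha.frame.det_ne hm
  have h2 := ha.integral_le hD hp
  have h4 : (weight P h).real univ * -G s ≤ C * (|LinearMap.det T|⁻¹ * (m ^ (-ν') + 1)) := by
    linarith
  have h5 := ha.funI_le_det hD hp
  have hG : 0 ≤ -G s := (neg_pos.2 (h3.G_neg s ha.s_pos)).le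
  have hI := ha.funI_pos hD hp
  rw [div_mul_eq_mul_div, le_div_iff₀ hH]
  calc (funI P F v).toReal * -G s * (weight P h).real univ
      = (funI P F v).toReal * ((weight P h).real univ * -G s) := by ring
    _ ≤ (F m * (|LinearMap.det T| * frameVolume n)) *
        (C * (|LinearMap.det T|⁻¹ * (m ^ (-ν') + 1))) := by
        refine mul_le_mul h5 h4 (mul_nonneg hH.le hG) (by positivity)
    _ = C * frameVolume n * (F m * (m ^ (-ν') + 1)) := by
        field_simp

/-- A slightly weakened form of the growth of `F`, with the constant `η` in the place of the
implicit constant. -/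
lemma isCoercive_of_isH3 (hD : IsConvexDomain P h) (hp : GoodPair g F G)
    {ν γ β₁ β₂ a A d D b B M η Λ : ℝ} (h3 : IsH3 n ν γ β₁ β₂ a A d D b B M F G)
    (hη : IsBigOWith η atTop (fun s => Real.log (F s))
      (fun s => s ^ (((n : ℝ) + β₁) / ((n : ℝ) + β₂)))) (hΛ : max η 0 < Λ) :
    IsCoercive P h g F G Λ := by
  have hn0 : (0 : ℝ) < n := by exact_mod_cast hD.one_le
  have hν0 := h3.nu_nonneg
  have hνγ := h3.nu_lt
  have hβ₁ := h3.beta_nonneg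
  have hβ := h3.beta_le
  have hd := h3.d_pos
  -- An exponent strictly between `ν` and `γ`: it is positive, and `F(m) m^(-ν')` tends to `0` with
  -- `m`, which later bounds `m` from below.
  set ν' := (ν + γ) / 2 with hν'
  have hν'0 : 0 < ν' := by linarith
  obtain ⟨C, hC0, hC⟩ := exists_funI_mul_le hD h3 hp (ν' := ν') (by linarith) hν'0
  have hB : 0 < B := by
    have h1 := h3.F_upper 1 (by norm_num)
    have h2 := hp.F_pos one_pos
    rw [Real.one_rpow, mul_one] at h1
    linarith
  set κ := frameRatio n with hκ
  have hκ0 : 0 < κ := frameRatio_pos n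
  have hV := frameVolume_pos hD.one_le
  have hsmall : ∀ m, 0 < m → m ≤ 1 → F m * (m ^ (-ν') + 1) ≤ 2 * B * m ^ (γ - ν') := by
    intro m hm hm1
    have h1 := h3.F_upper m ⟨hm, hm1⟩
    have h2 : 1 ≤ m ^ (-ν') := Real.one_le_rpow_of_pos_of_le_one_of_nonpos hm hm1 (by linarith)
    calc F m * (m ^ (-ν') + 1) ≤ (B * m ^ γ) * (2 * m ^ (-ν')) := by
          gcongr
          linarith
      _ = 2 * B * (m ^ γ * m ^ (-ν')) := by ring
      _ = 2 * B * m ^ (γ - ν') := by rw [← Real.rpow_add hm, sub_eq_add_neg]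
  have hlarge : ∀ m, 1 ≤ m → F m * (m ^ (-ν') + 1) ≤ 2 * F m := by
    intro m hm
    have h1 : m ^ (-ν') ≤ 1 := Real.rpow_le_one_of_one_le_of_nonpos hm (by linarith)
    have h2 := hp.F_pos (one_pos.trans_le hm)
    nlinarith
  have hFm : ∀ m s, 0 < m → m ≤ s → F m * (m ^ (-ν') + 1) ≤ 2 * B + 2 * F s := by
    intro m s hm hms
    have hFs := hp.F_pos (hm.trans_le hms)
    rcases le_or_gt m 1 with h1 | h1
    · refine (hsmall m hm h1).trans ?_
      have : m ^ (γ - ν') ≤ 1 := Real.rpow_le_one hm.le h1 (by linarith)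
      nlinarith
    · refine (hlarge m h1.le).trans ?_
      have := hp.F_le hm.le hms
      linarith
  -- The polynomial lower bound on `-G(s)` costs only a multiple of `log(1 + s)` in the bound for
  -- `log I`; half of the gap between `Λ` and `max η 0` absorbs it.
  have hGs : ∃ d' , 0 < d' ∧ ∀ s, 0 < s → d' * (1 + s) ^ (-((n : ℝ) + β₂)) ≤ -G s := by
    have hG1 := h3.G_neg 1 one_pos
    refine ⟨min d (-G 1), lt_min hd (by linarith), fun s hs => ?_⟩
    have h0 : 0 ≤ (1 + s) ^ (-((n : ℝ) + β₂)) := by positivity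
    rcases le_or_gt 1 s with h1 | h1
    · have h2 : (1 + s) ^ (-((n : ℝ) + β₂)) ≤ s ^ (-((n : ℝ) + β₂)) :=
        Real.rpow_le_rpow_of_nonpos hs (by linarith) (by linarith)
      have h4 := h3.G_upper_top s h1
      have h5 : min d (-G 1) * (1 + s) ^ (-((n : ℝ) + β₂)) ≤ d * s ^ (-((n : ℝ) + β₂)) :=
        mul_le_mul (min_le_left _ _) h2 h0 hd.le
      linarith
    · have h2 : (1 + s) ^ (-((n : ℝ) + β₂)) ≤ 1 :=
        Real.rpow_le_one_of_one_le_of_nonpos (by linarith) (by linarith)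
      have h4 := hp.G_le hs h1.le
      have h5 : min d (-G 1) * (1 + s) ^ (-((n : ℝ) + β₂)) ≤ -G 1 * 1 :=
        mul_le_mul (min_le_right _ _) h2 h0 (by linarith)
      linarith
  obtain ⟨d', hd', hGd⟩ := hGs
  obtain ⟨C₁, hC₁⟩ := hp.exists_log_F_le hη (by
    filter_upwards [eventually_ge_atTop 1] with t ht
    rw [abs_of_nonneg (by positivity)]
    refine (Real.rpow_le_rpow_of_exponent_le ht (y := ((n : ℝ) + β₁) / ((n : ℝ) + β₂)) (z := 1)
      ?_).trans_eq (Real.rpow_one t)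
    rw [div_le_one (by linarith)]
    linarith)
  set ζ := (Λ - max η 0) / 2 with hζ
  have hζ0 : 0 < ζ := by linarith
  obtain ⟨C₂, hC₂⟩ := exists_mul_log_le ((n : ℝ) + β₂) hζ0 (by linarith)
  set c₀ := max η 0 with hc₀
  have hc₀0 : 0 ≤ c₀ := le_max_right _ _
  set Q := C * (2 * B + 2 * Real.exp C₁) + 1 with hQ
  have hQ0 : 0 < Q := by positivity
  refine isCoercive_of_bounds hD hp (B := c₀ + ζ) (C := Real.log Q - Real.log d' + ζ + C₂)
    (by linarith) (by linarith) (fun v s m p₀ e T ha => ?_) fun R c hc => ?_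
  · have hs := ha.s_pos
    have hI := ha.funI_pos hD hp
    have h1 : (funI P F v).toReal * -G s ≤ Q * Real.exp (c₀ * s) := by
      have hexp : 1 ≤ Real.exp (c₀ * s) := Real.one_le_exp (by positivity)
      have hF : F s ≤ Real.exp C₁ * Real.exp (c₀ * s) := by
        rw [← Real.exp_add, ← Real.log_le_iff_le_exp (hp.F_pos hs)]
        linarith [hC₁ s hs]
      calc (funI P F v).toReal * -G s ≤ C * (2 * B + 2 * F s) :=
            (hC v s m p₀ e T ha).trans
              (mul_le_mul_of_nonneg_left (hFm m s ha.frame.pos (ha.m_le hD hp)) hC0)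
        _ ≤ C * (2 * B * Real.exp (c₀ * s) + 2 * (Real.exp C₁ * Real.exp (c₀ * s))) := by
            have := le_mul_of_one_le_right (show 0 ≤ 2 * B by positivity) hexp
            exact mul_le_mul_of_nonneg_left (by linarith) hC0
        _ = C * (2 * B + 2 * Real.exp C₁) * Real.exp (c₀ * s) := by ring
        _ ≤ Q * Real.exp (c₀ * s) := by
            gcongr
            linarith
    have h2 : (funI P F v).toReal * (d' * (1 + s) ^ (-((n : ℝ) + β₂))) ≤
        Q * Real.exp (c₀ * s) := (mul_le_mul_of_nonneg_left (hGd s hs) hI.le).trans h1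
    have h4 := Real.log_le_log (by positivity) h2
    rw [Real.log_mul hI.ne' (by positivity), Real.log_mul hd'.ne' (by positivity),
      Real.log_rpow (by positivity), Real.log_mul hQ0.ne' (Real.exp_pos _).ne',
      Real.log_exp] at h4
    have h5 := hC₂ (1 + s) (by positivity)
    linarith
  · have hR : ∃ m₁, 0 < m₁ ∧ ∀ v s m p₀ e T, IsAdmissible P h g G v s m p₀ e T → s ≤ R →
        c ≤ (funI P F v).toReal → m₁ ≤ m := by
      rcases le_or_gt R 0 with hR0 | hR0
      · exact ⟨1, one_pos, fun v s m p₀ e T ha hsR _ => absurd ha.s_pos (by linarith)⟩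
      have hGR : 0 < -G R := neg_pos.2 (h3.G_neg R hR0)
      set q := c * -G R / (C * (2 * B) + 1) with hq
      have hq0 : 0 < q := by positivity
      refine ⟨min 1 (q ^ (γ - ν')⁻¹), lt_min one_pos (by positivity),
        fun v s m p₀ e T ha hsR hcI => ?_⟩
      have hm := ha.frame.pos
      rcases le_or_gt 1 m with h1 | h1
      · exact (min_le_left _ _).trans h1
      refine (min_le_right _ _).trans ?_
      have h2 : c * -G R ≤ (C * (2 * B) + 1) * m ^ (γ - ν') := by
        calc c * -G R ≤ (funI P F v).toReal * -G s := by
              have := hp.G_le ha.s_pos hsR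
              gcongr
          _ ≤ C * (2 * B * m ^ (γ - ν')) :=
              (hC v s m p₀ e T ha).trans (mul_le_mul_of_nonneg_left (hsmall m hm h1.le) hC0)
          _ ≤ (C * (2 * B) + 1) * m ^ (γ - ν') := by
              have : 0 ≤ m ^ (γ - ν') := by positivity
              linarith
      have h4 : q ≤ m ^ (γ - ν') := by
        rw [hq, div_le_iff₀ (by positivity)]
        linarith
      calc q ^ (γ - ν')⁻¹ ≤ (m ^ (γ - ν')) ^ (γ - ν')⁻¹ := by
            refine Real.rpow_le_rpow hq0.le h4 (inv_nonneg.2 (by linarith))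
        _ = m := Real.rpow_rpow_inv hm.le (by linarith)
    obtain ⟨m₁, hm₁, hmm₁⟩ := hR
    rcases le_or_gt R 0 with hR0 | hR0
    · exact ⟨0, fun v s m p₀ e T ha hsR _ => absurd ha.s_pos (by linarith)⟩
    have hGR : 0 < -G R := neg_pos.2 (h3.G_neg R hR0)
    have hGm : 0 < -G (κ * m₁) := neg_pos.2 (h3.G_neg _ (by positivity))
    -- With this slab fraction the loss inside the slab is at most half of `-G R`. A long edge makes
    -- `G` at that length exceed `G R / 2`, and the two together contradict `G s ≤ G R`.
    set θ := -G R / (2 * -G (κ * m₁)) with hθ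
    have hθ0 : 0 < θ := by positivity
    obtain ⟨δ, hδ⟩ := exists_isSlabWidth hD hθ0
    have hδ0 := hδ.1
    obtain ⟨t₀, ht₀⟩ := eventually_atTop.1
      ((h3.G_lim.eventually_const_lt (show G R / 2 < 0 by linarith)).and (eventually_gt_atTop 0))
    have ht₀0 := (ht₀ t₀ le_rfl).2
    refine ⟨t₀ / (κ * δ), fun v s m p₀ e T ha hsR hcI j => ?_⟩
    obtain ⟨i, hi, hGi⟩ := ha.exists_index hD hp hθ0.le hδ
    refine (hi j).trans ?_
    by_contra! hlt
    rw [div_lt_iff₀ (by positivity)] at hlt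
    have hm := ha.frame.pos
    have h1 : t₀ ≤ κ * max m (δ * ‖e i‖) := by
      have : κ * (δ * ‖e i‖) ≤ κ * max m (δ * ‖e i‖) := by gcongr; exact le_max_right _ _
      linarith
    have h2 := (ht₀ _ h1).1
    have h4 : G (κ * m₁) ≤ G (κ * m) :=
      hp.G_le (by positivity) (by gcongr; exact hmm₁ v s m p₀ e T ha hsR hcI)
    have h5 := hp.G_le ha.s_pos hsR
    have h6 : G (κ * max m (δ * ‖e i‖)) < 0 := h3.G_neg _ (by linarith)
    have h7 : θ * (G (κ * max m (δ * ‖e i‖)) - G (κ * m)) ≤ θ * -G (κ * m₁) := by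
      gcongr
      linarith
    have h8 : θ * -G (κ * m₁) = -G R / 2 := by
      have hne : G (κ * m₁) ≠ 0 := (neg_pos.1 hGm).ne
      rw [hθ]
      field_simp
    linarith

end FreeBdyMA

namespace FreeBdyMA

variable {n : ℕ} {P : Set (EuclideanSpace ℝ (Fin n))} {h : EuclideanSpace ℝ (Fin n) → ℝ}
  {v : EuclideanSpace ℝ (Fin n) → ℝ} {g F G : ℝ → ℝ} {s m : ℝ} {p₀ : EuclideanSpace ℝ (Fin n)}
  {e : Fin n → EuclideanSpace ℝ (Fin n)}
  {T : EuclideanSpace ℝ (Fin n) →ₗ[ℝ] EuclideanSpace ℝ (Fin n)}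

/-! ### Coercivity under the second structural condition -/

/-- For `γ = 0` the lower bound would keep `F` above `b` near `0`, against continuity and `F 0 = 0`.
-/
lemma IsH2.gamma_pos {ν γ a A b B : ℝ} {M : ℝ → ℝ} (h2 : IsH2 n ν γ a A b B M F G)
    (hp : GoodPair g F G) : 0 < γ := by
  rcases (h2.nu_nonneg.trans h2.nu_le).eq_or_lt with h0 | h0
  · obtain ⟨m₀, hm₀, hm⟩ := hp.exists_le_of_le_F h2.b_pos
    have h1 : 0 < min 1 (m₀ / 2) := lt_min one_pos (by linarith)
    have h3 := h2.F_lower _ ⟨h1, min_le_left _ _⟩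
    rw [← h0, Real.rpow_zero, mul_one] at h3
    have := hm _ h1 h3
    linarith [min_le_right 1 (m₀ / 2)]
  · exact h0

lemma IsH2.neg_le {ν γ a A b B : ℝ} {M : ℝ → ℝ} (h2 : IsH2 n ν γ a A b B M F G)
    (hp : GoodPair g F G) {t : ℝ} (ht : 0 < t) : max (-G t) 0 ≤ A * t ^ (-((n : ℝ) + γ)) := by
  have hA : 0 ≤ A := by
    have h1 := h2.G_lower 1 (by norm_num)
    rw [Real.one_rpow, mul_one, h2.G_one] at h1
    linarith
  refine max_le ?_ (by positivity)
  rcases le_or_gt t 1 with h1 | h1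
  · have h3 := h2.G_lower t ⟨ht, h1⟩
    have h4 : t ^ (-((n : ℝ) + ν)) ≤ t ^ (-((n : ℝ) + γ)) :=
      Real.rpow_le_rpow_of_exponent_ge ht h1 (by linarith [h2.nu_le])
    have := mul_le_mul_of_nonneg_left h4 hA
    linarith
  · have h3 := hp.G_le one_pos h1.le
    rw [h2.G_one] at h3
    have : 0 ≤ A * t ^ (-((n : ℝ) + γ)) := by positivity
    linarith

/-- For `m ≤ 1`, the bounds `c ≤ I ≤ B m^γ |det T| V` control exactly the factor `|det T|⁻¹ m^(-γ)`
produced by scaling, so no gap between `ν` and `γ` is needed. For `m > 1` the argument of `G` is at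
least `κ`. -/
lemma exists_integral_neg_part_le (hD : IsConvexDomain P h) {ν γ a A b B : ℝ} {M : ℝ → ℝ}
    (h2 : IsH2 n ν γ a A b B M F G) (hp : GoodPair g F G) {c : ℝ} (hc : 0 < c) :
    ∃ K, ∀ v s m p₀ e T, IsAdmissible P h g G v s m p₀ e T → c ≤ (funI P F v).toReal →
      ∫ y, max (-G (frameRatio n * max m ‖T y‖)) 0 ∂weight P h ≤ K := by
  have := hD.isFiniteMeasure
  obtain ⟨C₀, hC0, hC⟩ := exists_weight_le hD.condA1 hD.isOpen
  obtain ⟨C₁, hC₁, hrad⟩ := exists_integral_max_rpow_le hC0 hC (h2.gamma_pos hp)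
  set κ := frameRatio n with hκ
  have hκ0 : 0 < κ := frameRatio_pos n
  have hV := frameVolume_pos hD.one_le
  have hA : 0 ≤ A := by
    simpa using (le_max_right _ _).trans (h2.neg_le hp one_pos)
  have hB : 0 ≤ B := by
    have h1 := h2.F_upper 1 (by norm_num)
    have h3 := hp.F_pos one_pos
    rw [Real.one_rpow, mul_one] at h1
    linarith
  set a₁ := A * κ ^ (-((n : ℝ) + γ)) with ha₁
  have ha₁0 : 0 ≤ a₁ := by positivity
  refine ⟨max (a₁ * (C₁ * (B * frameVolume n / c)))
    ((weight P h).real univ * max (-G κ) 0), fun v s m p₀ e T ha hcI => ?_⟩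
  have hm := ha.frame.pos
  have hint : Integrable (fun y => max (-G (κ * max m ‖T y‖)) 0) (weight P h) :=
    integrable_of_continuousOn hD.bounded hD.ae_mem
      ((IsFrame.continuous_integrand hm hp hκ0).neg.max continuous_const).continuousOn
  rcases le_or_gt m 1 with h1 | h1
  · refine le_max_of_le_left ?_
    obtain ⟨hi, hle⟩ := hrad T m ha.frame.det_ne hm
    have hdet : 0 < |LinearMap.det T| := abs_pos.2 ha.frame.det_ne
    have h3 : ∫ y, max (-G (κ * max m ‖T y‖)) 0 ∂weight P h ≤
        ∫ y, a₁ * (max m ‖T y‖) ^ (-((n : ℝ) + γ)) ∂weight P h := by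
      refine integral_mono hint (hi.const_mul _) fun y => ?_
      have hmax : 0 < max m ‖T y‖ := lt_max_of_lt_left hm
      refine (h2.neg_le hp (mul_pos hκ0 hmax)).trans_eq ?_
      rw [Real.mul_rpow hκ0.le hmax.le, mul_assoc]
    rw [integral_const_mul] at h3
    have h4 : |LinearMap.det T|⁻¹ * m ^ (-γ) ≤ B * frameVolume n / c := by
      have h5 : c ≤ B * m ^ γ * (|LinearMap.det T| * frameVolume n) := by
        refine hcI.trans ((ha.funI_le_det hD hp).trans ?_)
        gcongr
        exact h2.F_upper m ⟨hm, h1⟩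
      have hmγ : 0 < m ^ γ := by positivity
      rw [Real.rpow_neg hm.le, ← mul_inv, inv_le_iff_one_le_mul₀ (by positivity),
        div_mul_eq_mul_div, le_div_iff₀ hc]
      linarith
    refine h3.trans (mul_le_mul_of_nonneg_left (hle.trans ?_) ha₁0)
    exact mul_le_mul_of_nonneg_left h4 hC₁
  · refine le_max_of_le_right ?_
    have h3 : ∫ y, max (-G (κ * max m ‖T y‖)) 0 ∂weight P h ≤
        ∫ _, max (-G κ) 0 ∂weight P h := by
      refine integral_mono hint (integrable_const _) fun y => max_le_max ?_ le_rfl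
      refine neg_le_neg (hp.G_le hκ0 ?_)
      exact le_mul_of_one_le_right hκ0.le (h1.le.trans (le_max_left _ _))
    rwa [integral_const, smul_eq_mul] at h3

/-- `G` changes sign, so its negative part is bounded separately; for the positive part Markov's
inequality applies, since at least half of the mass lies outside the slab of the longest edge. -/
lemma exists_index_of_isH2 (hD : IsConvexDomain P h) {ν γ a A b B : ℝ} {M : ℝ → ℝ}
    (h2 : IsH2 n ν γ a A b B M F G) (hp : GoodPair g F G) {δ : ℝ}
    (hδ : IsSlabWidth P h (1 / 2) δ) {c : ℝ} (hc : 0 < c) :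
    ∃ K, 0 ≤ K ∧ ∀ v s m p₀ e T, IsAdmissible P h g G v s m p₀ e T → c ≤ (funI P F v).toReal →
      ∃ i, (∀ j, ‖e j‖ ≤ ‖e i‖) ∧ G (frameRatio n * max m (δ * ‖e i‖)) / 2 ≤ G s + K := by
  have := hD.isFiniteMeasure
  have hne : Nonempty (Fin n) := ⟨⟨0, hD.one_le⟩⟩
  obtain ⟨K, hK⟩ := exists_integral_neg_part_le hD h2 hp hc
  set κ := frameRatio n with hκ
  have hκ0 : 0 < κ := frameRatio_pos n
  set H := (weight P h).real univ with hH
  have hH0 : 0 < H := hD.weight_pos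
  refine ⟨max K 0 / H, by positivity, fun v s m p₀ e T ha hcI => ?_⟩
  obtain ⟨i, hi⟩ := Finite.exists_max fun j => ‖e j‖
  refine ⟨i, hi, ?_⟩
  have hm := ha.frame.pos
  have hcont := IsFrame.continuous_integrand (T := T) hm hp hκ0
  have hneg : Integrable (fun y => max (-G (κ * max m ‖T y‖)) 0) (weight P h) :=
    integrable_of_continuousOn hD.bounded hD.ae_mem (hcont.neg.max continuous_const).continuousOn
  have hposi : Integrable (fun y => max (G (κ * max m ‖T y‖)) 0) (weight P h) :=
    integrable_of_continuousOn hD.bounded hD.ae_mem (hcont.max continuous_const).continuousOn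
  have hsplit : ∫ y, G (κ * max m ‖T y‖) ∂weight P h =
      ∫ y, max (G (κ * max m ‖T y‖)) 0 ∂weight P h -
        ∫ y, max (-G (κ * max m ‖T y‖)) 0 ∂weight P h := by
    rw [← integral_sub hposi hneg]
    have hab : ∀ r : ℝ, r = max r 0 - max (-r) 0 := by
      intro r
      rcases le_total 0 r with h0 | h0
      · rw [max_eq_left h0, max_eq_right (by linarith), sub_zero]
      · rw [max_eq_right h0, max_eq_left (by linarith), zero_sub, neg_neg]
    exact integral_congr_ae (ae_of_all _ fun y => hab _)
  set q := max (G (κ * max m (δ * ‖e i‖))) 0 with hq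
  have hq0 : 0 ≤ q := le_max_right _ _
  set S := {y | |inner ℝ (e i) y| < δ * ‖e i‖} with hS
  have hSm : MeasurableSet S := (isOpen_lt (by fun_prop) continuous_const).measurableSet
  have hSμ : H / 2 ≤ (weight P h).real Sᶜ := by
    have h3 : (weight P h).real S ≤ 1 / 2 * H :=
      ENNReal.toReal_le_of_le_ofReal (by positivity) (hδ.2 (e i))
    rw [measureReal_compl hSm]
    linarith
  have hsub : Sᶜ ⊆ {y | q ≤ max (G (κ * max m ‖T y‖)) 0} := by
    intro y hy
    have h3 : δ * ‖e i‖ ≤ |inner ℝ (e i) y| := not_lt.1 hy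
    have h4 : |inner ℝ (e i) y| ≤ ‖T y‖ := by
      rw [← ha.frame.apply_eq, ← Real.norm_eq_abs]
      exact PiLp.norm_apply_le (T y) i
    refine max_le_max (hp.G_le (mul_pos hκ0 (lt_max_of_lt_left hm)) ?_) le_rfl
    have h5 := h3.trans h4
    gcongr
  have h3 := mul_meas_ge_le_integral_of_nonneg
    (ae_of_all _ fun y => le_max_right (G (κ * max m ‖T y‖)) 0) hposi q
  have h4 : q * (H / 2) ≤ ∫ y, max (G (κ * max m ‖T y‖)) 0 ∂weight P h :=
    (mul_le_mul_of_nonneg_left (hSμ.trans (measureReal_mono hsub)) hq0).trans h3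
  have h5 := ha.integral_le hD hp
  have h6 := hK v s m p₀ e T ha hcI
  have h7 : G (κ * max m (δ * ‖e i‖)) ≤ q := le_max_left _ _
  have h8 : q / 2 * H ≤ (G s + max K 0 / H) * H := by
    rw [add_mul, div_mul_cancel₀ _ hH0.ne']
    linarith [le_max_left K 0]
  have := le_of_mul_le_mul_right h8 hH0
  linarith

lemma GoodPair.Ginv_mem_Ioc (hp : GoodPair g F G) (h1 : G 1 = 0) {x s : ℝ} (hx : 0 ≤ x)
    (hs : 0 < s) (hxs : x ≤ G s) : Ginv G x ∈ Ioc 0 s := by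
  have h1s : 1 ≤ s := hp.le_of_G_le one_pos hs (by linarith)
  have hcont : ContinuousOn G (Icc 1 s) :=
    hp.G_cont.mono fun t ht => one_pos.trans_le ht.1
  obtain ⟨t, ht, rfl⟩ := intermediate_value_Icc h1s hcont ⟨h1.trans_le hx, hxs⟩
  have ht0 : 0 < t := one_pos.trans_le ht.1
  rw [hp.Ginv_eq ht0]
  exact ⟨ht0, ht.2⟩

/-- For a long edge of length `l` the index estimate gives `ε G(ε l) ≤ G(s)`, so the growth
condition yields `log F(l) ≤ c₀ s`, and convexity of `F` turns this into `log l ≤ c₀ s + C`. Then `I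
≤ F(s) l^n V` has logarithm at most `(n + 1) c₀ s + C`: one `c₀` from `F(s)`, and `n` from the
volume. -/
lemma isCoercive_of_isH2 (hD : IsConvexDomain P h) (hp : GoodPair g F G)
    {ν γ a A b B η Λ δ ε : ℝ} {M : ℝ → ℝ} (h2 : IsH2 n ν γ a A b B M F G)
    (hδ : IsSlabWidth P h (1 / 2) δ) (hε0 : 0 < ε) (hε : ε ≤ 1 / 4) (hεδ : ε ≤ frameRatio n * δ)
    (hη : IsBigOWith η atTop (fun x => Real.log (F x)) (fun x => Ginv G (ε * G (ε * x))))
    (hΛ : ((n : ℝ) + 1) * max η 0 < Λ) : IsCoercive P h g F G Λ := by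
  have hδ0 := hδ.1
  set κ := frameRatio n with hκ
  have hκ0 : 0 < κ := frameRatio_pos n
  have hV := frameVolume_pos hD.one_le
  set c₀ := max η 0 with hc₀
  have hc₀0 : 0 ≤ c₀ := le_max_right _ _
  have hGε : Tendsto (fun x => G (ε * x)) atTop atTop :=
    h2.G_top.comp (tendsto_id.const_mul_atTop hε0)
  obtain ⟨C₁, hC₁⟩ := hp.exists_log_F_le hη (by
    filter_upwards [eventually_gt_atTop 0, hGε.eventually_ge_atTop 0] with t ht hGt
    have h3 : ε * G (ε * t) ≤ G t := by
      have h4 : G (ε * t) ≤ G t := hp.G_le (by positivity) (by nlinarith)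
      nlinarith
    obtain ⟨h4, h5⟩ := hp.Ginv_mem_Ioc h2.G_one (mul_nonneg hε0.le hGt) ht h3
    rwa [abs_of_pos h4])
  -- The threshold `1` suffices for the logarithmic bound, which is trivial when `I ≤ 1`. Beyond
  -- `L₀` the constant `K` is at most a quarter of `G(ε l)`.
  obtain ⟨K, hK0, hK⟩ := exists_index_of_isH2 hD h2 hp hδ one_pos
  obtain ⟨L₀, hL₀⟩ := eventually_atTop.1 ((hη.bound.and (hGε.eventually_ge_atTop (4 * K))).and
    (eventually_ge_atTop 1))
  have hL₀1 : 1 ≤ L₀ := (hL₀ L₀ le_rfl).2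
  have hF1 : 0 < F 1 := hp.F_pos one_pos
  have hFlin : ∀ l, 1 ≤ l → l * F 1 ≤ F l := by
    intro l hl
    have h3 := h2.F_convex.2 (show (0 : ℝ) ∈ Ici 0 from self_mem_Ici)
      (show l ∈ Ici (0 : ℝ) from zero_le_one.trans hl)
      (sub_nonneg.2 (inv_le_one_of_one_le₀ hl)) (by positivity) (sub_add_cancel 1 l⁻¹)
    have hl0 : l ≠ 0 := by positivity
    simp only [smul_eq_mul, mul_zero, zero_add, h2.F_zero, inv_mul_cancel₀ hl0] at h3
    have h4 := mul_le_mul_of_nonneg_left h3 (show 0 ≤ l by positivity)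
    rwa [mul_inv_cancel_left₀ hl0] at h4
  set C₂ := max (Real.log L₀) (-Real.log (F 1)) with hC₂
  have hlogl : ∀ v s m p₀ e T, IsAdmissible P h g G v s m p₀ e T →
      1 ≤ (funI P F v).toReal → ∃ l, 1 ≤ l ∧ (∀ j, ‖e j‖ ≤ l) ∧
        Real.log l ≤ c₀ * s + C₂ := by
    intro v s m p₀ e T ha hI
    have hs := ha.s_pos
    obtain ⟨i, hi, hGi⟩ := hK v s m p₀ e T ha hI
    rcases le_or_gt ‖e i‖ L₀ with hl | hl
    · refine ⟨L₀, hL₀1, fun j => (hi j).trans hl, ?_⟩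
      have : 0 ≤ c₀ * s := by positivity
      linarith [le_max_left (Real.log L₀) (-Real.log (F 1))]
    · obtain ⟨⟨h3, h4⟩, h5⟩ := hL₀ _ hl.le
      refine ⟨‖e i‖, h5, hi, ?_⟩
      have hpos : 0 < ‖e i‖ := by positivity
      have h6 : G (ε * ‖e i‖) ≤ G (κ * max m (δ * ‖e i‖)) := by
        refine hp.G_le (by positivity) ?_
        calc ε * ‖e i‖ ≤ κ * δ * ‖e i‖ := by gcongr
          _ = κ * (δ * ‖e i‖) := by ring
          _ ≤ κ * max m (δ * ‖e i‖) := by gcongr; exact le_max_right _ _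
      have h7 : 0 ≤ G (ε * ‖e i‖) := by linarith
      have h8 : ε * G (ε * ‖e i‖) ≤ 1 / 4 * G (ε * ‖e i‖) := by gcongr
      obtain ⟨h9, h10⟩ := hp.Ginv_mem_Ioc h2.G_one (mul_nonneg hε0.le h7) hs
        (show ε * G (ε * ‖e i‖) ≤ G s by linarith)
      have h11 : Real.log (F ‖e i‖) ≤ c₀ * s := by
        refine (le_abs_self _).trans (h3.trans ?_)
        rw [Real.norm_eq_abs, abs_of_pos h9]
        exact mul_le_mul (le_max_left _ _) h10 h9.le hc₀0
      have h12 := Real.log_le_log (by positivity) (hFlin _ h5)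
      rw [Real.log_mul hpos.ne' hF1.ne'] at h12
      linarith [le_max_right (Real.log L₀) (-Real.log (F 1))]
  refine isCoercive_of_bounds hD hp (B := ((n : ℝ) + 1) * c₀)
    (C := max (C₁ + n * C₂ + Real.log (frameVolume n)) 0) (by positivity) hΛ
    (fun v s m p₀ e T ha => ?_) fun R c hc => ?_
  · have hs := ha.s_pos
    have hI := ha.funI_pos hD hp
    rcases le_or_gt (funI P F v).toReal 1 with h3 | h3
    · have h4 := Real.log_nonpos hI.le h3
      have h5 : 0 ≤ ((n : ℝ) + 1) * c₀ * s := by positivity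
      linarith [le_max_right (C₁ + n * C₂ + Real.log (frameVolume n)) 0]
    · obtain ⟨l, hl1, hl, hlog⟩ := hlogl v s m p₀ e T ha h3.le
      have hl0 : 0 < l := by linarith
      have hFs := hp.F_pos hs
      have h4 : (funI P F v).toReal ≤ F s * (l ^ n * frameVolume n) := by
        refine (ha.funI_le_pow hD hp hl0.le hl).trans ?_
        gcongr
        exact hp.F_le ha.frame.pos.le (ha.m_le hD hp)
      have h5 := Real.log_le_log hI h4
      rw [Real.log_mul hFs.ne' (by positivity), Real.log_mul (by positivity) hV.ne',
        Real.log_pow] at h5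
      have h6 := hC₁ s hs
      have h7 : (n : ℝ) * Real.log l ≤ n * (c₀ * s + C₂) := by gcongr
      linarith [le_max_left (C₁ + n * C₂ + Real.log (frameVolume n)) 0]
  · rcases le_or_gt R 0 with hR0 | hR0
    · exact ⟨0, fun v s m p₀ e T ha hsR _ => absurd ha.s_pos (by linarith)⟩
    obtain ⟨K', hK'0, hK'⟩ := exists_index_of_isH2 hD h2 hp hδ hc
    obtain ⟨t₀, ht₀⟩ := eventually_atTop.1 (h2.G_top.eventually_gt_atTop (2 * (G R + K')))
    refine ⟨t₀ / (κ * δ), fun v s m p₀ e T ha hsR hcI j => ?_⟩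
    obtain ⟨i, hi, hGi⟩ := hK' v s m p₀ e T ha hcI
    refine (hi j).trans ?_
    by_contra! hlt
    rw [div_lt_iff₀ (by positivity)] at hlt
    have h3 : t₀ ≤ κ * max m (δ * ‖e i‖) := by
      have : κ * (δ * ‖e i‖) ≤ κ * max m (δ * ‖e i‖) := by gcongr; exact le_max_right _ _
      linarith
    have h4 := ht₀ _ h3
    have h5 := hp.G_le ha.s_pos hsR
    linarith

end FreeBdyMA

namespace FreeBdyMA

variable {n : ℕ} {P : Set (EuclideanSpace ℝ (Fin n))} {h : EuclideanSpace ℝ (Fin n) → ℝ}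
  {f g F G : ℝ → ℝ}

/-! ### Existence of minimizers -/

lemma attainsInf_of_isH1 (hD : IsConvexDomain P h) (hb : BarycenterZero P h) {M Λ : ℝ}
    (hfg : IsAntiderivPair f g F G) (h1 : IsH1 M F G) (hΛ : max M 0 + 1 ≤ Λ) :
    AttainsInf P h g F G Λ := by
  obtain ⟨c, -, hGc⟩ := h1.G_deriv_const
  have hconc : ConcaveOn ℝ (Ioi 0) G := by
    refine AntitoneOn.concaveOn_of_deriv (convex_Ioi 0)
      (fun x hx => (hGc x hx).continuousAt.continuousWithinAt) ?_ ?_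
    · rw [interior_Ioi]
      exact fun x hx => (hGc x hx).differentiableAt.differentiableWithinAt
    · rw [interior_Ioi]
      intro x hx y hy _
      rw [(hGc x hx).deriv, (hGc y hy).deriv]
  have hp := hfg.goodPair hconc
  refine attainsInf_of_isCoercive hD hp
    (hasNormalization_of_const hD hb fun s hs => (hfg.G_deriv s hs).unique (hGc s hs))
    (by linarith [le_max_right M 0]) (isCoercive_of_isH1 hD hp h1 hΛ)

lemma attainsInf_of_isH2 (hD : IsConvexDomain P h) {vo ν γ a A b B η Λ δ ε : ℝ} {M : ℝ → ℝ}
    (hvo : IsVanishingOrder P h vo) (hν : vo ≤ ν)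
    (hfg : IsAntiderivPair f g F G) (h2 : IsH2 n ν γ a A b B M F G)
    (hδ : IsSlabWidth P h (1 / 2) δ) (hε0 : 0 < ε) (hε : ε ≤ 1 / 4) (hεδ : ε ≤ frameRatio n * δ)
    (hη : IsBigOWith η atTop (fun x => Real.log (F x)) (fun x => Ginv G (ε * G (ε * x))))
    (hΛ : ((n : ℝ) + 1) * max η 0 < Λ) : AttainsInf P h g F G Λ := by
  have hp := hfg.goodPair h2.G_concave
  have hη0 := le_max_right η 0
  exact attainsInf_of_isCoercive hD hp
    (hasNormalization_of_divergence hD hp (hasDivergence hD hp hvo hν h2.G_div))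
    (lt_of_le_of_lt (by positivity) hΛ) (isCoercive_of_isH2 hD hp h2 hδ hε0 hε hεδ hη hΛ)

lemma attainsInf_of_isH3 (hD : IsConvexDomain P h) {vo ν γ β₁ β₂ a A d D b B M η Λ : ℝ}
    (hvo : IsVanishingOrder P h vo) (hν : vo ≤ ν)
    (hfg : IsAntiderivPair f g F G) (h3 : IsH3 n ν γ β₁ β₂ a A d D b B M F G)
    (hη : IsBigOWith η atTop (fun s => Real.log (F s))
      (fun s => s ^ (((n : ℝ) + β₁) / ((n : ℝ) + β₂)))) (hΛ : max η 0 < Λ) :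
    AttainsInf P h g F G Λ := by
  have hp := hfg.goodPair h3.G_concave
  exact attainsInf_of_isCoercive hD hp
    (hasNormalization_of_divergence hD hp (hasDivergence hD hp hvo hν h3.G_div))
    ((le_max_right _ _).trans_lt hΛ) (isCoercive_of_isH3 hD hp h3 hη hΛ)

end FreeBdyMA

/-! ### Choice of the threshold in the three cases -/

theorem mainTheorem11 (n : ℕ) (hn : 1 ≤ n) (P : Set (EuclideanSpace ℝ (Fin n)))
    (hPo : IsOpen P) (hPc : Convex ℝ P) (hPb : Bornology.IsBounded P) (hP0 : 0 ∈ P)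
    (h : EuclideanSpace ℝ (Fin n) → ℝ) (hA1 : FreeBdyMA.CondA1 P h)
    (hA2 : ∃ vo : ℝ, FreeBdyMA.IsVanishingOrder P h vo) :
    -- Property H1
    (FreeBdyMA.BarycenterZero P h →
      ∀ M : ℝ, ∃ Λ₀ : ℝ, 0 ≤ Λ₀ ∧ ∀ f g F G : ℝ → ℝ,
        FreeBdyMA.IsAntiderivPair f g F G → FreeBdyMA.IsH1 M F G →
        ∀ Λ : ℝ, Λ₀ ≤ Λ → FreeBdyMA.AttainsInf P h g F G Λ) ∧
    -- Property H2
    (∀ ν γ a A b B : ℝ, ∀ M : ℝ → ℝ,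
      (∃ vo : ℝ, FreeBdyMA.IsVanishingOrder P h vo ∧ vo ≤ ν) →
      (∃ Λ₀ : ℝ, 0 ≤ Λ₀ ∧ ∀ f g F G : ℝ → ℝ,
        FreeBdyMA.IsAntiderivPair f g F G → FreeBdyMA.IsH2 n ν γ a A b B M F G →
        ∀ Λ : ℝ, Λ₀ ≤ Λ → FreeBdyMA.AttainsInf P h g F G Λ) ∧
      (∀ f g F G : ℝ → ℝ,
        FreeBdyMA.IsAntiderivPair f g F G → FreeBdyMA.IsH2 n ν γ a A b B M F G →
        FreeBdyMA.StrongH2Growth F G →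
        ∀ Λ : ℝ, 0 < Λ → FreeBdyMA.AttainsInf P h g F G Λ)) ∧
    -- Property H3
    (∀ ν γ β₁ β₂ a A d D b B M : ℝ,
      (∃ vo : ℝ, FreeBdyMA.IsVanishingOrder P h vo ∧ vo ≤ ν) →
      (∃ Λ₀ : ℝ, 0 ≤ Λ₀ ∧ ∀ f g F G : ℝ → ℝ,
        FreeBdyMA.IsAntiderivPair f g F G → FreeBdyMA.IsH3 n ν γ β₁ β₂ a A d D b B M F G →
        ∀ Λ : ℝ, Λ₀ ≤ Λ → FreeBdyMA.AttainsInf P h g F G Λ) ∧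
      (∀ f g F G : ℝ → ℝ,
        FreeBdyMA.IsAntiderivPair f g F G → FreeBdyMA.IsH3 n ν γ β₁ β₂ a A d D b B M F G →
        FreeBdyMA.StrongH3Growth n β₁ β₂ F →
        ∀ Λ : ℝ, 0 < Λ → FreeBdyMA.AttainsInf P h g F G Λ)) := by
  have hD : FreeBdyMA.IsConvexDomain P h := ⟨hn, hPo, hPc, hPb, hP0, hA1⟩
  refine ⟨fun hb M => ?_, fun ν γ a A b B M ⟨vo, hvo, hν⟩ => ?_,
    fun ν γ β₁ β₂ a A d D b B M ⟨vo, hvo, hν⟩ => ⟨?_, ?_⟩⟩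
  · refine ⟨max M 0 + 1, by linarith [le_max_right M 0], fun f g F G hfg h1 Λ hΛ => ?_⟩
    exact FreeBdyMA.attainsInf_of_isH1 hD hb hfg h1 hΛ
  -- `δ` and `ε` come from `n`, `P` and `h` alone, before `F` and `G` are introduced, so the
  -- threshold depends on the pair only through `M ε`.
  · obtain ⟨δ, hδ⟩ := FreeBdyMA.exists_isSlabWidth hD (θ := 1 / 2) (by norm_num)
    have hκδ : 0 < FreeBdyMA.frameRatio n * δ := mul_pos (FreeBdyMA.frameRatio_pos n) hδ.1
    obtain ⟨ε, hε0, hε, hεδ⟩ : ∃ ε : ℝ, 0 < ε ∧ ε ≤ 1 / 4 ∧ ε ≤ FreeBdyMA.frameRatio n * δ :=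
      ⟨min (1 / 4) (FreeBdyMA.frameRatio n * δ), lt_min (by norm_num) hκδ,
        min_le_left _ _, min_le_right _ _⟩
    have hε1 : ε ∈ Ioo (0 : ℝ) 1 := ⟨hε0, by linarith⟩
    refine ⟨⟨((n : ℝ) + 1) * max (M ε) 0 + 1, ?_, fun f g F G hfg h2 Λ hΛ => ?_⟩,
      fun f g F G hfg h2 hs Λ hΛ => ?_⟩
    · have := le_max_right (M ε) 0
      positivity
    · exact FreeBdyMA.attainsInf_of_isH2 hD hvo hν hfg h2 hδ hε0 hε hεδ (h2.log_F ε hε1)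
        (by linarith)
    -- Little-o growth permits any implicit constant; this one makes `(n + 1) η = Λ / 2 < Λ`.
    · have hη : 0 < Λ / (2 * ((n : ℝ) + 1)) := by positivity
      refine FreeBdyMA.attainsInf_of_isH2 hD hvo hν hfg h2 hδ hε0 hε hεδ
        ((hs ε hε1).forall_isBigOWith hη) ?_
      rw [max_eq_left hη.le]
      field_simp
      linarith
  · refine ⟨max M 0 + 1, by linarith [le_max_right M 0], fun f g F G hfg h3 Λ hΛ => ?_⟩
    exact FreeBdyMA.attainsInf_of_isH3 hD hvo hν hfg h3 h3.log_F (by linarith)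
  · intro f g F G hfg h3 hs Λ hΛ
    refine FreeBdyMA.attainsInf_of_isH3 hD hvo hν hfg h3
      (hs.forall_isBigOWith (half_pos hΛ)) ?_
    rw [max_eq_left (half_pos hΛ).le]
    exact half_lt_self hΛ
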